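/- **Setting.** Let $\Gamma$ be a finitely generated group with a normal subgroup $\Lambda$ of finite index, together with a fixed identification $\Lambda=\mathbb Z^m$, $m\ge 1$. Let $\Delta\ni\mathrm{id}$ be a set of representatives of $\Lambda\backslash\Gamma$, so that $\Gamma=\bigsqcup_{x\in\Delta}\Lambda x$, and let $\Phi:\Gamma\to\mathbb Z^m$ be the map $vx\mapsto v$ for $v\in\Lambda=\mathbb Z^m$, $x\in\Delta$. Write $[\gamma]=\Lambda\gamma$. Let $\mu$ be a probability measure on $\Gamma$ with $\sum_\gamma|\gamma|^2\mu(\gamma)<\infty$ for a word metric $|\cdot|$, whose support $S$ generates $\Gamma$ as a semigroup. Let $\mu_n$ be its $n$th convolution power, and let $q$ be its period, i.e. the greatest common divisor of the integers $n\ge1$ for which there are $s_1,\dots,s_n\in S$ with $s_1\cdots s_n=\mathrm{id}$. The associated weighted diagram $G$ has vertex set $V=\Lambda\backslash\Gamma$ and edges $e=([\gamma],s)$ with $s\in S\cup S^{-1}$, where $oe=[\gamma]$, $te=[\gamma s]$, $\bar e=([\gamma s],s^{-1})$, and weights $p(e)=\mu(s)$. For a probability distribution $\pi$ on $V$ that is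 stationary ($\sum_{te=x}\pi(oe)p(e)=\pi(x)$ for all $x$) put $c(e)=\pi(oe)p(e)$. A $1$-form is a function $\omega:E(G)\to\mathbb R$ with $\omega(\bar e)=-\omega(e)$. It is *harmonic* if $\sum_e\omega(e)^2c(e)<\infty$ and $$-\frac1{\pi(x)}\sum_{oe=x}c(e)\omega(e)+\sum_{e}\omega(e)c(e)=0\qquad\text{for all }x\in V.$$ A *harmonic part* of $\omega$ is a harmonic $1$-form $u$ such that for some $f:V\to\mathbb R$ one has $\omega(e)=u(e)+f(te)-f(oe)$ for all $e$. For $e=([\gamma],s)$ let $\Phi_e=\Phi(\gamma s)-\Phi(\gamma)$ (which does not depend on the choice of $\gamma$ in its coset), let $\zeta_c=\sum_e c(e)\Phi_e$, and for $v\in\mathbb R^m$ let $\widehat v(e)=\langle v,\Phi_e\rangle$. For a positive definite $m\times m$ matrix $\Sigma$ let $$\xi_\Sigma(v)=\frac{1}{(2\pi)^{m/2}\sqrt{\det\Sigma}}\,e^{-\frac12\langle v,\Sigma^{-1}v\rangle},\qquad \mathcal N_{n,\Sigma,\zeta}(\gamma)=\pi([\gamma])\,\frac{\xi_{n\Sigma}(\Phi(\gamma)-n\zeta)}{\sum_{w\in\mathbb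 Z^m}\xi_{n\Sigma}(w)} ,$$ where in the first formula $\pi$ is the number $3.14\ldots$. Let $\|f-g\|_{\rm TV}=\frac12\sum_{\gamma}|f(\gamma)-g(\gamma)|$. **Theorem (Local CLT).** The stationary distribution $\pi$ exists, is unique, and is uniform on $\Lambda\backslash\Gamma$. The series defining $\zeta_c$ converges absolutely, and for every $v\in\mathbb R^m$ the $1$-form $\widehat v$ has a unique harmonic part. There is a symmetric positive definite $m\times m$ matrix $\Sigma$ such that $$\langle v_1,\Sigma v_2\rangle=\sum_{e}u_1(e)u_2(e)c(e)-\sum_{e}u_1(e)c(e)\,\sum_{e}u_2(e)c(e)$$ for all $v_1,v_2\in\mathbb R^m$, where $u_i$ is the harmonic part of $\widehat v_i$, and $$\Bigl\|\,q^{-1}\sum_{i=0}^{q-1}\mu_{qn+i}-\mathcal N_{qn,\Sigma,\zeta_c}\Bigr\|_{\rm TV}\longrightarrow 0\qquad(n\to\infty).$$ -/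

import Mathlib

open Filter Topology
open scoped ENNReal Matrix

noncomputable section

/-- A weighted diagram with vertex set `V` and set of directed edges `E`: a multi-digraph closed
under edge reversal, with a weight whose sum over the edges leaving each vertex is `1`. -/
structure WeightedDiagram (V E : Type*) where
  /-- original vertex of an edge -/
  o : E → V
  /-- terminal vertex of an edge -/
  t : E → V
  /-- reversed edge -/
  rev : E → E
  o_rev : ∀ e, o (rev e) = t e
  t_rev : ∀ e, t (rev e) = o e
  rev_rev : ∀ e, rev (rev e) = e
  /-- weight of an edge -/
  p : E → ℝ
  p_nonneg : ∀ e, 0 ≤ p e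
  p_le_one : ∀ e, p e ≤ 1
  sum_p : ∀ x, HasSum (fun e : {e : E // o e = x} => p e) 1

namespace WeightedDiagram

variable {V E : Type*} (G : WeightedDiagram V E)

/-- `π` is a stationary probability distribution of the Markov chain on the vertices. -/
def IsStationary [Fintype V] (π : V → ℝ) : Prop :=
  (∀ x, 0 ≤ π x) ∧ ∑ x, π x = 1 ∧
    ∀ x, HasSum (fun e : {e : E // G.t e = x} => π (G.o e) * G.p e) (π x)

/-- The conductance `c(e) = π(oe) p(e)`. -/
def conductance (π : V → ℝ) (e : E) : ℝ := π (G.o e) * G.p e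

/-- `1`-forms: real functions on edges that change sign under edge reversal. -/
def IsOneForm (ω : E → ℝ) : Prop := ∀ e, ω (G.rev e) = -ω e

/-- The square integrable `1`-forms. -/
def IsL2Form (π : V → ℝ) (ω : E → ℝ) : Prop :=
  G.IsOneForm ω ∧ Summable fun e => ω e ^ 2 * G.conductance π e

/-- The differential `df(e) = f(te) - f(oe)`. -/
def diff (f : V → ℝ) (e : E) : ℝ := f (G.t e) - f (G.o e)

/-- The operator `d^*ω(x) = -π(x)⁻¹ ∑_{oe = x} c(e) ω(e)`. -/
def codiff (π : V → ℝ) (ω : E → ℝ) (x : V) : ℝ :=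
  -(1 / π x) * ∑' e : {e : E // G.o e = x}, G.conductance π e * ω e

/-- The pairing `⟨c, ω⟩ = ∑_e ω(e) c(e)`. -/
def pairing (π : V → ℝ) (ω : E → ℝ) : ℝ := ∑' e, ω e * G.conductance π e

/-- The space `H¹` of harmonic `1`-forms: `d^*ω + ⟨c, ω⟩ = 0`. -/
def IsHarmonic (π : V → ℝ) (ω : E → ℝ) : Prop :=
  G.IsL2Form π ω ∧ ∀ x, G.codiff π ω x + G.pairing π ω = 0

/-- `u` is a harmonic part of `ω`: `u ∈ H¹` and `ω = u + df` for some function `f`. -/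
def IsHarmonicPart (π : V → ℝ) (ω u : E → ℝ) : Prop :=
  G.IsHarmonic π u ∧ ∃ f : V → ℝ, ω = u + G.diff f

end WeightedDiagram

section Walk

variable {Γ : Type*} [Group Γ]

/-- Word length with respect to a set `T` of generators. -/
def wordLength (T : Set Γ) (γ : Γ) : ℕ :=
  sInf {n | ∃ l : List Γ, l.length = n ∧ (∀ g ∈ l, g ∈ T ∨ g⁻¹ ∈ T) ∧ l.prod = γ}

/-- Finite second moment with respect to the word length defined by `T`. -/
def FiniteSecondMoment (T : Set Γ) (μ : PMF Γ) : Prop :=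
  Summable fun γ => (wordLength T γ : ℝ) ^ 2 * (μ γ).toReal

/-- The convolution power `μ_n`: the law of a product of `n` independent steps of law `μ`. -/
def convPow (μ : PMF Γ) : ℕ → PMF Γ
  | 0 => PMF.pure 1
  | n + 1 => (convPow μ n).bind fun g => μ.map fun s => g * s

/-- `q` is the greatest common divisor of the lengths of the nontrivial directed loops at the
identity whose labels lie in the support of `μ`. -/
def IsPeriod (μ : PMF Γ) (q : ℕ) : Prop :=
  q = Nat.setGcd {n | 1 ≤ n ∧ ∃ l : List Γ, l.length = n ∧ (∀ s ∈ l, s ∈ μ.support) ∧ l.prod = 1}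

/-- The total variation distance, as half of the `ℓ¹` distance. -/
def tvDist (f g : Γ → ℝ) : ℝ≥0∞ := (∑' γ, ENNReal.ofReal |f γ - g γ|) / 2

/-- The set `Λ \ Γ` of cosets `Λγ`. -/
abbrev CosetSpace (Λ : Subgroup Γ) : Type _ := Quotient (QuotientGroup.rightRel Λ)

/-- The coset `[γ] = Λγ`. -/
def cosetMk (Λ : Subgroup Γ) (γ : Γ) : CosetSpace Λ := Quotient.mk _ γ

instance (Λ : Subgroup Γ) [Λ.FiniteIndex] : Finite (CosetSpace Λ) :=
  Finite.of_equiv (Γ ⧸ Λ) (QuotientGroup.quotientRightRelEquivQuotientLeftRel Λ).symm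

instance (Λ : Subgroup Γ) [Λ.FiniteIndex] : Fintype (CosetSpace Λ) := Fintype.ofFinite _

/-- The action of `Γ` on `Λ \ Γ` by right translations: `[γ] ↦ [γ s]`. -/
def cosetMul {Λ : Subgroup Γ} (x : CosetSpace Λ) (s : Γ) : CosetSpace Λ :=
  Quotient.map (fun γ => γ * s) (fun a b h => by
    have h' : b * a⁻¹ ∈ Λ := QuotientGroup.rightRel_apply.1 h
    exact QuotientGroup.rightRel_apply.2 (by simpa [mul_assoc] using h')) x

theorem cosetMul_mk {Λ : Subgroup Γ} (γ s : Γ) :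
    cosetMul (cosetMk Λ γ) s = cosetMk Λ (γ * s) := rfl

theorem cosetMul_mul_inv {Λ : Subgroup Γ} (x : CosetSpace Λ) (s : Γ) :
    cosetMul (cosetMul x s) s⁻¹ = x := by
  induction x using Quotient.inductionOn with
  | h γ => exact (congrArg (cosetMk Λ) (mul_inv_cancel_right γ s))

/-- The labels of the Cayley diagram: elements of `S ∪ S⁻¹` with `S` the support of `μ`. -/
abbrev Label (μ : PMF Γ) : Type _ := {s : Γ // s ∈ μ.support ∨ s⁻¹ ∈ μ.support}

/-- The edges `([γ], s)` of the quotient diagram. -/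
abbrev QEdge (Λ : Subgroup Γ) (μ : PMF Γ) : Type _ := CosetSpace Λ × Label μ

theorem hasSum_label (μ : PMF Γ) : HasSum (fun s : Label μ => (μ s).toReal) 1 := by
  have h : HasSum (fun s : Γ => (μ s).toReal) 1 := by
    have := ENNReal.hasSum_toReal (f := μ) (by rw [μ.tsum_coe]; exact ENNReal.one_ne_top)
    simpa [← ENNReal.tsum_toReal_eq (fun a => μ.apply_ne_top a), μ.tsum_coe] using this
  refine (hasSum_subtype_iff_of_support_subset
    (s := {s : Γ | s ∈ μ.support ∨ s⁻¹ ∈ μ.support}) ?_).2 h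
  intro s hs
  left
  rw [PMF.mem_support_iff]
  intro h0
  simp [h0] at hs

theorem hasSum_weight {Λ : Subgroup Γ} (μ : PMF Γ) (x : CosetSpace Λ) :
    HasSum (fun e : {e : QEdge Λ μ // e.1 = x} => (μ e.1.2.1).toReal) 1 := by
  have k : (fun s : Label μ => (⟨(x, s), rfl⟩ : {e : QEdge Λ μ // e.1 = x})).Bijective := by
    refine ⟨fun a b h => ?_, fun e => ⟨e.1.2, Subtype.ext (Prod.ext e.2.symm rfl)⟩⟩
    exact congrArg (fun e => e.1.2) h
  have h := (Equiv.ofBijective _ k).hasSum_iff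
    (f := fun e : {e : QEdge Λ μ // e.1 = x} => (μ e.1.2.1).toReal) (a := 1)
  exact h.1 (hasSum_label μ)

/-- The quotient `Λ \ Cay(Γ, S)` of the Cayley diagram, weighted by `p([γ], s) = μ(s)`. -/
def quotientDiagram (Λ : Subgroup Γ) (μ : PMF Γ) :
    WeightedDiagram (CosetSpace Λ) (QEdge Λ μ) where
  o e := e.1
  t e := cosetMul e.1 e.2
  rev e := (cosetMul e.1 e.2, ⟨(e.2 : Γ)⁻¹, by simpa using e.2.2.symm⟩)
  o_rev _ := rfl
  t_rev e := cosetMul_mul_inv e.1 e.2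
  rev_rev e := by
    refine Prod.ext ?_ (Subtype.ext ?_)
    · exact cosetMul_mul_inv e.1 e.2
    · exact inv_inv _
  p e := (μ e.2).toReal
  p_nonneg _ := ENNReal.toReal_nonneg
  p_le_one e := by
    simpa using ENNReal.toReal_mono ENNReal.one_ne_top (μ.coe_le_one e.2)
  sum_p x := hasSum_weight μ x

variable {Λ : Subgroup Γ} {m : ℕ} {Δ : Set Γ}

/-- The map `Φ : Γ → ℤ^m`, `γ = v x ↦ v` for `v ∈ Λ = ℤ^m` and `x ∈ Δ`. -/
def Phi (φ : Λ ≃* Multiplicative (Fin m → ℤ)) (hΔ : Subgroup.IsComplement (Λ : Set Γ) Δ)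
    (γ : Γ) : Fin m → ℤ :=
  Multiplicative.toAdd (φ (hΔ.equiv γ).1)

theorem Phi_mul (φ : Λ ≃* Multiplicative (Fin m → ℤ))
    (hΔ : Subgroup.IsComplement (Λ : Set Γ) Δ) (l : Λ) (γ : Γ) :
    Phi φ hΔ (l * γ) = Multiplicative.toAdd (φ l) + Phi φ hΔ γ := by
  unfold Phi
  rw [hΔ.equiv_mul_left l γ]
  exact congrArg Multiplicative.toAdd (map_mul φ l (hΔ.equiv γ).1)

/-- `Φ_e = Φ(γ s) - Φ(γ)` for an edge `e = ([γ], s)`, with an arbitrary lift `(γ, s)` of `e`. -/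
def PhiEdge (φ : Λ ≃* Multiplicative (Fin m → ℤ)) (hΔ : Subgroup.IsComplement (Λ : Set Γ) Δ)
    {μ : PMF Γ} (e : QEdge Λ μ) : Fin m → ℝ :=
  Quotient.lift (s := QuotientGroup.rightRel Λ)
    (fun γ => fun i => ((Phi φ hΔ (γ * e.2) i - Phi φ hΔ γ i : ℤ) : ℝ))
    (fun a b h => by
      have h' : b * a⁻¹ ∈ Λ := QuotientGroup.rightRel_apply.1 h
      obtain ⟨l, hl⟩ : ∃ l : Λ, b = l * a := ⟨⟨b * a⁻¹, h'⟩, by simp⟩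
      funext i
      simp only [hl, mul_assoc, Phi_mul, Pi.add_apply]
      congr 1
      ring) e.1

theorem PhiEdge_mk (φ : Λ ≃* Multiplicative (Fin m → ℤ))
    (hΔ : Subgroup.IsComplement (Λ : Set Γ) Δ) {μ : PMF Γ} (γ : Γ) (s : Label μ) :
    PhiEdge φ hΔ ((cosetMk Λ γ, s) : QEdge Λ μ)
      = fun i => ((Phi φ hΔ (γ * s) i - Phi φ hΔ γ i : ℤ) : ℝ) := rfl

/-- The drift `ζ_c = ∑_e c(e) Φ_e`. -/
def drift (φ : Λ ≃* Multiplicative (Fin m → ℤ)) (hΔ : Subgroup.IsComplement (Λ : Set Γ) Δ)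
    (μ : PMF Γ) (π : CosetSpace Λ → ℝ) : Fin m → ℝ :=
  ∑' e : QEdge Λ μ, (quotientDiagram Λ μ).conductance π e • PhiEdge φ hΔ e

/-- The `1`-form `v̂(e) = ⟨v, Φ_e⟩`. -/
def hatForm (φ : Λ ≃* Multiplicative (Fin m → ℤ)) (hΔ : Subgroup.IsComplement (Λ : Set Γ) Δ)
    (μ : PMF Γ) (v : Fin m → ℝ) (e : QEdge Λ μ) : ℝ :=
  v ⬝ᵥ PhiEdge φ hΔ e

/-- The centred Gaussian density `ξ_C` on `ℝ^m` with covariance matrix `C`. -/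
def gaussDensity (C : Matrix (Fin m) (Fin m) ℝ) (v : Fin m → ℝ) : ℝ :=
  1 / ((2 * Real.pi) ^ ((m : ℝ) / 2) * Real.sqrt C.det) * Real.exp (-(1 / 2) * (v ⬝ᵥ C⁻¹ *ᵥ v))

/-- The discretized Gaussian
`N_{n,C,ζ}(γ) = π([γ]) (∑_{w ∈ ℤ^m} ξ_{nC}(w))⁻¹ ξ_{nC}(Φ(γ) - nζ)` on `Γ`. -/
def discreteGaussian (φ : Λ ≃* Multiplicative (Fin m → ℤ))
    (hΔ : Subgroup.IsComplement (Λ : Set Γ) Δ) (π : CosetSpace Λ → ℝ) (n : ℕ)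
    (C : Matrix (Fin m) (Fin m) ℝ) (ζ : Fin m → ℝ) (γ : Γ) : ℝ :=
  π (cosetMk Λ γ) * (1 / ∑' w : Fin m → ℤ, gaussDensity ((n : ℝ) • C) (fun i => (w i : ℝ))) *
    gaussDensity ((n : ℝ) • C) (fun i => (Phi φ hΔ γ i : ℝ) - n * ζ i)

end Walk

end

/-! Two facts are combined: characteristic functions determine the law of the walk at scale √n, and
an ℓ¹ regularity estimate rules out structure at smaller scales.

Regularity. A law on Γ acts on ℓ¹(Γ) through left translations ρ; put P = ∑ μ(s)ρ(s). For a
contraction w, (1-w)((1+w)/2)^n has norm O(n^(-1/2)), because neighbouring binomial coefficients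
nearly agree (`norm_one_sub_mul_half_one_add_pow_le`). For y in the commutative group Λ, the average
U of (1+ρ(y'))/2 over the finitely many conjugates y' of y commutes with ρ(Γ). A law charging 1 and
all y' acts as pU plus a commuting remainder of norm at most 1-p, and so inherits the decay
(`exists_norm_one_sub_mul_convElem_pow_le`). Consequently, translating the period-averaged law at
time N by j ∈ ℤ^m costs O(|j|/√N) + o(1) in ℓ¹ (`exists_tsum_abs_translate_avgProb_sub_le`).

Shape. On the finite quotient every function of mean zero has the form Pf - f, now with P the
transition operator (`exists_transOp_sub_eq`). This Poisson equation is used three times: to make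
the mean increment of v̂ - df the same at all vertices, which is harmonicity and turns the centred
process into a martingale; to average out the dependence of the local variance on the vertex; and to
equidistribute the coset. The outcome is the central limit theorem jointly with the coset
(`tendsto_char_avgProb`). Σ is definite because a vanishing variance would make ⟨v, Φ⟩ - f constant
on Γ (`eq_zero_of_localCov_eq_zero`).

Combination. Smooth the law at time n by a Gaussian on ℤ^m of covariance tnΣ. By regularity this
changes it by O(√t) + o(1) in ℓ¹. By Fourier inversion the smoothed law is within o(n^(-m/2)),
uniformly on Γ, of a multiple of the Gaussian of covariance (1+t)nΣ (`abs_tsum_gaussExp_mul_sub_le`,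
`tendsto_charDefect`). This bounds it below by nearly the target, and since the masses agree
asymptotically, such a one-sided bound controls the ℓ¹ distance (`tsum_abs_sub_le_of_le`). Let n →
∞, then t → 0. -/

noncomputable section

/-! ### Decay of powers of lazy contractions in a normed algebra -/

section NormedRing

theorem norm_pow_le_one' {A : Type*} [NormedRing A] [NormOneClass A] {a : A} (ha : ‖a‖ ≤ 1) (n : ℕ) :
    ‖a ^ n‖ ≤ 1 :=
  (norm_pow_le a n).trans (pow_le_one₀ (norm_nonneg a) ha)

variable {A : Type*} [NormedRing A] [NormOneClass A] [NormedAlgebra ℝ A]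

/-- Cauchy–Schwarz for the binomial weights: the mean absolute deviation is at most the standard
deviation. -/
theorem sum_choose_mul_abs_sub_two_mul_le (n : ℕ) :
    ∑ i ∈ Finset.range (n + 1), (n.choose i : ℝ) * |(n : ℝ) - 2 * i| ≤ 2 ^ n * √(n : ℝ) := by
  have hvar : ∑ i ∈ Finset.range (n + 1), (n.choose i : ℝ) * ((n : ℝ) - 2 * i) ^ 2
      = (2 : ℝ) ^ n * (n : ℝ) := by
    -- The variance of a binomial variable with parameter 1/2, read off from the Bernstein
    -- polynomials at 1/2.
    have h := congrArg (Polynomial.eval (1 / 2 : ℝ)) (bernsteinPolynomial.variance ℝ n)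
    simp only [bernsteinPolynomial, Polynomial.eval_finsetSum, Polynomial.eval_mul,
      Polynomial.eval_pow, Polynomial.eval_sub, Polynomial.eval_X,
      Polynomial.eval_natCast, Polynomial.eval_one, nsmul_eq_mul] at h
    have h2 : ∑ i ∈ Finset.range (n + 1), (n.choose i : ℝ) * ((n : ℝ) - 2 * i) ^ 2
        = 4 * 2 ^ n * ∑ x ∈ Finset.range (n + 1), ((n : ℝ) * (1 / 2) - x) ^ 2 *
          ((n.choose x : ℝ) * (1 / 2) ^ x * (1 - 1 / 2) ^ (n - x)) := by
      rw [Finset.mul_sum]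
      refine Finset.sum_congr rfl fun i hi => ?_
      have hi' : i ≤ n := Nat.lt_succ_iff.1 (Finset.mem_range.1 hi)
      have : (1 / 2 : ℝ) ^ i * (1 - 1 / 2) ^ (n - i) = (1 / 2) ^ n := by
        rw [show (1 - 1 / 2 : ℝ) = 1 / 2 by norm_num, ← pow_add, Nat.add_sub_cancel' hi']
      rw [mul_assoc (n.choose i : ℝ), this]
      have h22 : (2 : ℝ) ^ n * (1 / 2) ^ n = 1 := by rw [← mul_pow]; norm_num
      linear_combination (-(n.choose i : ℝ) * ((n : ℝ) - 2 * i) ^ 2) * h22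
    rw [h2, h]; ring
  have hsum : ∑ i ∈ Finset.range (n + 1), (n.choose i : ℝ) = 2 ^ n := by
    exact_mod_cast Nat.sum_range_choose n
  have hcs := Finset.sum_mul_sq_le_sq_mul_sq (Finset.range (n + 1))
    (fun i => √(n.choose i : ℝ)) (fun i => √(n.choose i : ℝ) * |(n : ℝ) - 2 * i|)
  have e1 : ∀ i : ℕ, √(n.choose i : ℝ) * (√(n.choose i : ℝ) * |(n : ℝ) - 2 * i|)
      = (n.choose i : ℝ) * |(n : ℝ) - 2 * i| := fun i => by
    rw [← mul_assoc, Real.mul_self_sqrt (Nat.cast_nonneg _)]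
  have e2 : ∀ i : ℕ, √(n.choose i : ℝ) ^ 2 = n.choose i := fun i =>
    Real.sq_sqrt (Nat.cast_nonneg _)
  simp only [e1, e2, mul_pow, sq_abs, hvar, hsum] at hcs
  refine abs_le_of_sq_le_sq' ?_ (by positivity) |>.2
  rw [mul_pow, Real.sq_sqrt (Nat.cast_nonneg _)]
  nlinarith

/-- The coefficients of (1-w)(1+w)^n are differences of neighbouring binomial coefficients, so their
absolute sum is a mean deviation of a binomial law. Only ‖w‖ ≤ 1 enters, which suits translations of
ℓ¹. -/
theorem norm_one_sub_mul_half_one_add_pow_le {w : A} (hw : ‖w‖ ≤ 1) (n : ℕ) :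
    ‖(1 - w) * ((1 / 2 : ℝ) • (1 + w)) ^ n‖ ≤ 2 / √(n + 1) := by
  have hexp : ∀ k : ℕ, (1 + w) ^ k = ∑ i ∈ Finset.range (k + 1), (k.choose i : ℝ) • w ^ i := by
    intro k
    rw [add_comm, (Commute.one_right w).add_pow]
    refine Finset.sum_congr rfl fun i _ => ?_
    rw [one_pow, mul_one, ← nsmul_eq_mul', Nat.cast_smul_eq_nsmul]
  -- Coefficientwise: (n+1)(C(n,i) - C(n,i-1)) = C(n+1,i)(n+1-2i).
  have key : ((n : ℝ) + 1) • ((1 - w) * (1 + w) ^ n)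
      = ∑ i ∈ Finset.range (n + 1 + 1),
        (((n + 1).choose i : ℝ) * (((n + 1 : ℕ) : ℝ) - 2 * i)) • w ^ i := by
    have h1 : (1 - w) * (1 + w) ^ n = (1 + w) ^ n - w * (1 + w) ^ n := by
      rw [sub_mul, one_mul]
    have ha : (1 + w) ^ n = ∑ i ∈ Finset.range (n + 1 + 1), (n.choose i : ℝ) • w ^ i := by
      rw [hexp, Finset.sum_range_succ _ (n + 1)]; simp
    have hb : w * (1 + w) ^ n = ∑ i ∈ Finset.range (n + 1 + 1),
        ((if i = 0 then 0 else n.choose (i - 1) : ℕ) : ℝ) • w ^ i := by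
      rw [hexp, Finset.sum_range_succ' _ (n + 1), Finset.mul_sum]
      simp [pow_succ']
    rw [h1, hb, ha, ← Finset.sum_sub_distrib, Finset.smul_sum]
    refine Finset.sum_congr rfl fun i hi => ?_
    rw [← sub_smul, smul_smul]
    congr 1
    rcases i with _ | i
    · simp
    · have hi' : i ≤ n := by simpa using Finset.mem_range.1 hi
      have h2 : ((n + 1) * n.choose i : ℝ) = (n + 1).choose (i + 1) * (i + 1) := by
        exact_mod_cast Nat.add_one_mul_choose_eq n i
      have h3 : ((n + 1).choose (i + 1) : ℝ) = n.choose i + n.choose (i + 1) := by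
        exact_mod_cast Nat.choose_succ_succ n i
      simp only [Nat.add_eq_zero_iff, one_ne_zero, and_false, if_false, Nat.add_sub_cancel]
      push_cast
      linear_combination (-2 : ℝ) * h2 - (n + 1 : ℝ) * h3
  have hn : (0 : ℝ) < n + 1 := by positivity
  have hb : ((n : ℝ) + 1) * ‖(1 - w) * (1 + w) ^ n‖ ≤ 2 ^ (n + 1) * √(n + 1) := by
    rw [← Real.norm_of_nonneg hn.le, ← norm_smul, key]
    refine (norm_sum_le _ _).trans (le_trans (Finset.sum_le_sum fun i _ => ?_)
      (by simpa [Real.norm_of_nonneg hn.le] using sum_choose_mul_abs_sub_two_mul_le (n + 1)))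
    rw [norm_smul, norm_mul, Real.norm_natCast, Real.norm_eq_abs]
    have := norm_pow_le_one' hw i
    push_cast at *
    exact mul_le_of_le_one_right (by positivity) this
  rw [smul_pow, mul_smul_comm, norm_smul, norm_pow, Real.norm_of_nonneg (by norm_num : (0:ℝ) ≤ 1/2)]
  rw [le_div_iff₀ (by positivity)]
  have hs : √((n : ℝ) + 1) * √(n + 1) = n + 1 := Real.mul_self_sqrt hn.le
  have hs0 : 0 < √((n : ℝ) + 1) := by positivity
  have h3 : √((n : ℝ) + 1) * ‖(1 - w) * (1 + w) ^ n‖ ≤ 2 ^ (n + 1) := by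
    refine le_of_mul_le_mul_left ?_ hs0
    rw [← mul_assoc, hs, mul_comm _ ((2 : ℝ) ^ (n + 1))]
    exact hb
  have h22 : (1 / 2 : ℝ) ^ n * 2 ^ n = 1 := by rw [← mul_pow]; norm_num
  calc (1 / 2 : ℝ) ^ n * ‖(1 - w) * (1 + w) ^ n‖ * √(n + 1)
      = (1 / 2) ^ n * (√(n + 1) * ‖(1 - w) * (1 + w) ^ n‖) := by ring
    _ ≤ (1 / 2) ^ n * 2 ^ (n + 1) := by gcongr
    _ = 2 := by rw [pow_succ]; linear_combination 2 * h22

/-- By Cauchy–Schwarz it suffices to bound the binomial mean of 1/(j+1), which is explicit. -/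
theorem sum_binomial_inv_sqrt_le {p : ℝ} (hp : 0 < p) (hp1 : p ≤ 1) (n : ℕ) :
    ∑ j ∈ Finset.range (n + 1), p ^ j * (1 - p) ^ (n - j) * n.choose j * (1 / √(j + 1))
      ≤ 1 / √(p * (n + 1)) := by
  have h1p : 0 ≤ 1 - p := by linarith
  set a : ℕ → ℝ := fun j => p ^ j * (1 - p) ^ (n - j) * n.choose j
  have ha : ∀ j, 0 ≤ a j := fun j => by positivity
  have hsum : ∑ j ∈ Finset.range (n + 1), a j = 1 := by
    rw [← add_pow]; simp
  -- Since (n+1)C(n,j) = (j+1)C(n+1,j+1), this is 1/(p(n+1)) times the binomial sum of order n+1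
  -- without its first term.
  have hsum2 : ∑ j ∈ Finset.range (n + 1), a j * (1 / ((j : ℝ) + 1)) ≤ 1 / (p * (n + 1)) := by
    have h := add_pow p (1 - p) (n + 1)
    rw [Finset.sum_range_succ'] at h
    have h2 : ∑ k ∈ Finset.range (n + 1), p ^ (k + 1) * (1 - p) ^ (n + 1 - (k + 1)) *
        ((n + 1).choose (k + 1) : ℝ) ≤ 1 := by
      have : 0 ≤ p ^ 0 * (1 - p) ^ (n + 1 - 0) * ((n + 1).choose 0 : ℝ) := by positivity
      have e : (p + (1 - p)) ^ (n + 1) = 1 := by simp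
      linarith
    rw [le_div_iff₀ (by positivity), Finset.sum_mul]
    refine le_trans (le_of_eq (Finset.sum_congr rfl fun j _ => ?_)) h2
    have h2 : ((n + 1) * n.choose j : ℝ) = (n + 1).choose (j + 1) * (j + 1) := by
      exact_mod_cast Nat.add_one_mul_choose_eq n j
    simp only [a, Nat.add_sub_add_right, pow_succ]
    field_simp
    linear_combination (1 - p) ^ (n - j) * h2
  have hcs := Finset.sum_mul_sq_le_sq_mul_sq (Finset.range (n + 1))
    (fun j => √(a j)) (fun j => √(a j) * (1 / √((j : ℝ) + 1)))
  have e1 : ∀ j : ℕ, √(a j) * (√(a j) * (1 / √((j : ℝ) + 1))) = a j * (1 / √((j : ℝ) + 1)) :=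
    fun j => by rw [← mul_assoc, Real.mul_self_sqrt (ha j)]
  have e2 : ∀ j : ℕ, √(a j) ^ 2 = a j := fun j => Real.sq_sqrt (ha j)
  have e3 : ∀ j : ℕ, (1 / √((j : ℝ) + 1)) ^ 2 = 1 / ((j : ℝ) + 1) := fun j => by
    rw [div_pow, Real.sq_sqrt (by positivity), one_pow]
  simp only [e1, e2, mul_pow, e3, hsum, one_mul] at hcs
  refine abs_le_of_sq_le_sq' ?_ (by positivity) |>.2
  rw [div_pow, Real.sq_sqrt (by positivity), one_pow]
  exact hcs.trans hsum2

/-- In the expansion of (pu+r)^n the number of factors u behaves like a binomial variable with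
parameter p, as r has norm at most 1-p. Hence decay along powers of u passes to powers of pu+r. -/
theorem norm_mul_smul_add_pow_le {b u r : A} {p c : ℝ} (hur : Commute u r) (hp : 0 < p)
    (hp1 : p ≤ 1) (hr : ‖r‖ ≤ 1 - p) (hb : ∀ j : ℕ, ‖b * u ^ j‖ ≤ c / √(j + 1)) (n : ℕ) :
    ‖b * (p • u + r) ^ n‖ ≤ c / √p / √(n + 1) := by
  have hc : 0 ≤ c := by
    have := (norm_nonneg _).trans (hb 0)
    simpa using this
  rw [(hur.smul_left p).add_pow, Finset.mul_sum]
  refine (norm_sum_le _ _).trans ?_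
  have : c / √p / √((n : ℝ) + 1) = c * (1 / √(p * (n + 1))) := by
    rw [Real.sqrt_mul hp.le]; field_simp
  rw [this]
  refine le_trans ?_ (mul_le_mul_of_nonneg_left (sum_binomial_inv_sqrt_le hp hp1 n) hc)
  rw [Finset.mul_sum]
  refine Finset.sum_le_sum fun j _ => ?_
  have h1 : b * ((p • u) ^ j * r ^ (n - j) * (n.choose j : A))
      = (p ^ j * n.choose j : ℝ) • ((b * u ^ j) * r ^ (n - j)) := by
    rw [smul_pow, ← nsmul_eq_mul', ← Nat.cast_smul_eq_nsmul ℝ, smul_mul_assoc, smul_smul,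
      mul_smul_comm, mul_assoc, mul_comm (p ^ j)]
  rw [h1, norm_smul, Real.norm_of_nonneg (by positivity)]
  have h2 : ‖b * u ^ j * r ^ (n - j)‖ ≤ c / √(j + 1) * (1 - p) ^ (n - j) :=
    (norm_mul_le _ _).trans (mul_le_mul (hb j)
      ((norm_pow_le _ _).trans (pow_le_pow_left₀ (norm_nonneg _) hr _)) (norm_nonneg _)
      (by positivity))
  calc _ ≤ p ^ j * n.choose j * (c / √(j + 1) * (1 - p) ^ (n - j)) := by gcongr
    _ = _ := by ring

end NormedRing

/-! ### Bounded functions summed against a probability measure -/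

section PMFSums

variable {α B : Type*} [NormedAddCommGroup B] [NormedSpace ℝ B] [CompleteSpace B]

theorem PMF.hasSum_toReal (p : PMF α) : HasSum (fun a => (p a).toReal) 1 := by
  have := ENNReal.hasSum_toReal (f := p) (by rw [p.tsum_coe]; exact ENNReal.one_ne_top)
  simpa [← ENNReal.tsum_toReal_eq (fun a => p.apply_ne_top a), p.tsum_coe] using this

omit [CompleteSpace B] in
theorem PMF.summable_norm_smul (p : PMF α) {F : α → B} {K : ℝ} (hF : ∀ a, ‖F a‖ ≤ K) :
    Summable fun a => ‖(p a).toReal • F a‖ :=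
  Summable.of_nonneg_of_le (fun _ => norm_nonneg _) (fun a => by
    rw [norm_smul, Real.norm_of_nonneg ENNReal.toReal_nonneg]
    exact mul_le_mul_of_nonneg_left (hF a) ENNReal.toReal_nonneg)
    (p.hasSum_toReal.summable.mul_right K)

theorem PMF.summable_smul (p : PMF α) {F : α → B} {K : ℝ} (hF : ∀ a, ‖F a‖ ≤ K) :
    Summable fun a => (p a).toReal • F a :=
  (p.summable_norm_smul hF).of_norm

omit [CompleteSpace B] in
theorem PMF.norm_tsum_smul_le (p : PMF α) {F : α → B} {K : ℝ} (hF : ∀ a, ‖F a‖ ≤ K) :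
    ‖∑' a, (p a).toReal • F a‖ ≤ K := by
  have h := p.hasSum_toReal.mul_right K
  rw [one_mul] at h
  refine tsum_of_norm_bounded h fun a => ?_
  rw [norm_smul, Real.norm_of_nonneg ENNReal.toReal_nonneg]
  exact mul_le_mul_of_nonneg_left (hF a) ENNReal.toReal_nonneg

end PMFSums

/-! ### Convolution powers, their supports and the period -/

section Walk

variable {Γ : Type*} [Group Γ]

theorem convPow_succ_apply (μ : PMF Γ) (n : ℕ) (γ : Γ) :
    convPow μ (n + 1) γ = ∑' g, convPow μ n g * μ (g⁻¹ * γ) := by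
  classical
  rw [convPow, PMF.bind_apply]
  refine tsum_congr fun g => ?_
  congr 1
  rw [PMF.map_apply, tsum_eq_single (g⁻¹ * γ)]
  · simp
  · intro b hb
    rw [if_neg]
    rintro rfl
    simp at hb

theorem toReal_convPow_succ (μ : PMF Γ) (n : ℕ) (γ : Γ) :
    HasSum (fun g => (convPow μ n g).toReal * (μ (g⁻¹ * γ)).toReal)
      (convPow μ (n + 1) γ).toReal := by
  have h := convPow_succ_apply μ n γ
  have hne : ∑' g, convPow μ n g * μ (g⁻¹ * γ) ≠ ⊤ := h ▸ PMF.apply_ne_top _ _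
  have := ENNReal.hasSum_toReal hne
  rw [← ENNReal.tsum_toReal_eq (ENNReal.ne_top_of_tsum_ne_top hne), ← h] at this
  simpa [ENNReal.toReal_mul] using this

/-- Conditioning on the first n steps. Boundedness of F makes the double sum over (g, s) absolutely
summable, so it can be reindexed by (g, gs). -/
theorem tsum_convPow_succ {B : Type*} [NormedAddCommGroup B] [NormedSpace ℝ B] [CompleteSpace B]
    (μ : PMF Γ) (n : ℕ) {F : Γ → B} {K : ℝ} (hF : ∀ g, ‖F g‖ ≤ K) :
    ∑' γ, (convPow μ (n + 1) γ).toReal • F γ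
      = ∑' g, (convPow μ n g).toReal • ∑' s, (μ s).toReal • F (g * s) := by
  have hK : 0 ≤ K := (norm_nonneg _).trans (hF 1)
  let e : Γ × Γ ≃ Γ × Γ :=
    { toFun := fun x => (x.1, x.1⁻¹ * x.2)
      invFun := fun x => (x.1, x.1 * x.2)
      left_inv := fun x => by simp
      right_inv := fun x => by simp }
  have hs : Summable fun x : Γ × Γ =>
      ((convPow μ n x.1).toReal * (μ x.2).toReal) • F (x.1 * x.2) := by
    refine Summable.of_norm_bounded (g := fun x : Γ × Γ =>
      ((convPow μ n x.1).toReal * (μ x.2).toReal) * K) ?_ fun x => ?_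
    · exact ((convPow μ n).hasSum_toReal.summable.mul_of_nonneg μ.hasSum_toReal.summable
        (fun _ => ENNReal.toReal_nonneg) (fun _ => ENNReal.toReal_nonneg)).mul_right K
    · rw [norm_smul, Real.norm_of_nonneg (by positivity)]
      exact mul_le_mul_of_nonneg_left (hF _) (by positivity)
  have hs2 : Summable fun x : Γ × Γ =>
      ((convPow μ n x.1).toReal * (μ (x.1⁻¹ * x.2)).toReal) • F x.2 := by
    refine (e.summable_iff.2 hs).congr fun x => ?_
    simp [e]
  have h1 : ∑' x : Γ × Γ, ((convPow μ n x.1).toReal * (μ x.2).toReal) • F (x.1 * x.2)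
      = ∑' g, (convPow μ n g).toReal • ∑' s, (μ s).toReal • F (g * s) := by
    rw [hs.tsum_prod]
    refine tsum_congr fun g => ?_
    simp_rw [mul_smul]
    exact (μ.summable_smul fun s => hF (g * s)).tsum_const_smul _
  have h2 : ∑' x : Γ × Γ, ((convPow μ n x.1).toReal * (μ (x.1⁻¹ * x.2)).toReal) • F x.2
      = ∑' γ, (convPow μ (n + 1) γ).toReal • F γ := by
    have hs3 : Summable fun x : Γ × Γ =>
        ((convPow μ n x.2).toReal * (μ (x.2⁻¹ * x.1)).toReal) • F x.1 :=
      (Equiv.prodComm Γ Γ).summable_iff.2 hs2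
    refine ((Equiv.prodComm Γ Γ).tsum_eq fun x : Γ × Γ =>
      ((convPow μ n x.1).toReal * (μ (x.1⁻¹ * x.2)).toReal) • F x.2).symm.trans
      (hs3.tsum_prod.trans ?_)
    refine tsum_congr fun γ => ?_
    exact ((toReal_convPow_succ μ n γ).smul_const (F γ)).tsum_eq
  rw [← h1, ← h2]
  refine (e.symm.tsum_eq _).symm.trans (tsum_congr fun x => ?_)
  simp [e]

theorem mul_mem_support_convPow {μ : PMF Γ} {a b : ℕ} {g h : Γ} (hg : g ∈ (convPow μ a).support)
    (hh : h ∈ (convPow μ b).support) : g * h ∈ (convPow μ (a + b)).support := by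
  induction b generalizing h with
  | zero =>
    have : h = 1 := by simpa [convPow] using hh
    simpa [this] using hg
  | succ b ih =>
    rw [convPow, PMF.mem_support_bind_iff] at hh
    obtain ⟨k, hk, hh⟩ := hh
    rw [PMF.support_map] at hh
    obtain ⟨s, hs, rfl⟩ := hh
    rw [← add_assoc, convPow, PMF.mem_support_bind_iff]
    refine ⟨g * k, ih hk, ?_⟩
    rw [PMF.support_map]
    exact ⟨s, hs, mul_assoc _ _ _⟩

theorem mem_support_convPow_one {μ : PMF Γ} {s : Γ} (hs : s ∈ μ.support) :
    s ∈ (convPow μ 1).support := by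
  rw [convPow, PMF.mem_support_bind_iff]
  refine ⟨1, by simp [convPow], ?_⟩
  rw [PMF.support_map]
  exact ⟨s, hs, one_mul s⟩

theorem prod_mem_support_convPow {μ : PMF Γ} (l : List Γ) (hl : ∀ s ∈ l, s ∈ μ.support) :
    l.prod ∈ (convPow μ l.length).support := by
  induction l with
  | nil => simp [convPow]
  | cons s l ih =>
    rw [List.prod_cons, List.length_cons, add_comm]
    exact mul_mem_support_convPow (mem_support_convPow_one (hl s (by simp)))
      (ih fun t ht => hl t (by simp [ht]))

theorem exists_list_of_closure_eq_top {S : Set Γ} (h : Subsemigroup.closure S = ⊤) (γ : Γ) :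
    ∃ l : List Γ, 1 ≤ l.length ∧ (∀ s ∈ l, s ∈ S) ∧ l.prod = γ := by
  have hγ : γ ∈ Subsemigroup.closure S := h ▸ Subsemigroup.mem_top γ
  induction hγ using Subsemigroup.closure_induction with
  | mem x hx => exact ⟨[x], by simp, by simpa using hx, by simp⟩
  | mul x y _ _ hx hy =>
    obtain ⟨l, h1, h2, rfl⟩ := hx
    obtain ⟨l', h1', h2', rfl⟩ := hy
    exact ⟨l ++ l', by simp; omega, fun s hs => (List.mem_append.1 hs).elim (h2 s) (h2' s), by simp⟩

theorem exists_mem_support_convPow {μ : PMF Γ} (h : Subsemigroup.closure μ.support = ⊤) (γ : Γ) :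
    ∃ a, 1 ≤ a ∧ γ ∈ (convPow μ a).support := by
  obtain ⟨l, h1, h2, rfl⟩ := exists_list_of_closure_eq_top h γ
  exact ⟨l.length, h1, prod_mem_support_convPow l h2⟩

theorem pow_mem_support_convPow {μ : PMF Γ} {a : ℕ} {g : Γ} (hg : g ∈ (convPow μ a).support)
    (k : ℕ) : g ^ k ∈ (convPow μ (k * a)).support := by
  induction k with
  | zero => simp [convPow]
  | succ k ih => rw [pow_succ, Nat.succ_mul]; exact mul_mem_support_convPow ih hg

theorem IsPeriod.pos {μ : PMF Γ} {q : ℕ} (hq : IsPeriod μ q)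
    (h : Subsemigroup.closure μ.support = ⊤) : 0 < q := by
  rw [Nat.pos_iff_ne_zero, hq, Ne, Nat.setGcd_eq_zero_iff]
  intro hsub
  obtain ⟨l, h1, h2, h3⟩ := exists_list_of_closure_eq_top h (1 : Γ)
  have := hsub (show l.length ∈ _ from ⟨h1, l, rfl, h2, h3⟩)
  simp only [Set.mem_singleton_iff] at this
  omega

/-- Loops concatenate, and all large multiples of the greatest common divisor lie in the additive
semigroup generated by the loop lengths. -/
theorem IsPeriod.exists_one_mem_support {μ : PMF Γ} {q : ℕ} (hq : IsPeriod μ q)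
    (h : Subsemigroup.closure μ.support = ⊤) :
    ∃ k₀, ∀ k ≥ k₀, (1 : Γ) ∈ (convPow μ (q * k)).support := by
  obtain ⟨n, hn⟩ := Nat.exists_mem_closure_of_ge
    {n | 1 ≤ n ∧ ∃ l : List Γ, l.length = n ∧ (∀ s ∈ l, s ∈ μ.support) ∧ l.prod = 1}
  rw [← hq] at hn
  refine ⟨n, fun k hk => ?_⟩
  have hmem := hn (q * k) (hk.trans (Nat.le_mul_of_pos_left k (hq.pos h))) (dvd_mul_right q k)
  generalize q * k = a at hmem
  induction hmem using AddSubmonoid.closure_induction with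
  | mem x hx =>
    obtain ⟨_, l, rfl, h2, h3⟩ := hx
    exact h3 ▸ prod_mem_support_convPow l h2
  | zero => simp [convPow]
  | add x y _ _ hx hy => simpa using mul_mem_support_convPow hx hy

end Walk

/-! ### Laws on Γ as elements of a Banach algebra -/

section ConvolutionAlgebra

variable {Γ : Type*} [Group Γ] {A : Type*} [NormedRing A] [NormedAlgebra ℝ A] [CompleteSpace A]
  {ρ : Γ →* A}

/-- The element `∑ c(s) ρ(s)` of a Banach algebra on which `Γ` acts. -/
def convElem (ρ : Γ →* A) (c : Γ → ℝ) : A := ∑' s, c s • ρ s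

omit [CompleteSpace A] in
theorem norm_smul_rep_le (hρ : ∀ g, ‖ρ g‖ ≤ 1) (c : Γ → ℝ) (s : Γ) : ‖c s • ρ s‖ ≤ |c s| := by
  rw [norm_smul]
  exact mul_le_of_le_one_right (norm_nonneg _) (hρ s)

theorem summable_smul_rep (hρ : ∀ g, ‖ρ g‖ ≤ 1) {c : Γ → ℝ} (hc : Summable c) :
    Summable fun s => c s • ρ s :=
  Summable.of_norm_bounded hc.abs (norm_smul_rep_le hρ c)

omit [CompleteSpace A] in
theorem norm_convElem_le (hρ : ∀ g, ‖ρ g‖ ≤ 1) {c : Γ → ℝ} (hc : Summable c) :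
    ‖convElem ρ c‖ ≤ ∑' s, |c s| :=
  tsum_of_norm_bounded hc.abs.hasSum (norm_smul_rep_le hρ c)

theorem convElem_smul (hρ : ∀ g, ‖ρ g‖ ≤ 1) (a : ℝ) {c : Γ → ℝ} (hc : Summable c) :
    convElem ρ (fun s => a * c s) = a • convElem ρ c := by
  simp only [convElem, mul_smul]
  exact (summable_smul_rep hρ hc).tsum_const_smul a

theorem convElem_sub (hρ : ∀ g, ‖ρ g‖ ≤ 1) {c c' : Γ → ℝ} (hc : Summable c) (hc' : Summable c') :
    convElem ρ (fun s => c s - c' s) = convElem ρ c - convElem ρ c' := by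
  simp only [convElem, sub_smul]
  exact (summable_smul_rep hρ hc).tsum_sub (summable_smul_rep hρ hc')

/-- Through this identity a norm bound on (1-ρ(g)) times an element becomes a bound on the
difference between a law and its translate. -/
theorem rep_mul_convElem (hρ : ∀ g, ‖ρ g‖ ≤ 1) (g : Γ) {c : Γ → ℝ} (hc : Summable c) :
    ρ g * convElem ρ c = convElem ρ fun s => c (g⁻¹ * s) := by
  rw [convElem, ← (summable_smul_rep hρ hc).tsum_mul_left, convElem,
    ← (Equiv.mulLeft g).tsum_eq fun s => c (g⁻¹ * s) • ρ s]
  refine tsum_congr fun s => ?_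
  simp

theorem convElem_sum (hρ : ∀ g, ‖ρ g‖ ≤ 1) {ι : Type*} (t : Finset ι) {c : ι → Γ → ℝ}
    (hc : ∀ i ∈ t, Summable (c i)) :
    convElem ρ (fun s => ∑ i ∈ t, c i s) = ∑ i ∈ t, convElem ρ (c i) := by
  simp only [convElem, Finset.sum_smul]
  exact Summable.tsum_finsetSum fun i hi => summable_smul_rep hρ (hc i hi)

/-- The element of a Banach algebra on which `Γ` acts given by a probability measure. -/
def stepElem (ρ : Γ →* A) (μ : PMF Γ) : A := convElem ρ fun s => (μ s).toReal

theorem convElem_convPow (hρ : ∀ g, ‖ρ g‖ ≤ 1) (μ : PMF Γ) (n : ℕ) :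
    convElem ρ (fun s => (convPow μ n s).toReal) = stepElem ρ μ ^ n := by
  induction n with
  | zero =>
    classical
    rw [convElem, tsum_eq_single 1]
    · simp [convPow]
    · intro s hs
      simp [convPow, hs]
  | succ n ih =>
    rw [convElem, tsum_convPow_succ μ n hρ, pow_succ, ← ih, convElem,
      ← (summable_smul_rep hρ (convPow μ n).hasSum_toReal.summable).tsum_mul_right]
    refine tsum_congr fun g => ?_
    rw [stepElem, convElem, smul_mul_assoc,
      ← (summable_smul_rep hρ μ.hasSum_toReal.summable).tsum_mul_left]
    simp_rw [map_mul, mul_smul_comm]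

omit [CompleteSpace A] in
theorem norm_stepElem_le (hρ : ∀ g, ‖ρ g‖ ≤ 1) (μ : PMF Γ) : ‖stepElem ρ μ‖ ≤ 1 := by
  refine (norm_convElem_le hρ μ.hasSum_toReal.summable).trans (le_of_eq ?_)
  simp [abs_of_nonneg, μ.hasSum_toReal.tsum_eq]

theorem commute_convElem (hρ : ∀ g, ‖ρ g‖ ≤ 1) {u : A} (hu : ∀ g, Commute u (ρ g)) {c : Γ → ℝ}
    (hc : Summable c) : Commute u (convElem ρ c) := by
  have hs := summable_smul_rep hρ hc
  rw [Commute, SemiconjBy, convElem, ← hs.tsum_mul_left, ← hs.tsum_mul_right]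
  refine tsum_congr fun s => ?_
  rw [mul_smul_comm, smul_mul_assoc, (hu s).eq]

/-- If `0 ≤ c' ≤ c` then `∑ c(s) ρ(s)` and `∑ c'(s) ρ(s)` differ by at most the difference of the
masses. -/
theorem norm_convElem_sub_le (hρ : ∀ g, ‖ρ g‖ ≤ 1) {c c' : Γ → ℝ} (hc : Summable c)
    (hc' : Summable c') (h : ∀ s, c' s ≤ c s) :
    ‖convElem ρ c - convElem ρ c'‖ ≤ ∑' s, c s - ∑' s, c' s := by
  rw [← convElem_sub hρ hc hc', ← hc.tsum_sub hc']
  refine (norm_convElem_le hρ (hc.sub hc')).trans (le_of_eq (tsum_congr fun s => ?_))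
  exact abs_of_nonneg (sub_nonneg.2 (h s))

end ConvolutionAlgebra

/-! ### The left regular representation on ℓ¹(Γ) -/

section EllOne

variable {Γ : Type*} [Group Γ]

variable (Γ) in
/-- The bounded operators on `ℓ¹(Γ)`. -/
abbrev EllOneOp : Type _ := lp (fun _ : Γ => ℝ) 1 →L[ℝ] lp (fun _ : Γ => ℝ) 1

theorem memℓp_one_iff {α : Type*} {f : α → ℝ} : Memℓp f 1 ↔ Summable fun a => |f a| := by
  rw [memℓp_gen_iff (by simp)]
  simp

theorem lp_one_norm_eq {α : Type*} (f : lp (fun _ : α => ℝ) 1) : ‖f‖ = ∑' a, |f a| := by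
  rw [lp.norm_eq_tsum_rpow (by simp)]
  simp

/-- Left translation on `ℓ¹(Γ)`, as a bounded operator. -/
def leftTranslationOp (g : Γ) : EllOneOp Γ :=
  LinearMap.mkContinuous
    { toFun := fun f => ⟨fun x => f (g⁻¹ * x), memℓp_one_iff.2
        ((Equiv.mulLeft g⁻¹).summable_iff.2 (memℓp_one_iff.1 (lp.memℓp f)))⟩
      map_add' := fun _ _ => rfl
      map_smul' := fun _ _ => rfl } 1 fun f => by
    rw [one_mul, lp_one_norm_eq, lp_one_norm_eq]
    exact ((Equiv.mulLeft g⁻¹).tsum_eq fun x => |f x|).le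

theorem leftTranslationOp_apply (g : Γ) (f : lp (fun _ : Γ => ℝ) 1) (x : Γ) :
    leftTranslationOp g f x = f (g⁻¹ * x) := rfl

theorem norm_leftTranslationOp_le (g : Γ) : ‖leftTranslationOp g‖ ≤ 1 :=
  LinearMap.mkContinuous_norm_le _ zero_le_one _

variable (Γ) in
/-- The left regular representation on `ℓ¹(Γ)`. -/
def leftTranslation : Γ →* EllOneOp Γ where
  toFun := leftTranslationOp
  map_one' := by
    ext f x
    simp [leftTranslationOp_apply]
  map_mul' g h := by
    ext f x
    rw [mul_apply_eq_comp, leftTranslationOp_apply, leftTranslationOp_apply,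
      leftTranslationOp_apply, mul_inv_rev, mul_assoc]

theorem norm_leftTranslation_le (g : Γ) : ‖leftTranslation Γ g‖ ≤ 1 :=
  norm_leftTranslationOp_le g

instance : Nontrivial (lp (fun _ : Γ => ℝ) 1) := by
  classical
  refine ⟨lp.single 1 1 1, 0, fun h => ?_⟩
  have := congrArg (fun f => f (1 : Γ)) h
  simp at this

/-- The point mass at 1 is sent to the coefficient function itself. Together with `norm_convElem_le`
this shows that passing to operators loses nothing. -/
theorem tsum_abs_le_norm_convElem {c : Γ → ℝ} (hc : Summable c) :
    ∑' s, |c s| ≤ ‖convElem (leftTranslation Γ) c‖ := by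
  classical
  set δ : lp (fun _ : Γ => ℝ) 1 := lp.single 1 1 1
  have happ : ∀ γ, convElem (leftTranslation Γ) c δ γ = c γ := by
    intro γ
    let ev : EllOneOp Γ →L[ℝ] ℝ :=
      (lp.evalCLM ℝ (fun _ : Γ => ℝ) 1 γ).comp (ContinuousLinearMap.apply ℝ _ δ)
    have hev : ∀ s, ev (leftTranslation Γ s) = δ (s⁻¹ * γ) := fun T => rfl
    have h2 : convElem (leftTranslation Γ) c δ γ = ev (convElem (leftTranslation Γ) c) := rfl
    rw [h2, convElem, ev.map_tsum (summable_smul_rep norm_leftTranslation_le hc),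
      tsum_eq_single γ]
    · rw [ev.map_smul, hev, inv_mul_cancel, lp.single_apply_self, smul_eq_mul, mul_one]
    · intro s hs
      rw [ev.map_smul, hev, lp.single_apply_ne, smul_zero]
      simpa [inv_mul_eq_one] using hs
  have hδ : ‖δ‖ = 1 := by
    rw [lp.norm_single (by simp)]; simp
  calc ∑' s, |c s| = ‖convElem (leftTranslation Γ) c δ‖ := by
        rw [lp_one_norm_eq]; exact tsum_congr fun γ => by rw [happ]
    _ ≤ ‖convElem (leftTranslation Γ) c‖ * ‖δ‖ := ContinuousLinearMap.le_opNorm _ _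
    _ = ‖convElem (leftTranslation Γ) c‖ := by rw [hδ, mul_one]

end EllOne

/-! ### Decay along all powers, and for elements with an atom at 1 -/

section Decay

variable {A : Type*} [NormedRing A] [NormOneClass A]

/-- Split N into a multiple of a and a remainder. The remaining power of P is a contraction, and N+1
≤ a(⌊N/a⌋+1) accounts for √a. -/
theorem norm_mul_pow_le_of_norm_mul_pow_mul_le {b P : A} (hP : ‖P‖ ≤ 1) {a : ℕ} (ha : 0 < a)
    {C : ℝ} (h : ∀ n : ℕ, ‖b * (P ^ a) ^ n‖ ≤ C / √(n + 1)) (N : ℕ) :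
    ‖b * P ^ N‖ ≤ C * √a / √(N + 1) := by
  have hC : 0 ≤ C := by simpa using (norm_nonneg _).trans (h 0)
  have h1 : ‖b * P ^ N‖ ≤ ‖b * (P ^ a) ^ (N / a)‖ := by
    conv_lhs => rw [← Nat.div_add_mod N a, pow_add, pow_mul, ← mul_assoc]
    exact (norm_mul_le _ _).trans (mul_le_of_le_one_right (norm_nonneg _) (norm_pow_le_one' hP _))
  refine h1.trans ((h _).trans ?_)
  rw [div_le_div_iff₀ (by positivity) (by positivity), mul_assoc, ← Real.sqrt_mul (by positivity)]
  refine mul_le_mul_of_nonneg_left (Real.sqrt_le_sqrt ?_) hC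
  have := Nat.lt_mul_div_succ N ha
  exact_mod_cast this

theorem tendsto_of_le_div_sqrt {f : ℕ → ℝ} {C : ℝ} (h0 : ∀ n, 0 ≤ f n)
    (h : ∀ n : ℕ, f n ≤ C / √(n + 1)) : Tendsto f atTop (𝓝 0) := by
  refine squeeze_zero h0 h ?_
  refine Tendsto.div_atTop tendsto_const_nhds ?_
  exact Real.tendsto_sqrt_atTop.comp (tendsto_atTop_add_const_right _ _ tendsto_natCast_atTop_atTop)

variable [NormedAlgebra ℝ A]

/-- With X = β + R one has X² = βX + RX, and βX contains β²(1+X)/2. So X² is β² times the lazy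
version of X plus a commuting rest of norm at most 1-β². -/
theorem norm_one_sub_mul_sq_pow_le {X : A} {β : ℝ} (hβ : 0 < β) (hβ1 : β ≤ 1)
    (hX : ‖X - β • (1 : A)‖ ≤ 1 - β) (n : ℕ) :
    ‖(1 - X) * (X ^ 2) ^ n‖ ≤ 2 / √(β ^ 2) / √(n + 1) := by
  have hX1 : ‖X‖ ≤ 1 := by
    calc ‖X‖ = ‖β • (1 : A) + (X - β • (1 : A))‖ := by congr 1; abel
      _ ≤ ‖β • (1 : A)‖ + ‖X - β • (1 : A)‖ := norm_add_le _ _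
      _ ≤ β + (1 - β) := by
        refine add_le_add ?_ hX
        rw [norm_smul, norm_one, mul_one, Real.norm_of_nonneg hβ.le]
      _ = 1 := by ring
  set R := X - β • (1 : A) with hR
  set r : A := (β / 2) • R + ((β - β ^ 2) / 2) • X + R * X with hr
  have hXsq : X ^ 2 = (β ^ 2) • ((1 / 2 : ℝ) • (1 + X)) + r := by
    have : R * X = X ^ 2 - β • X := by rw [hR, sub_mul, smul_mul_assoc, one_mul, sq]
    rw [hr, this, hR]
    module
  have hrn : ‖r‖ ≤ 1 - β ^ 2 := by
    calc ‖r‖ ≤ ‖(β / 2) • R‖ + ‖((β - β ^ 2) / 2) • X‖ + ‖R * X‖ := norm_add₃_le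
      _ ≤ (β / 2) * (1 - β) + ((β - β ^ 2) / 2) * 1 + (1 - β) * 1 := by
        have : 0 ≤ (β - β ^ 2) / 2 := by nlinarith
        refine add_le_add (add_le_add ?_ ?_) ?_
        · rw [norm_smul, Real.norm_of_nonneg (by positivity)]
          gcongr
        · rw [norm_smul, Real.norm_of_nonneg this]
          gcongr
        · exact (norm_mul_le _ _).trans (mul_le_mul hX hX1 (norm_nonneg _) (by linarith))
      _ = 1 - β ^ 2 := by ring
  have hc : Commute ((1 / 2 : ℝ) • (1 + X)) r := by
    have hXR : Commute X R := (Commute.refl X).sub_right ((Commute.one_right X).smul_right β)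
    have : Commute X r := ((hXR.smul_right _).add_right ((Commute.refl X).smul_right _)).add_right
      (hXR.mul_right (Commute.refl X))
    exact ((Commute.one_left r).add_left this).smul_left _
  rw [hXsq]
  exact norm_mul_smul_add_pow_le hc (by positivity) (by nlinarith) hrn
    (fun j => norm_one_sub_mul_half_one_add_pow_le hX1 j) n

end Decay

/-! ### Averages over conjugates and decay for laws charging them -/

section Regularity

variable {Γ : Type*} [Group Γ] {Λ : Subgroup Γ}

/-- The conjugate `γ⁻¹ y γ` for a representative `γ` of the coset `x = Λγ`. -/
def conjRep (y : Γ) (x : CosetSpace Λ) : Γ := x.out⁻¹ * y * x.out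

theorem exists_mul_eq_out (γ : Γ) : ∃ l ∈ Λ, (cosetMk Λ γ).out = l * γ := by
  have h : (QuotientGroup.rightRel Λ) γ (cosetMk Λ γ).out :=
    (QuotientGroup.rightRel Λ).symm (Quotient.mk_out γ)
  exact ⟨_, QuotientGroup.rightRel_apply.1 h, by simp⟩

/-- Another representative of the coset differs by an element of Λ, which commutes with y. So y has
only finitely many conjugates, indexed by Λ\Γ. -/
theorem conjRep_mk (hΛ : ∀ a ∈ Λ, ∀ b ∈ Λ, a * b = b * a) {y : Γ} (hy : y ∈ Λ) (γ : Γ) :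
    conjRep y (cosetMk Λ γ) = γ⁻¹ * y * γ := by
  obtain ⟨l, hl, h⟩ := exists_mul_eq_out (Λ := Λ) γ
  have : l⁻¹ * y * l = y := by rw [mul_assoc, hΛ y hy l hl]; simp
  calc conjRep y (cosetMk Λ γ) = γ⁻¹ * (l⁻¹ * y * l) * γ := by rw [conjRep, h]; group
    _ = _ := by rw [this]

theorem conjRep_mem [Λ.Normal] {y : Γ} (hy : y ∈ Λ) (x : CosetSpace Λ) : conjRep y x ∈ Λ := by
  have := (inferInstance : Λ.Normal).conj_mem y hy x.out⁻¹
  simpa [conjRep] using this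

theorem conjRep_pow (y : Γ) (n : ℕ) (x : CosetSpace Λ) :
    conjRep (y ^ n) x = conjRep y x ^ n := by
  simpa [conjRep] using (conj_pow (a := x.out⁻¹) (b := y) (i := n)).symm

theorem conjRep_cosetMul (hΛ : ∀ a ∈ Λ, ∀ b ∈ Λ, a * b = b * a) {y : Γ} (hy : y ∈ Λ)
    (x : CosetSpace Λ) (s : Γ) : s * conjRep y (cosetMul x s) = conjRep y x * s := by
  obtain ⟨γ, rfl⟩ := Quotient.exists_rep x
  have h1 := conjRep_mk hΛ hy (γ * s)
  have h2 := conjRep_mk hΛ hy γ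
  rw [show cosetMul (⟦γ⟧ : CosetSpace Λ) s = cosetMk Λ (γ * s) from rfl, h1,
    show (⟦γ⟧ : CosetSpace Λ) = cosetMk Λ γ from rfl, h2]
  group

/-- Right translation by `s` as a permutation of `Λ \ Γ`. -/
def cosetPerm (Λ : Subgroup Γ) (s : Γ) : Equiv.Perm (CosetSpace Λ) where
  toFun x := cosetMul x s
  invFun x := cosetMul x s⁻¹
  left_inv x := cosetMul_mul_inv x s
  right_inv x := by simpa using cosetMul_mul_inv x s⁻¹

variable [Λ.FiniteIndex] {A : Type*} [NormedRing A] [NormedAlgebra ℝ A] {ρ : Γ →* A}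

variable (Λ) in
/-- The average of `(1 + ρ(y')) / 2` over the conjugates `y'` of `y ∈ Λ`. -/
def lazyConj (ρ : Γ →* A) (y : Γ) : A :=
  ∑ x : CosetSpace Λ, (1 / Fintype.card (CosetSpace Λ) : ℝ) • ((1 / 2 : ℝ) • (1 + ρ (conjRep y x)))

/-- Moving ρ(s) past ρ(y') turns y' into another conjugate of y, so it only permutes the summands.
-/
theorem commute_lazyConj (hΛ : ∀ a ∈ Λ, ∀ b ∈ Λ, a * b = b * a) {y : Γ} (hy : y ∈ Λ) (s : Γ) :
    Commute (lazyConj Λ ρ y) (ρ s) := by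
  rw [Commute, SemiconjBy, lazyConj, Finset.sum_mul, Finset.mul_sum]
  refine Eq.trans (Finset.sum_congr rfl fun x _ => ?_) (Equiv.sum_comp (cosetPerm Λ s) fun x =>
    ρ s * ((1 / (Fintype.card (CosetSpace Λ) : ℕ) : ℝ) • ((1 / 2 : ℝ) • (1 + ρ (conjRep y x)))))
  simp only [smul_mul_assoc, mul_smul_comm, add_mul, mul_add, one_mul, mul_one]
  rw [← map_mul, ← map_mul]
  congr 4
  exact (conjRep_cosetMul hΛ hy x s).symm

variable [NormOneClass A]

instance : Nonempty (CosetSpace Λ) := ⟨cosetMk Λ 1⟩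

theorem norm_half_one_add_le {w : A} (hw : ‖w‖ ≤ 1) : ‖(1 / 2 : ℝ) • (1 + w)‖ ≤ 1 := by
  rw [norm_smul, Real.norm_of_nonneg (by norm_num)]
  have := norm_add_le (1 : A) w
  rw [norm_one] at this
  linarith

/-- The trivial coset contributes (1+ρ(y))/2 with weight 1/d, where d is the number of cosets. The
other summands commute with it, all conjugates of y being in the commutative normal subgroup Λ. -/
theorem norm_one_sub_mul_lazyConj_pow_le [Λ.Normal] (hΛ : ∀ a ∈ Λ, ∀ b ∈ Λ, a * b = b * a)
    (hρ : ∀ g, ‖ρ g‖ ≤ 1) {y : Γ} (hy : y ∈ Λ) (n : ℕ) :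
    ‖(1 - ρ y) * lazyConj Λ ρ y ^ n‖ ≤ 2 / √(1 / Fintype.card (CosetSpace Λ)) / √(n + 1) := by
  classical
  set d : ℝ := ((Fintype.card (CosetSpace Λ) : ℕ) : ℝ) with hd
  have hd1 : 1 ≤ d := by
    rw [hd]; exact_mod_cast Fintype.card_pos
  have hd0 : 0 < d := by linarith
  have hy1 : conjRep y (cosetMk Λ 1) = y := by simpa using conjRep_mk hΛ hy 1
  set r : A := ∑ x ∈ Finset.univ.erase (cosetMk Λ 1),
    (1 / d) • ((1 / 2 : ℝ) • (1 + ρ (conjRep y x))) with hr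
  have hU : lazyConj Λ ρ y = (1 / d) • ((1 / 2 : ℝ) • (1 + ρ y)) + r := by
    rw [lazyConj, ← Finset.add_sum_erase _ _ (Finset.mem_univ (cosetMk Λ 1)), hy1]
  have hrn : ‖r‖ ≤ 1 - 1 / d := by
    have hx : ∀ x ∈ Finset.univ.erase (cosetMk Λ (1 : Γ)),
        ‖(1 / d) • ((1 / 2 : ℝ) • (1 + ρ (conjRep y x)))‖ ≤ 1 / d := fun x _ => by
      rw [norm_smul, Real.norm_of_nonneg (by positivity)]
      exact mul_le_of_le_one_right (by positivity) (norm_half_one_add_le (hρ _))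
    refine (norm_sum_le_of_le _ hx).trans (le_of_eq ?_)
    rw [Finset.sum_const, Finset.card_erase_of_mem (Finset.mem_univ _), Finset.card_univ,
      nsmul_eq_mul, Nat.cast_sub Fintype.card_pos, ← hd]
    field_simp
    simp
  have hcomm : Commute ((1 / 2 : ℝ) • (1 + ρ y)) r := by
    refine Commute.sum_right _ _ _ fun x _ => ?_
    have h1 : Commute (ρ y) (ρ (conjRep y x)) := by
      rw [Commute, SemiconjBy, ← map_mul, ← map_mul, hΛ y hy _ (conjRep_mem hy x)]
    have h2 : Commute (ρ y) ((1 / d) • ((1 / 2 : ℝ) • (1 + ρ (conjRep y x)))) :=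
      (((Commute.one_right _).add_right h1).smul_right _).smul_right _
    exact ((Commute.one_left _).add_left h2).smul_left _
  rw [hU]
  refine norm_mul_smul_add_pow_le hcomm (by positivity) ?_ hrn
    (fun j => norm_one_sub_mul_half_one_add_pow_le (hρ y) j) n
  rw [div_le_one hd0]; exact hd1

variable [CompleteSpace A]

/-- The law c dominates p times the law behind `lazyConj`. Since `lazyConj` commutes with all of
ρ(Γ), it commutes with the remainder even though Γ need not be commutative, and the binomial
expansion applies. -/
theorem exists_norm_one_sub_mul_convElem_pow_le [Λ.Normal]
    (hΛ : ∀ a ∈ Λ, ∀ b ∈ Λ, a * b = b * a) (hρ : ∀ g, ‖ρ g‖ ≤ 1) {y : Γ} (hy : y ∈ Λ)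
    {c : Γ → ℝ} (hc : HasSum c 1) (hc0 : ∀ s, 0 ≤ c s) (h1 : 0 < c 1)
    (hcy : ∀ x : CosetSpace Λ, 0 < c (conjRep y x)) :
    ∃ C : ℝ, ∀ n : ℕ, ‖(1 - ρ y) * convElem ρ c ^ n‖ ≤ C / √(n + 1) := by
  classical
  set d : ℝ := ((Fintype.card (CosetSpace Λ) : ℕ) : ℝ) with hd
  have hd0 : 0 < d := by rw [hd]; exact_mod_cast Fintype.card_pos
  -- p is the least mass that c gives to 1 and to the conjugates of y; it is positive because Λ\Γ is
  -- finite.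
  obtain ⟨p, hp, hp1, hpy⟩ : ∃ p, 0 < p ∧ p ≤ c 1 ∧ ∀ x : CosetSpace Λ, p ≤ c (conjRep y x) := by
    obtain ⟨x₀, hx₀⟩ := Finite.exists_min fun x : CosetSpace Λ => c (conjRep y x)
    exact ⟨min (c 1) (c (conjRep y x₀)), lt_min h1 (hcy x₀), min_le_left _ _,
      fun x => (min_le_right _ _).trans (hx₀ x)⟩
  let e : Γ → Γ → ℝ := fun g s => if s = g then 1 else 0
  have he : ∀ g, HasSum (e g) 1 := fun g => hasSum_ite_eq g 1
  have hec : ∀ g, convElem ρ (e g) = ρ g := fun g => by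
    rw [convElem, tsum_eq_single g]
    · simp [e]
    · intro s hs; simp [e, hs]
  let cx : CosetSpace Λ → Γ → ℝ := fun x s => (1 / d) * ((1 / 2) * (e 1 s + e (conjRep y x) s))
  have hcx : ∀ x, HasSum (cx x) (1 / d) := fun x => by
    have := (((he 1).add (he (conjRep y x))).mul_left (1 / 2)).mul_left (1 / d)
    rwa [show 1 / d * (1 / 2 * ((1 : ℝ) + 1)) = 1 / d by ring] at this
  have hcxc : ∀ x, convElem ρ (cx x) = (1 / d) • ((1 / 2 : ℝ) • (1 + ρ (conjRep y x))) := by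
    intro x
    have h2 : convElem ρ (fun s => e 1 s + e (conjRep y x) s) = 1 + ρ (conjRep y x) := by
      rw [← map_one ρ, ← hec 1, ← hec (conjRep y x)]
      simp only [convElem, add_smul]
      exact (summable_smul_rep hρ (he _).summable).tsum_add (summable_smul_rep hρ (he _).summable)
    have hs := (he 1).add (he (conjRep y x))
    rw [← h2, ← convElem_smul hρ _ hs.summable, ← convElem_smul hρ _ (hs.summable.mul_left _)]
  let cU : Γ → ℝ := fun s => ∑ x, cx x s
  have hcU : HasSum cU 1 := by
    have := hasSum_sum fun x (_ : x ∈ Finset.univ) => hcx x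
    rwa [Finset.sum_const, Finset.card_univ, nsmul_eq_mul, ← hd, mul_one_div_cancel hd0.ne'] at this
  have hU : convElem ρ cU = lazyConj Λ ρ y := by
    rw [lazyConj, convElem_sum hρ _ fun x _ => (hcx x).summable]
    exact Finset.sum_congr rfl fun x _ => hcxc x
  have hle : ∀ s, p * cU s ≤ c s := by
    intro s
    have hx : ∀ x, p * cx x s ≤ (1 / d) * c s := by
      intro x
      have hes : ∀ g, p ≤ c g → p * e g s ≤ c s := fun g hg => by
        by_cases hsg : s = g
        · simpa [e, hsg] using hg
        · simpa [e, hsg] using hc0 s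
      have a1 := hes 1 hp1
      have a2 := hes _ (hpy x)
      calc p * cx x s = (1 / d) * ((1 / 2) * (p * e 1 s + p * e (conjRep y x) s)) := by
            simp only [cx]; ring
        _ ≤ (1 / d) * ((1 / 2) * (c s + c s)) := by gcongr
        _ = _ := by ring
    calc p * cU s = ∑ x, p * cx x s := Finset.mul_sum _ _ _
      _ ≤ ∑ _x : CosetSpace Λ, (1 / d) * c s := Finset.sum_le_sum fun x _ => hx x
      _ = c s := by
        rw [Finset.sum_const, Finset.card_univ, nsmul_eq_mul, ← hd]; field_simp
  have hpU : convElem ρ (fun s => p * cU s) = p • lazyConj Λ ρ y := by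
    rw [convElem_smul hρ _ hcU.summable, hU]
  have hr : ‖convElem ρ c - p • lazyConj Λ ρ y‖ ≤ 1 - p := by
    rw [← hpU]
    refine (norm_convElem_sub_le hρ hc.summable (hcU.summable.mul_left p) hle).trans (le_of_eq ?_)
    rw [hc.tsum_eq, (hcU.mul_left p).tsum_eq, mul_one]
  have hcomm : Commute (lazyConj Λ ρ y) (convElem ρ c - p • lazyConj Λ ρ y) :=
    (commute_convElem hρ (commute_lazyConj hΛ hy) hc.summable).sub_right
      ((Commute.refl _).smul_right p)
  have hc1 : c 1 ≤ 1 := le_hasSum hc 1 fun s _ => hc0 s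
  refine ⟨2 / √(1 / d) / √p, fun n => ?_⟩
  have := norm_mul_smul_add_pow_le hcomm hp (hp1.trans hc1) hr
    (fun j => norm_one_sub_mul_lazyConj_pow_le hΛ hρ hy j) n
  rwa [add_sub_cancel] at this

end Regularity

/-! ### Regularity of the walk under translations by elements of Λ -/

section WalkRegularity

variable {Γ : Type*} [Group Γ] {μ : PMF Γ} {q : ℕ} {A : Type*} [NormedRing A] [NormedAlgebra ℝ A]
  [NormOneClass A] [CompleteSpace A] {ρ : Γ →* A}

theorem toReal_convPow_pos {n : ℕ} {g : Γ} (h : g ∈ (convPow μ n).support) :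
    0 < (convPow μ n g).toReal :=
  ENNReal.toReal_pos ((PMF.mem_support_iff _ _).1 h) (PMF.apply_ne_top _ _)

/-- The atom β of μ_a at the identity puts P^a within 1-β of β·1. The decay concerns powers of
(P^a)², whence the exponent 2a in the constant. -/
theorem exists_norm_one_sub_pow_mul_pow_le (hρ : ∀ g, ‖ρ g‖ ≤ 1) {a : ℕ} (ha : 0 < a)
    (h1 : (1 : Γ) ∈ (convPow μ a).support) :
    ∃ C : ℝ, ∀ N : ℕ, ‖(1 - stepElem ρ μ ^ a) * stepElem ρ μ ^ N‖ ≤ C / √(N + 1) := by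
  classical
  set P := stepElem ρ μ
  have hc := (convPow μ a).hasSum_toReal
  set β := (convPow μ a 1).toReal with hβ
  have hβ0 : 0 < β := toReal_convPow_pos h1
  have hβ1 : β ≤ 1 := le_hasSum hc 1 fun _ _ => ENNReal.toReal_nonneg
  have he : HasSum (fun s : Γ => if s = 1 then β else 0) β := hasSum_ite_eq 1 β
  have hX : ‖P ^ a - β • (1 : A)‖ ≤ 1 - β := by
    have h := norm_convElem_sub_le hρ hc.summable he.summable fun s => by
      by_cases hs : s = 1
      · simp [hs, hβ]
      · simp [hs]
    rw [hc.tsum_eq, he.tsum_eq, convElem_convPow hρ] at h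
    convert h using 3
    rw [convElem, tsum_eq_single 1]
    · simp
    · intro s hs; simp [hs]
  refine ⟨2 / √(β ^ 2) * √((a * 2 : ℕ) : ℝ), fun N => ?_⟩
  refine norm_mul_pow_le_of_norm_mul_pow_mul_le (norm_stepElem_le hρ μ) (by positivity)
    (fun n => ?_) N
  rw [pow_mul]
  exact norm_one_sub_mul_sq_pow_le hβ0 hβ1 hX n

/-- Two consecutive large multiples of q are both return times, and 1-P^q is 1-P^(q(k+2)) minus
P^q(1-P^(q(k+1))). -/
theorem exists_norm_one_sub_pow_period_mul_pow_le (hgen : Subsemigroup.closure μ.support = ⊤)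
    (hq : IsPeriod μ q) (hρ : ∀ g, ‖ρ g‖ ≤ 1) :
    ∃ C : ℝ, ∀ N : ℕ, ‖(1 - stepElem ρ μ ^ q) * stepElem ρ μ ^ N‖ ≤ C / √(N + 1) := by
  have hq0 := hq.pos hgen
  obtain ⟨k, hk⟩ := hq.exists_one_mem_support hgen
  obtain ⟨C₁, h₁⟩ := exists_norm_one_sub_pow_mul_pow_le hρ (a := q * (k + 1)) (by positivity)
    (hk (k + 1) (by omega))
  obtain ⟨C₂, h₂⟩ := exists_norm_one_sub_pow_mul_pow_le hρ (a := q * (k + 2)) (by positivity)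
    (hk (k + 2) (by omega))
  set P := stepElem ρ μ
  have hP : ‖P‖ ≤ 1 := norm_stepElem_le hρ μ
  refine ⟨C₂ + C₁, fun N => ?_⟩
  have e : (1 - P ^ q) * P ^ N
      = (1 - P ^ (q * (k + 2))) * P ^ N - P ^ q * ((1 - P ^ (q * (k + 1))) * P ^ N) := by
    have : P ^ q * P ^ (q * (k + 1)) = P ^ (q * (k + 2)) := by rw [← pow_add]; congr 1; ring
    rw [← mul_assoc, mul_sub, this, mul_one, ← sub_mul]
    congr 1
    abel
  rw [e, add_div]
  refine (norm_sub_le _ _).trans (add_le_add (h₂ N) (((norm_mul_le _ _).trans ?_).trans (h₁ N)))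
  exact mul_le_of_le_one_left (norm_nonneg _) (norm_pow_le_one' hP _)

/-- The average of the laws of the walk over a period. -/
def avgProb (μ : PMF Γ) (q N : ℕ) (γ : Γ) : ℝ :=
  (q : ℝ)⁻¹ * ∑ i ∈ Finset.range q, (convPow μ (N + i) γ).toReal

theorem avgProb_nonneg (μ : PMF Γ) (q N : ℕ) (γ : Γ) : 0 ≤ avgProb μ q N γ := by
  unfold avgProb; positivity

theorem hasSum_avgProb (μ : PMF Γ) (hq : 0 < q) (N : ℕ) : HasSum (avgProb μ q N) 1 := by
  have h := (hasSum_sum fun i (_ : i ∈ Finset.range q) =>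
    (convPow μ (N + i)).hasSum_toReal).mul_left (q : ℝ)⁻¹
  have hq' : (q : ℝ) ≠ 0 := by positivity
  rw [Finset.sum_const, Finset.card_range, nsmul_eq_mul, mul_one, inv_mul_cancel₀ hq'] at h
  exact h

omit [NormOneClass A] in
theorem convElem_avgProb (hρ : ∀ g, ‖ρ g‖ ≤ 1) (μ : PMF Γ) (q N : ℕ) :
    convElem ρ (avgProb μ q N)
      = stepElem ρ μ ^ N * ((q : ℝ)⁻¹ • ∑ i ∈ Finset.range q, stepElem ρ μ ^ i) := by
  have hs : ∀ i ∈ Finset.range q, Summable fun s => (convPow μ (N + i) s).toReal :=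
    fun i _ => (convPow μ (N + i)).hasSum_toReal.summable
  unfold avgProb
  rw [convElem_smul hρ _ (summable_sum hs), convElem_sum hρ _ hs, mul_smul_comm, Finset.mul_sum]
  simp_rw [convElem_convPow hρ, pow_add]

omit [NormOneClass A] [CompleteSpace A] in
-- Averaging over a period replaces 1-P, for which decay may fail by periodicity, by 1-P^q, for
-- which it holds.
theorem one_sub_mul_avg (P : A) (q : ℕ) :
    (1 - P) * ((q : ℝ)⁻¹ • ∑ i ∈ Finset.range q, P ^ i) = (q : ℝ)⁻¹ • (1 - P ^ q) := by
  rw [mul_smul_comm, mul_neg_geom_sum]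

variable {Λ : Subgroup Γ} [Λ.Normal] [Λ.FiniteIndex]

omit [Λ.Normal] in
theorem exists_bound_conjRep_mem (hgen : Subsemigroup.closure μ.support = ⊤) (z : Γ) :
    ∃ K : ℕ, ∀ x : CosetSpace Λ, ∃ a ≤ K, conjRep z x ∈ (convPow μ a).support := by
  choose a _ ha using fun x : CosetSpace Λ => exists_mem_support_convPow hgen (conjRep z x)
  exact ⟨∑ x, a x, fun x => ⟨a x, Finset.single_le_sum (f := a) (fun _ _ => Nat.zero_le _)
    (Finset.mem_univ x), ha x⟩⟩

/-- A conjugate of z reached in b steps has its q-th power reached in qb steps, and loops at 1 pad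
all these times to a common multiple of q. For z itself there may be no time at which both 1 and z
are charged, which is why z^q appears. -/
theorem exists_norm_one_sub_rep_pow_mul_pow_le (hΛ : ∀ a ∈ Λ, ∀ b ∈ Λ, a * b = b * a)
    (hgen : Subsemigroup.closure μ.support = ⊤) (hq : IsPeriod μ q) (hρ : ∀ g, ‖ρ g‖ ≤ 1)
    {z : Γ} (hz : z ∈ Λ) :
    ∃ C : ℝ, ∀ N : ℕ, ‖(1 - ρ (z ^ q)) * stepElem ρ μ ^ N‖ ≤ C / √(N + 1) := by
  have hq0 := hq.pos hgen
  obtain ⟨k₀, hk₀⟩ := hq.exists_one_mem_support hgen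
  obtain ⟨K, hK⟩ := exists_bound_conjRep_mem (Λ := Λ) hgen z
  set a := q * (k₀ + K + 1)
  have hy : ∀ x : CosetSpace Λ, conjRep (z ^ q) x ∈ (convPow μ a).support := fun x => by
    obtain ⟨b, hb, hx⟩ := hK x
    have := mul_mem_support_convPow (hk₀ (k₀ + K + 1 - b) (by omega)) (pow_mem_support_convPow hx q)
    rw [one_mul, ← mul_add, Nat.sub_add_cancel (by omega)] at this
    rw [conjRep_pow]
    exact this
  obtain ⟨C, hC⟩ := exists_norm_one_sub_mul_convElem_pow_le hΛ hρ (Λ.pow_mem hz q)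
    (convPow μ a).hasSum_toReal (fun _ => ENNReal.toReal_nonneg)
    (toReal_convPow_pos (hk₀ _ (by omega))) (fun x => toReal_convPow_pos (hy x))
  rw [convElem_convPow hρ] at hC
  exact ⟨_, norm_mul_pow_le_of_norm_mul_pow_mul_le (norm_stepElem_le hρ μ) (by positivity) hC⟩

/-- Let X be the law averaged over one period from time a. It charges 1 and all conjugates of y
whatever their residues modulo q, so (1-ρ(y))X^J is small for large J. For fixed J, (1-X^J)P^N S →
0, where S averages the powers of P over a period: 1-X is a multiple of 1-P, and (1-P)S = (1-P^q)/q.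
Fixing J before N costs the rate, but none is needed here. -/
theorem tendsto_norm_one_sub_rep_mul_avg (hΛ : ∀ a ∈ Λ, ∀ b ∈ Λ, a * b = b * a)
    (hgen : Subsemigroup.closure μ.support = ⊤) (hq : IsPeriod μ q) (hρ : ∀ g, ‖ρ g‖ ≤ 1)
    {y : Γ} (hy : y ∈ Λ) :
    Tendsto (fun N : ℕ => ‖(1 - ρ y) * convElem ρ (avgProb μ q N)‖) atTop (𝓝 0) := by
  have hq0 := hq.pos hgen
  have hq0' : (0 : ℝ) < q := by exact_mod_cast hq0
  obtain ⟨k₀, hk₀⟩ := hq.exists_one_mem_support hgen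
  obtain ⟨K, hK⟩ := exists_bound_conjRep_mem (Λ := Λ) hgen y
  obtain ⟨C₁, hC₁⟩ := exists_norm_one_sub_pow_period_mul_pow_le hgen hq hρ
  set a := q * (k₀ + K)
  have hpos : ∀ g : Γ, (∃ i < q, g ∈ (convPow μ (a + i)).support) → 0 < avgProb μ q a g := by
    rintro g ⟨i, hi, hg⟩
    have : 0 < ∑ i ∈ Finset.range q, (convPow μ (a + i) g).toReal :=
      Finset.sum_pos' (fun _ _ => ENNReal.toReal_nonneg)
        ⟨i, Finset.mem_range.2 hi, toReal_convPow_pos hg⟩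
    unfold avgProb
    positivity
  -- If the conjugate is reached in b steps, its slot in the period is b mod q; loops of total
  -- length q(k₀+K-⌊b/q⌋) fill the time up to a + b mod q.
  have hyx : ∀ x : CosetSpace Λ, ∃ i < q, conjRep y x ∈ (convPow μ (a + i)).support := fun x => by
    obtain ⟨b, hb, hx⟩ := hK x
    have hbq : b / q ≤ b := Nat.div_le_self b q
    refine ⟨b % q, Nat.mod_lt _ hq0, ?_⟩
    have := mul_mem_support_convPow (hk₀ (k₀ + K - b / q) (by omega)) hx
    rw [one_mul] at this
    convert this using 3
    conv_rhs => rw [← Nat.div_add_mod b q, ← add_assoc]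
    rw [← mul_add, Nat.div_add_mod, Nat.sub_add_cancel (by omega)]
  obtain ⟨C₂, hC₂⟩ := exists_norm_one_sub_mul_convElem_pow_le hΛ hρ hy (hasSum_avgProb μ hq0 a)
    (avgProb_nonneg μ q a) (hpos 1 ⟨0, hq0, by simpa using hk₀ _ (by omega)⟩)
    (fun x => hpos _ (hyx x))
  set P := stepElem ρ μ
  have hP : ‖P‖ ≤ 1 := norm_stepElem_le hρ μ
  set S : A := (q : ℝ)⁻¹ • ∑ i ∈ Finset.range q, P ^ i with hS
  have hPS : Commute P S := (Commute.sum_right _ _ _ fun i _ => Commute.self_pow P i).smul_right _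
  set X := convElem ρ (avgProb μ q a)
  have hX : X = P ^ a * S := convElem_avgProb hρ μ q a
  have hPX : Commute P X := hX ▸ (Commute.self_pow P a).mul_right hPS
  have hSX : Commute S X := hX ▸ (hPS.symm.pow_right a).mul_right (Commute.refl S)
  -- `1 - X` is divisible by `1 - P`
  obtain ⟨Q, hQ⟩ : ∃ Q, 1 - X = Q * (1 - P) := by
    refine ⟨(q : ℝ)⁻¹ • ∑ i ∈ Finset.range q, ∑ j ∈ Finset.range (a + i), P ^ j, ?_⟩
    rw [smul_mul_assoc, Finset.sum_mul]
    simp_rw [geom_sum_mul_neg]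
    rw [Finset.sum_sub_distrib, smul_sub, hX, hS, mul_smul_comm, Finset.mul_sum]
    simp_rw [pow_add]
    congr 1
    rw [Finset.sum_const, Finset.card_range, ← Nat.cast_smul_eq_nsmul ℝ, smul_smul,
      inv_mul_cancel₀ hq0'.ne', one_smul]
  have hmain : ∀ J : ℕ, Tendsto (fun N : ℕ => ‖(1 - X ^ J) * (P ^ N * S)‖) atTop (𝓝 0) := by
    intro J
    set R := (∑ i ∈ Finset.range J, X ^ i) * Q
    have e : ∀ N, (1 - X ^ J) * (P ^ N * S)
        = R * ((q : ℝ)⁻¹ • ((1 - P ^ q) * P ^ N)) := fun N => by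
      have h1 : (1 - P) * (P ^ N * S) = (q : ℝ)⁻¹ • ((1 - P ^ q) * P ^ N) := by
        rw [(hPS.pow_left N).eq, ← mul_assoc, one_sub_mul_avg, smul_mul_assoc]
      rw [← geom_sum_mul_neg, hQ, ← h1, mul_assoc, mul_assoc, mul_assoc]
    refine tendsto_of_le_div_sqrt (C := ‖R‖ * ((q : ℝ)⁻¹ * C₁)) (fun _ => norm_nonneg _)
      fun N => ?_
    rw [e, mul_div_assoc, mul_div_assoc]
    refine (norm_mul_le _ _).trans (mul_le_mul_of_nonneg_left ?_ (norm_nonneg _))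
    rw [norm_smul, Real.norm_of_nonneg (by positivity)]
    exact mul_le_mul_of_nonneg_left (hC₁ N) (by positivity)
  have hXN : ∀ N, ‖P ^ N * S‖ ≤ 1 := fun N => by
    rw [← convElem_avgProb hρ μ q N]
    refine (norm_convElem_le hρ (hasSum_avgProb μ hq0 N).summable).trans (le_of_eq ?_)
    simp [abs_of_nonneg (avgProb_nonneg μ q N _), (hasSum_avgProb μ hq0 N).tsum_eq]
  have hy2 : ‖1 - ρ y‖ ≤ 2 := by
    have := norm_sub_le 1 (ρ y)
    rw [norm_one] at this
    linarith [hρ y]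
  rw [Metric.tendsto_atTop]
  intro ε hε
  obtain ⟨J, hJ⟩ : ∃ J : ℕ, C₂ / √(J + 1) < ε / 2 := by
    have : Tendsto (fun n : ℕ => C₂ / √((n : ℝ) + 1)) atTop (𝓝 0) :=
      Tendsto.div_atTop tendsto_const_nhds
        (Real.tendsto_sqrt_atTop.comp (tendsto_atTop_add_const_right _ _ tendsto_natCast_atTop_atTop))
    exact (this.eventually_lt_const (half_pos hε)).exists
  obtain ⟨N₀, hN₀⟩ := eventually_atTop.1 ((hmain J).eventually_lt_const (show 0 < ε / 4 by positivity))
  refine ⟨N₀, fun N hN => ?_⟩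
  rw [Real.dist_0_eq_abs, abs_norm, convElem_avgProb hρ]
  have e : (1 - ρ y) * (P ^ N * S)
      = (1 - ρ y) * X ^ J * (P ^ N * S) + (1 - ρ y) * ((1 - X ^ J) * (P ^ N * S)) := by
    noncomm_ring
  have b1 : ‖(1 - ρ y) * X ^ J * (P ^ N * S)‖ < ε / 2 :=
    ((norm_mul_le _ _).trans (mul_le_of_le_one_right (norm_nonneg _) (hXN N))).trans_lt
      ((hC₂ J).trans_lt hJ)
  have b2 : ‖(1 - ρ y) * ((1 - X ^ J) * (P ^ N * S))‖ ≤ 2 * (ε / 4) :=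
    (norm_mul_le _ _).trans (mul_le_mul hy2 (hN₀ N hN).le (norm_nonneg _) (by norm_num))
  change ‖(1 - ρ y) * (P ^ N * S)‖ < ε
  rw [e]
  refine (norm_add_le _ _).trans_lt ?_
  linarith

end WalkRegularity

/-! ### From generators of ℤ^m to arbitrary translations -/

section LatticeTranslations

variable {A : Type*} [NormedRing A] {m : ℕ}

theorem norm_one_sub_mul_mul_le {M : Type*} [Monoid M] {σ : M →* A} (hσ : ∀ a, ‖σ a‖ ≤ 1)
    (X : A) (a b : M) : ‖(1 - σ (a * b)) * X‖ ≤ ‖(1 - σ a) * X‖ + ‖(1 - σ b) * X‖ := by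
  have e : (1 - σ (a * b)) * X = (1 - σ a) * X + σ a * ((1 - σ b) * X) := by
    rw [map_mul]; noncomm_ring
  rw [e]
  refine (norm_add_le _ _).trans (add_le_add le_rfl ((norm_mul_le _ _).trans ?_))
  exact mul_le_of_le_one_left (norm_nonneg _) (hσ a)

theorem norm_one_sub_pow_mul_le {M : Type*} [Monoid M] {σ : M →* A} (hσ : ∀ a, ‖σ a‖ ≤ 1)
    (X : A) (a : M) (n : ℕ) : ‖(1 - σ (a ^ n)) * X‖ ≤ n * ‖(1 - σ a) * X‖ := by
  induction n with
  | zero => simp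
  | succ n ih =>
    rw [pow_succ]
    refine (norm_one_sub_mul_mul_le hσ X _ _).trans ?_
    push_cast
    linarith

theorem norm_one_sub_inv_mul_le {M : Type*} [Group M] {σ : M →* A} (hσ : ∀ a, ‖σ a‖ ≤ 1)
    (X : A) (a : M) : ‖(1 - σ a⁻¹) * X‖ ≤ ‖(1 - σ a) * X‖ := by
  have h : σ a⁻¹ * σ a = 1 := by rw [← map_mul]; simp
  have e : (1 - σ a⁻¹) * X = -(σ a⁻¹ * ((1 - σ a) * X)) := by
    rw [← mul_assoc, mul_sub, h, mul_one, ← neg_mul, neg_sub]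
  rw [e, norm_neg]
  exact (norm_mul_le _ _).trans (mul_le_of_le_one_left (norm_nonneg _) (hσ _))

theorem norm_one_sub_zpow_mul_le {M : Type*} [Group M] {σ : M →* A} (hσ : ∀ a, ‖σ a‖ ≤ 1)
    (X : A) (a : M) (n : ℤ) : ‖(1 - σ (a ^ n)) * X‖ ≤ |(n : ℝ)| * ‖(1 - σ a) * X‖ := by
  obtain ⟨k, rfl | rfl⟩ := n.eq_nat_or_neg
  · simpa using norm_one_sub_pow_mul_le hσ X a k
  · rw [zpow_neg, zpow_natCast]
    refine (norm_one_sub_inv_mul_le hσ X _).trans ?_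
    simpa using norm_one_sub_pow_mul_le hσ X a k

theorem norm_one_sub_prod_mul_le {M ι : Type*} [CommMonoid M] {σ : M →* A} (hσ : ∀ a, ‖σ a‖ ≤ 1)
    (X : A) (t : Finset ι) (f : ι → M) :
    ‖(1 - σ (∏ i ∈ t, f i)) * X‖ ≤ ∑ i ∈ t, ‖(1 - σ (f i)) * X‖ := by
  classical
  induction t using Finset.induction_on with
  | empty => simp
  | insert i t hi ih =>
    rw [Finset.prod_insert hi, Finset.sum_insert hi]
    exact (norm_one_sub_mul_mul_le hσ X _ _).trans (add_le_add le_rfl ih)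

/-- The standard generators of `ℤ^m`, written multiplicatively. -/
def latticeGen (i : Fin m) : Multiplicative (Fin m → ℤ) := Multiplicative.ofAdd (Pi.single i 1)

theorem ofAdd_eq_prod_latticeGen_zpow (j : Fin m → ℤ) :
    Multiplicative.ofAdd j = ∏ i, latticeGen i ^ j i := by
  apply Multiplicative.toAdd.injective
  rw [toAdd_prod]
  funext k
  simp [latticeGen, Finset.sum_apply, Pi.single_apply]

/-- Each coordinate is divided by q with remainder. Only q-th powers of generators come with a rate,
while the remainders are fewer than q unit translations, contributing a term independent of j. -/
theorem norm_one_sub_lattice_mul_le {σ : Multiplicative (Fin m → ℤ) →* A} (hσ : ∀ a, ‖σ a‖ ≤ 1)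
    (X : A) {q : ℕ} (hq : 0 < q) (j : Fin m → ℤ) :
    ‖(1 - σ (Multiplicative.ofAdd j)) * X‖
      ≤ (∑ i, |(j i : ℝ)|) * (∑ i, ‖(1 - σ (latticeGen i ^ q)) * X‖)
        + q * ∑ i, ‖(1 - σ (latticeGen i)) * X‖ := by
  rw [ofAdd_eq_prod_latticeGen_zpow]
  refine (norm_one_sub_prod_mul_le hσ X _ _).trans ?_
  rw [Finset.mul_sum, Finset.mul_sum, ← Finset.sum_add_distrib]
  refine Finset.sum_le_sum fun i _ => ?_
  set g := latticeGen i
  have e : g ^ j i = (g ^ q) ^ (j i / q) * g ^ (j i % q) := by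
    rw [← zpow_natCast, ← zpow_mul, ← zpow_add, Int.mul_ediv_add_emod]
  rw [e]
  refine (norm_one_sub_mul_mul_le hσ X _ _).trans (add_le_add ?_ ?_)
  · refine (norm_one_sub_zpow_mul_le hσ X _ _).trans (mul_le_mul_of_nonneg_right ?_ (norm_nonneg _))
    have h1 : |((j i / q : ℤ) : ℝ)| ≤ |(j i : ℝ)| := by
      have := Int.natAbs_ediv_le_natAbs (j i) q
      rw [← Int.cast_abs, ← Int.cast_abs, Int.abs_eq_natAbs, Int.abs_eq_natAbs]
      exact_mod_cast this
    exact h1.trans (Finset.single_le_sum (f := fun i => |(j i : ℝ)|) (fun _ _ => abs_nonneg _)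
      (Finset.mem_univ i))
  · refine (norm_one_sub_zpow_mul_le hσ X _ _).trans (mul_le_mul_of_nonneg_right ?_ (norm_nonneg _))
    have h0 : 0 ≤ j i % q := Int.emod_nonneg _ (by omega)
    have h1 : j i % q < q := Int.emod_lt_of_pos _ (by omega)
    rw [abs_of_nonneg (by exact_mod_cast h0)]
    exact_mod_cast h1.le

end LatticeTranslations

section

variable {Γ : Type*} [Group Γ] {μ : PMF Γ} {q : ℕ} {Λ : Subgroup Γ} [Λ.Normal] [Λ.FiniteIndex]
  {m : ℕ}

omit [Λ.Normal] [Λ.FiniteIndex] in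
theorem mul_comm_of_mulEquiv (φ : Λ ≃* Multiplicative (Fin m → ℤ)) :
    ∀ a ∈ Λ, ∀ b ∈ Λ, a * b = b * a := by
  intro a ha b hb
  have : (⟨a, ha⟩ : Λ) * ⟨b, hb⟩ = ⟨b, hb⟩ * ⟨a, ha⟩ := φ.injective (by
    rw [map_mul, map_mul, mul_comm])
  exact congrArg Subtype.val this

theorem exists_norm_one_sub_lattice_mul_avgProb_le (φ : Λ ≃* Multiplicative (Fin m → ℤ))
    (hgen : Subsemigroup.closure μ.support = ⊤) (hq : IsPeriod μ q) {A : Type*} [NormedRing A]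
    [NormedAlgebra ℝ A] [NormOneClass A] [CompleteSpace A] {ρ : Γ →* A} (hρ : ∀ g, ‖ρ g‖ ≤ 1) :
    ∃ (C : ℝ) (η : ℕ → ℝ), 0 ≤ C ∧ Tendsto η atTop (𝓝 0) ∧ ∀ (N : ℕ) (j : Fin m → ℤ),
      ‖(1 - ρ (φ.symm (Multiplicative.ofAdd j))) * convElem ρ (avgProb μ q N)‖
        ≤ C * (∑ i, |(j i : ℝ)|) / √(N + 1) + η N := by
  have hΛ := mul_comm_of_mulEquiv φ
  have hq0 := hq.pos hgen
  let σ : Multiplicative (Fin m → ℤ) →* A := ρ.comp (Λ.subtype.comp φ.symm.toMonoidHom)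
  have hσ : ∀ a, ‖σ a‖ ≤ 1 := fun a => hρ _
  set X : ℕ → A := fun N => convElem ρ (avgProb μ q N) with hX
  have h1 : ∀ i : Fin m, ∃ C : ℝ, ∀ N : ℕ, ‖(1 - σ (latticeGen i ^ q)) * X N‖ ≤ C / √(N + 1) := by
    intro i
    obtain ⟨C, hC⟩ := exists_norm_one_sub_rep_pow_mul_pow_le hΛ hgen hq hρ
      (φ.symm (latticeGen i)).2
    refine ⟨C, fun N => le_trans ?_ (hC N)⟩
    have hS : ‖(q : ℝ)⁻¹ • ∑ i ∈ Finset.range q, stepElem ρ μ ^ i‖ ≤ 1 := by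
      have h := convElem_avgProb hρ μ q 0
      rw [pow_zero, one_mul] at h
      rw [← h]
      refine (norm_convElem_le hρ (hasSum_avgProb μ hq0 0).summable).trans (le_of_eq ?_)
      simp [abs_of_nonneg (avgProb_nonneg μ q 0 _), (hasSum_avgProb μ hq0 0).tsum_eq]
    have e : σ (latticeGen i ^ q) = ρ ((φ.symm (latticeGen i) : Γ) ^ q) := by
      simp [σ]
    simp only [X]
    rw [e, convElem_avgProb hρ, ← mul_assoc]
    exact (norm_mul_le _ _).trans (mul_le_of_le_one_right (norm_nonneg _) hS)
  choose C hC using h1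
  have hC0 : ∀ i, 0 ≤ C i := fun i => by simpa using (norm_nonneg _).trans (hC i 0)
  refine ⟨∑ i, C i, fun N => q * ∑ i, ‖(1 - σ (latticeGen i)) * X N‖,
    Finset.sum_nonneg fun i _ => hC0 i, ?_, fun N j => ?_⟩
  · have : Tendsto (fun N => (q : ℝ) * ∑ i, ‖(1 - σ (latticeGen i)) * X N‖) atTop
        (𝓝 ((q : ℝ) * ∑ _i : Fin m, 0)) :=
      (tendsto_finsetSum _ fun i _ =>
        tendsto_norm_one_sub_rep_mul_avg hΛ hgen hq hρ (φ.symm (latticeGen i)).2).const_mul _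
    simpa using this
  · refine (norm_one_sub_lattice_mul_le hσ (X N) hq0 j).trans (add_le_add ?_ le_rfl)
    rw [mul_comm (∑ i, C i), mul_div_assoc, Finset.sum_div]
    exact mul_le_mul_of_nonneg_left (Finset.sum_le_sum fun i _ => hC i N)
      (Finset.sum_nonneg fun i _ => abs_nonneg _)

omit [Λ.Normal] [Λ.FiniteIndex] in
theorem Summable.comp_mul_left {f : Γ → ℝ} (hf : Summable f) (g : Γ) :
    Summable fun γ => f (g * γ) :=
  (Equiv.mulLeft g).summable_iff.2 hf

theorem exists_norm_convElem_translate_avgProb_sub_le (φ : Λ ≃* Multiplicative (Fin m → ℤ))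
    (hgen : Subsemigroup.closure μ.support = ⊤) (hq : IsPeriod μ q) {A : Type*} [NormedRing A]
    [NormedAlgebra ℝ A] [NormOneClass A] [CompleteSpace A] {ρ : Γ →* A} (hρ : ∀ g, ‖ρ g‖ ≤ 1) :
    ∃ (C : ℝ) (η : ℕ → ℝ), 0 ≤ C ∧ Tendsto η atTop (𝓝 0) ∧ ∀ (N : ℕ) (j : Fin m → ℤ),
      ‖convElem ρ fun γ =>
        avgProb μ q N ((φ.symm (Multiplicative.ofAdd j) : Γ)⁻¹ * γ) - avgProb μ q N γ‖
        ≤ C * (∑ i, |(j i : ℝ)|) / √(N + 1) + η N := by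
  obtain ⟨C, η, hC, hη, h⟩ := exists_norm_one_sub_lattice_mul_avgProb_le φ hgen hq hρ
  refine ⟨C, η, hC, hη, fun N j => le_trans (le_of_eq ?_) (h N j)⟩
  have hsum := (hasSum_avgProb μ (hq.pos hgen) N).summable
  rw [convElem_sub hρ (hsum.comp_mul_left _) hsum, ← rep_mul_convElem hρ _ hsum, sub_mul, one_mul, norm_sub_rev]

/-- Translations by `j ∈ ℤ^m` change the averaged law of the walk at time `N` little in `ℓ¹`,
if `|j|` is small compared to `√N`. -/
theorem exists_tsum_abs_translate_avgProb_sub_le (φ : Λ ≃* Multiplicative (Fin m → ℤ))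
    (hgen : Subsemigroup.closure μ.support = ⊤) (hq : IsPeriod μ q) :
    ∃ (C : ℝ) (η : ℕ → ℝ), 0 ≤ C ∧ Tendsto η atTop (𝓝 0) ∧ ∀ (N : ℕ) (j : Fin m → ℤ),
      ∑' γ, |avgProb μ q N ((φ.symm (Multiplicative.ofAdd j) : Γ)⁻¹ * γ) - avgProb μ q N γ|
        ≤ C * (∑ i, |(j i : ℝ)|) / √(N + 1) + η N := by
  obtain ⟨C, η, hC, hη, h⟩ := exists_norm_convElem_translate_avgProb_sub_le φ hgen hq
    (norm_leftTranslation_le (Γ := Γ))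
  refine ⟨C, η, hC, hη, fun N j => le_trans (tsum_abs_le_norm_convElem ?_) (h N j)⟩
  have hsum := (hasSum_avgProb μ (hq.pos hgen) N).summable
  exact (hsum.comp_mul_left _).sub hsum

omit [Λ.Normal] [Λ.FiniteIndex] in
theorem exists_norm_convElem_convPow_add_period_sub_le
    (hgen : Subsemigroup.closure μ.support = ⊤) (hq : IsPeriod μ q) {A : Type*} [NormedRing A]
    [NormedAlgebra ℝ A] [NormOneClass A] [CompleteSpace A] {ρ : Γ →* A} (hρ : ∀ g, ‖ρ g‖ ≤ 1) :
    ∃ C : ℝ, ∀ N : ℕ, ‖convElem ρ fun γ =>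
      (convPow μ (N + q) γ).toReal - (convPow μ N γ).toReal‖ ≤ C / √(N + 1) := by
  obtain ⟨C, hC⟩ := exists_norm_one_sub_pow_period_mul_pow_le hgen hq hρ
  refine ⟨C, fun N => le_trans (le_of_eq ?_) (hC N)⟩
  rw [convElem_sub hρ (convPow μ (N + q)).hasSum_toReal.summable
    (convPow μ N).hasSum_toReal.summable, convElem_convPow hρ, convElem_convPow hρ, norm_sub_rev,
    sub_mul, one_mul, ← pow_add, add_comm N q]

omit [Λ.Normal] [Λ.FiniteIndex] in
-- The laws at times N and N+q agree asymptotically; this disposes of the boundary terms when a sum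
-- over one period telescopes.
theorem tendsto_tsum_abs_convPow_add_period_sub (hgen : Subsemigroup.closure μ.support = ⊤)
    (hq : IsPeriod μ q) :
    Tendsto (fun N => ∑' γ, |(convPow μ (N + q) γ).toReal - (convPow μ N γ).toReal|) atTop
      (𝓝 0) := by
  obtain ⟨C, hC⟩ := exists_norm_convElem_convPow_add_period_sub_le hgen hq
    (norm_leftTranslation_le (Γ := Γ))
  refine tendsto_of_le_div_sqrt (C := C) (fun N => tsum_nonneg fun _ => abs_nonneg _) fun N => ?_
  exact (tsum_abs_le_norm_convElem ((convPow μ (N + q)).hasSum_toReal.summable.sub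
    (convPow μ N).hasSum_toReal.summable)).trans (hC N)

end

theorem HasSum.of_eq {α B : Type*} [AddCommMonoid B] [TopologicalSpace B] {f g : α → B} {a b : B}
    (h : HasSum f a) (hf : ∀ x, g x = f x) (ha : b = a) : HasSum g b := by
  rw [funext hf, ha]
  exact h

/-! ### The chain on Λ\Γ: invariance, harmonic functions and the Poisson equation -/

section FiniteChain

variable {Γ : Type*} [Group Γ] {Λ : Subgroup Γ} [Λ.FiniteIndex] {μ : PMF Γ}

theorem summable_toReal_mul_comp {Γ : Type*} (μ : PMF Γ) {α : Type*} [Fintype α] (f : α → ℝ)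
    (τ : Γ → α) :
    Summable fun s => (μ s).toReal * f (τ s) :=
  μ.summable_smul (F := fun s => f (τ s)) fun s => norm_le_pi_norm f (τ s)

omit [Λ.FiniteIndex] in
theorem cosetMul_mul (x : CosetSpace Λ) (s t : Γ) :
    cosetMul x (s * t) = cosetMul (cosetMul x s) t := by
  obtain ⟨γ, rfl⟩ := Quotient.exists_rep x
  exact congrArg (cosetMk Λ) (mul_assoc γ s t).symm

theorem sum_comp_cosetMul {B : Type*} [AddCommMonoid B] (f : CosetSpace Λ → B) (s : Γ) :
    ∑ x, f (cosetMul x s) = ∑ x, f x :=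
  Equiv.sum_comp (cosetPerm Λ s) f

/-- Every right translation permutes Λ\Γ, so the uniform measure is invariant. The map τ covers both
the walk and its reversal. -/
theorem sum_tsum_toReal_mul_cosetMul (μ : PMF Γ) (f : CosetSpace Λ → ℝ) (τ : Γ → Γ) :
    ∑ x, ∑' s, (μ s).toReal * f (cosetMul x (τ s)) = ∑ x, f x := by
  rw [← Summable.tsum_finsetSum fun x _ => summable_toReal_mul_comp μ f fun s => cosetMul x (τ s)]
  simp_rw [← Finset.mul_sum, sum_comp_cosetMul]
  rw [tsum_mul_right, μ.hasSum_toReal.tsum_eq, one_mul]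

/-- For harmonic f, the mean squared increment at x is the one-step mean of f² minus f(x)². These
sum to zero over x by invariance of the uniform measure, so every increment of positive weight
vanishes. -/
theorem cosetMul_eq_of_harmonic (f : CosetSpace Λ → ℝ) (τ : Γ → Γ)
    (hf : ∀ x, ∑' s, (μ s).toReal * f (cosetMul x (τ s)) = f x) {s : Γ} (hs : s ∈ μ.support)
    (x : CosetSpace Λ) : f (cosetMul x (τ s)) = f x := by
  have hsq : ∀ x, HasSum (fun s => (μ s).toReal * (f (cosetMul x (τ s)) - f x) ^ 2)
      (∑' s, (μ s).toReal * f (cosetMul x (τ s)) ^ 2 - f x ^ 2) := fun x => by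
    have h1 := (summable_toReal_mul_comp μ (fun x => f x ^ 2) fun s => cosetMul x (τ s)).hasSum
    have h2 := (summable_toReal_mul_comp μ f fun s => cosetMul x (τ s)).hasSum
    rw [hf x] at h2
    exact ((h1.sub (h2.mul_right (2 * f x))).add (μ.hasSum_toReal.mul_right (f x ^ 2))).of_eq
      (fun s => by ring) (by ring)
  have hzero : ∑ x, ∑' s, (μ s).toReal * (f (cosetMul x (τ s)) - f x) ^ 2 = 0 := by
    simp_rw [fun x => (hsq x).tsum_eq]
    rw [Finset.sum_sub_distrib, sum_tsum_toReal_mul_cosetMul μ (fun x => f x ^ 2) τ, sub_self]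
  have hnn : ∀ x s, 0 ≤ (μ s).toReal * (f (cosetMul x (τ s)) - f x) ^ 2 := fun x s => by positivity
  have hx := (Finset.sum_eq_zero_iff_of_nonneg fun x _ => tsum_nonneg (hnn x)).1 hzero x
    (Finset.mem_univ x)
  have h0 : HasSum (fun s => (μ s).toReal * (f (cosetMul x (τ s)) - f x) ^ 2) 0 :=
    hx ▸ (hsq x).summable.hasSum
  have hsx := congrFun ((hasSum_zero_iff_of_nonneg (hnn x)).1 h0) s
  have hμ : (μ s).toReal ≠ 0 :=
    (ENNReal.toReal_pos ((PMF.mem_support_iff _ _).1 hs) (PMF.apply_ne_top _ _)).ne'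
  simpa [hμ, sub_eq_zero] using hsx

omit [Λ.FiniteIndex] in
theorem eq_of_forall_cosetMul_eq {B : Type*} (hgen : Subsemigroup.closure μ.support = ⊤)
    (f : CosetSpace Λ → B) (hf : ∀ s ∈ μ.support, ∀ x, f (cosetMul x s) = f x)
    (x y : CosetSpace Λ) : f x = f y := by
  have h : ∀ γ : Γ, ∀ x, f (cosetMul x γ) = f x := by
    intro γ
    have hγ : γ ∈ Subsemigroup.closure μ.support := hgen ▸ Subsemigroup.mem_top γ
    induction hγ using Subsemigroup.closure_induction with
    | mem s hs => exact hf s hs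
    | mul s t _ _ h1 h2 => intro x; rw [cosetMul_mul, h2, h1]
  obtain ⟨γ, rfl⟩ := Quotient.exists_rep x
  obtain ⟨δ, rfl⟩ := Quotient.exists_rep y
  have := h (γ⁻¹ * δ) ⟦γ⟧
  rw [← this]
  exact congrArg f (congrArg (cosetMk Λ) (mul_inv_cancel_left γ δ))

theorem eq_of_harmonic (hgen : Subsemigroup.closure μ.support = ⊤) (f : CosetSpace Λ → ℝ)
    (hf : ∀ x, ∑' s, (μ s).toReal * f (cosetMul x s) = f x) (x y : CosetSpace Λ) : f x = f y :=
  eq_of_forall_cosetMul_eq hgen f (fun _ hs => cosetMul_eq_of_harmonic f id hf hs) x y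

theorem eq_of_harmonic_inv (hgen : Subsemigroup.closure μ.support = ⊤) (f : CosetSpace Λ → ℝ)
    (hf : ∀ x, ∑' s, (μ s).toReal * f (cosetMul x s⁻¹) = f x) (x y : CosetSpace Λ) : f x = f y :=
  eq_of_forall_cosetMul_eq hgen f (fun s hs x => by
    have := cosetMul_eq_of_harmonic f (fun s => s⁻¹) hf hs (cosetMul x s)
    rwa [cosetMul_mul_inv, eq_comm] at this) x y

/-- The mean of a function on `Λ \ Γ`. -/
def cosetMean (f : CosetSpace Λ → ℝ) : ℝ := (Λ.index : ℝ)⁻¹ * ∑ x, f x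

theorem card_cosetSpace (Λ : Subgroup Γ) [Λ.FiniteIndex] :
    Fintype.card (CosetSpace Λ) = Λ.index := by
  rw [Subgroup.index, ← Nat.card_eq_fintype_card]
  exact Nat.card_congr (QuotientGroup.quotientRightRelEquivQuotientLeftRel Λ)

theorem index_pos (Λ : Subgroup Γ) [Λ.FiniteIndex] : (0 : ℝ) < Λ.index := by
  exact_mod_cast Nat.pos_of_ne_zero Subgroup.FiniteIndex.index_ne_zero

theorem cosetMean_const (a : ℝ) : cosetMean (fun _ : CosetSpace Λ => a) = a := by
  rw [cosetMean, Finset.sum_const, Finset.card_univ, card_cosetSpace, nsmul_eq_mul,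
    inv_mul_cancel_left₀ (index_pos Λ).ne']

theorem cosetMean_add (f g : CosetSpace Λ → ℝ) :
    cosetMean (fun x => f x + g x) = cosetMean f + cosetMean g := by
  simp only [cosetMean, Finset.sum_add_distrib, mul_add]

theorem cosetMean_sub (f g : CosetSpace Λ → ℝ) :
    cosetMean (fun x => f x - g x) = cosetMean f - cosetMean g := by
  simp only [cosetMean, Finset.sum_sub_distrib, mul_sub]

variable (Λ) in
/-- The transition operator `f ↦ (x ↦ ∑ₛ μ(s) f(xs))` on functions on `Λ \ Γ`. -/
def transOp (μ : PMF Γ) : (CosetSpace Λ → ℝ) →ₗ[ℝ] CosetSpace Λ → ℝ where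
  toFun f x := ∑' s, (μ s).toReal * f (cosetMul x s)
  map_add' f g := by
    funext x
    simp only [Pi.add_apply, mul_add]
    exact (summable_toReal_mul_comp μ f fun s => cosetMul x s).tsum_add
      (summable_toReal_mul_comp μ g fun s => cosetMul x s)
  map_smul' a f := by
    funext x
    simp only [Pi.smul_apply, smul_eq_mul, RingHom.id_apply, ← tsum_mul_left, mul_left_comm]

theorem transOp_apply (f : CosetSpace Λ → ℝ) (x : CosetSpace Λ) :
    transOp Λ μ f x = ∑' s, (μ s).toReal * f (cosetMul x s) := rfl

theorem cosetMean_transOp (μ : PMF Γ) (f : CosetSpace Λ → ℝ) :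
    cosetMean (transOp Λ μ f) = cosetMean f := by
  rw [cosetMean, cosetMean, ← sum_tsum_toReal_mul_cosetMul μ f id]
  rfl

/-- Solvability of the Poisson equation on `Λ \ Γ`. -/
theorem exists_transOp_sub_eq (hgen : Subsemigroup.closure μ.support = ⊤)
    (g : CosetSpace Λ → ℝ) :
    ∃ f : CosetSpace Λ → ℝ, ∀ x, transOp Λ μ f x - f x = g x - cosetMean g := by
  -- Subtracting the mean removes the constants from the kernel of f ↦ Pf - f. The operator is then
  -- injective, hence onto by finite dimension, and comparing means in Tf = g gives `cosetMean f =
  -- -cosetMean g`.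
  let T : (CosetSpace Λ → ℝ) →ₗ[ℝ] CosetSpace Λ → ℝ :=
    { toFun := fun f x => transOp Λ μ f x - f x - cosetMean f
      map_add' := fun f h => by
        funext x
        simp only [map_add, Pi.add_apply]
        rw [show cosetMean (f + h) = _ from cosetMean_add f h]
        ring
      map_smul' := fun a f => by
        funext x
        simp only [map_smul, Pi.smul_apply, smul_eq_mul, RingHom.id_apply, cosetMean,
          ← Finset.mul_sum]
        ring }
  have hmean : ∀ f, cosetMean (T f) = -cosetMean f := fun f => by
    have : cosetMean (T f) = cosetMean (transOp Λ μ f) - cosetMean f - cosetMean f := by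
      have h1 := cosetMean_sub (fun x => transOp Λ μ f x - f x) fun _ => cosetMean f
      have h2 := cosetMean_sub (transOp Λ μ f) f
      rw [cosetMean_const] at h1
      rw [← h2, ← h1]
      rfl
    rw [this, cosetMean_transOp]
    ring
  have hinj : Function.Injective T := by
    rw [injective_iff_map_eq_zero]
    intro f hf
    have hm : cosetMean f = 0 := by
      have := hmean f
      rw [hf, show cosetMean (0 : CosetSpace Λ → ℝ) = 0 from cosetMean_const 0] at this
      linarith
    have hharm : ∀ x, ∑' s, (μ s).toReal * f (cosetMul x s) = f x := fun x => by
      have h1 : transOp Λ μ f x - f x - cosetMean f = 0 := congrFun hf x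
      rw [hm, transOp_apply] at h1
      linarith
    funext x
    have hc : cosetMean f = f x := by
      have : f = fun _ => f x := funext fun y => eq_of_harmonic hgen f hharm y x
      conv_lhs => rw [this]
      exact cosetMean_const _
    rw [← hc, hm]
    rfl
  obtain ⟨f, hf⟩ := LinearMap.injective_iff_surjective.1 hinj g
  refine ⟨f, fun x => ?_⟩
  have h1 : transOp Λ μ f x - f x - cosetMean f = g x := congrFun hf x
  have h2 := hmean f
  rw [hf] at h2
  linarith

end FiniteChain

/-! ### Edge sums and the stationary distribution -/

section EdgeSums

theorem hasSum_prod_of_fintype {α β : Type*} [Fintype α] {f : α × β → ℝ} {a : α → ℝ}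
    (h : ∀ x, HasSum (fun b => f (x, b)) (a x)) : HasSum f (∑ x, a x) := by
  classical
  have h1 : ∀ x, HasSum (fun e : α × β => if e.1 = x then f e else 0) (a x) := fun x => by
    refine (Function.Injective.hasSum_iff (g := fun b : β => (x, b)) (fun b b' hb => ?_) ?_).1 ?_
    · exact (Prod.mk.inj hb).2
    · rintro ⟨y, b⟩ hy
      rw [if_neg]
      rintro rfl
      exact hy ⟨b, rfl⟩
    · simpa [Function.comp_def] using h x
  have h2 := hasSum_sum fun x (_ : x ∈ Finset.univ) => h1 x
  simpa using h2

variable {Γ : Type*} [Group Γ] {Λ : Subgroup Γ} [Λ.FiniteIndex] {μ : PMF Γ}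

theorem hasSum_label_iff {F : Γ → ℝ} {a : ℝ} :
    HasSum (fun s : Label μ => (μ s).toReal * F s) a ↔ HasSum (fun s => (μ s).toReal * F s) a := by
  refine hasSum_subtype_iff_of_support_subset (f := fun s => (μ s).toReal * F s)
    (s := {s : Γ | s ∈ μ.support ∨ s⁻¹ ∈ μ.support}) ?_
  intro s hs
  left
  rw [PMF.mem_support_iff]
  intro h0
  simp [h0] at hs

/-- Reduces sums over edges to finitely many sums over steps. Labels that occur only as inverses of
steps have weight zero and drop out. -/
theorem hasSum_edge {F : CosetSpace Λ → Γ → ℝ} {a : CosetSpace Λ → ℝ}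
    (h : ∀ x, HasSum (fun s => (μ s).toReal * F x s) (a x)) (π : CosetSpace Λ → ℝ) :
    HasSum (fun e : QEdge Λ μ => F e.1 e.2 * (quotientDiagram Λ μ).conductance π e)
      (∑ x, π x * a x) := by
  refine hasSum_prod_of_fintype fun x => ?_
  refine ((hasSum_label_iff.2 (h x)).mul_left (π x)).of_eq (fun s => ?_) rfl
  change F x s * (π x * (μ s).toReal) = _
  ring

/-- The edges ending at x are the (xs⁻¹, s), so stationarity means harmonicity for the reversed
steps; such functions are constant. -/
theorem isStationary_iff (hgen : Subsemigroup.closure μ.support = ⊤) (π : CosetSpace Λ → ℝ) :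
    (quotientDiagram Λ μ).IsStationary π ↔ ∀ x, π x = 1 / (Λ.index : ℝ) := by
  have hd := index_pos Λ
  have key : ∀ x, ∀ a, HasSum (fun e : {e : QEdge Λ μ // (quotientDiagram Λ μ).t e = x} =>
      π ((quotientDiagram Λ μ).o e) * (quotientDiagram Λ μ).p e) a ↔
      HasSum (fun s => (μ s).toReal * π (cosetMul x s⁻¹)) a := fun x a => by
    rw [← hasSum_label_iff]
    let k : Label μ → {e : QEdge Λ μ // (quotientDiagram Λ μ).t e = x} := fun s =>
      ⟨(cosetMul x (s : Γ)⁻¹, s), by simpa [quotientDiagram] using cosetMul_mul_inv x (s : Γ)⁻¹⟩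
    have hk : k.Bijective := by
      refine ⟨fun a b h => congrArg (fun e => e.1.2) h, fun e => ⟨e.1.2, Subtype.ext ?_⟩⟩
      refine Prod.ext ?_ rfl
      have : cosetMul e.1.1 e.1.2 = x := e.2
      exact (congrArg (fun y => cosetMul y (e.1.2 : Γ)⁻¹) this).symm.trans (cosetMul_mul_inv _ _)
    rw [← (Equiv.ofBijective k hk).hasSum_iff]
    refine iff_of_eq (congrArg (fun f => HasSum f a) (funext fun s => ?_))
    exact mul_comm (π (cosetMul x (s : Γ)⁻¹)) (μ s).toReal
  constructor
  · rintro ⟨_, h1, h2⟩ x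
    have hconst : ∀ y, π y = π x := fun y =>
      eq_of_harmonic_inv hgen π (fun x => ((key x _).1 (h2 x)).tsum_eq) y x
    rw [Finset.sum_congr rfl fun y _ => hconst y, Finset.sum_const, Finset.card_univ,
      card_cosetSpace, nsmul_eq_mul] at h1
    field_simp
    linarith
  · intro h
    refine ⟨fun x => by rw [h]; positivity, ?_, fun x => (key x _).2 ?_⟩
    · rw [Finset.sum_congr rfl fun y _ => h y, Finset.sum_const, Finset.card_univ,
        card_cosetSpace, nsmul_eq_mul]
      field_simp
    · simp_rw [h]
      simpa using μ.hasSum_toReal.mul_right (1 / (Λ.index : ℝ))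

theorem existsUnique_isStationary (hgen : Subsemigroup.closure μ.support = ⊤) :
    ∃! π : CosetSpace Λ → ℝ, (quotientDiagram Λ μ).IsStationary π := by
  refine ⟨fun _ => 1 / (Λ.index : ℝ), (isStationary_iff hgen _).2 fun _ => rfl, fun π hπ => ?_⟩
  exact funext ((isStationary_iff hgen π).1 hπ)

end EdgeSums

/-! ### Increments of Φ, correctors and harmonic parts -/

section Increments

variable {Γ : Type*} [Group Γ] {Λ : Subgroup Γ} {m : ℕ} {Δ : Set Γ}
  (φ : Λ ≃* Multiplicative (Fin m → ℤ)) (hΔ : Subgroup.IsComplement (Λ : Set Γ) Δ)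

/-- The map `Φ`, with values in `ℝ^m`. -/
def realPhi (γ : Γ) : Fin m → ℝ := fun i => (Phi φ hΔ γ i : ℝ)

/-- The increment `Φ(γ s) - Φ(γ)` for `x = [γ]`. -/
def stepPhi (x : CosetSpace Λ) (s : Γ) : Fin m → ℝ :=
  realPhi φ hΔ (x.out * s) - realPhi φ hΔ x.out

theorem realPhi_mul (γ s : Γ) :
    realPhi φ hΔ (γ * s) = realPhi φ hΔ γ + stepPhi φ hΔ (cosetMk Λ γ) s := by
  obtain ⟨l, hl, h⟩ := exists_mul_eq_out (Λ := Λ) γ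
  have h1 := Phi_mul φ hΔ ⟨l, hl⟩ γ
  have h2 := Phi_mul φ hΔ ⟨l, hl⟩ (γ * s)
  simp only at h1 h2
  funext i
  simp only [stepPhi, realPhi, Pi.add_apply, Pi.sub_apply, h, mul_assoc, h1, h2]
  push_cast
  ring

theorem stepPhi_mk (γ s : Γ) :
    stepPhi φ hΔ (cosetMk Λ γ) s = realPhi φ hΔ (γ * s) - realPhi φ hΔ γ := by
  rw [realPhi_mul]; simp

theorem PhiEdge_eq {μ : PMF Γ} (e : QEdge Λ μ) : PhiEdge φ hΔ e = stepPhi φ hΔ e.1 e.2 := by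
  obtain ⟨x, s⟩ := e
  obtain ⟨γ, rfl⟩ := Quotient.exists_rep x
  refine (PhiEdge_mk φ hΔ γ s).trans ?_
  refine Eq.trans ?_ (stepPhi_mk φ hΔ γ s).symm
  funext i
  simp [realPhi]

theorem stepPhi_mul (x : CosetSpace Λ) (s t : Γ) :
    stepPhi φ hΔ x (s * t) = stepPhi φ hΔ x s + stepPhi φ hΔ (cosetMul x s) t := by
  obtain ⟨γ, rfl⟩ := Quotient.exists_rep x
  have h1 := stepPhi_mk φ hΔ γ (s * t)
  have h2 := stepPhi_mk φ hΔ γ s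
  have h3 := stepPhi_mk φ hΔ (γ * s) t
  change stepPhi φ hΔ (cosetMk Λ γ) (s * t)
    = stepPhi φ hΔ (cosetMk Λ γ) s + stepPhi φ hΔ (cosetMk Λ (γ * s)) t
  rw [h1, h2, h3, mul_assoc]
  abel

theorem stepPhi_one (x : CosetSpace Λ) : stepPhi φ hΔ x 1 = 0 := by
  simp [stepPhi]

theorem stepPhi_inv (x : CosetSpace Λ) (s : Γ) :
    stepPhi φ hΔ (cosetMul x s) s⁻¹ = -stepPhi φ hΔ x s := by
  have := stepPhi_mul φ hΔ x s s⁻¹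
  rw [mul_inv_cancel, stepPhi_one] at this
  exact (neg_eq_of_add_eq_zero_right this.symm).symm

variable [Λ.FiniteIndex]

/-- Increments add up along words by the cocycle identity `stepPhi_mul`, and there are finitely many
generators and cosets. This turns the moment hypothesis on word length into one on Φ. -/
theorem exists_abs_stepPhi_le {T : Finset Γ} (hT : Subgroup.closure (T : Set Γ) = ⊤) :
    ∃ K : ℝ, 0 ≤ K ∧ ∀ x s i, |stepPhi φ hΔ x s i| ≤ K * wordLength (T : Set Γ) s := by
  obtain ⟨K, hK, hT1⟩ : ∃ K : ℝ, 0 ≤ K ∧ ∀ t ∈ T, ∀ x i,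
      |stepPhi φ hΔ x t i| + |stepPhi φ hΔ x t⁻¹ i| ≤ K := by
    obtain ⟨K, hK⟩ := (Set.finite_range fun a : T × CosetSpace Λ × Fin m =>
      |stepPhi φ hΔ a.2.1 a.1 a.2.2| + |stepPhi φ hΔ a.2.1 (a.1 : Γ)⁻¹ a.2.2|).bddAbove
    exact ⟨max K 0, le_max_right _ _, fun t ht x i =>
      (hK ⟨(⟨t, ht⟩, x, i), rfl⟩).trans (le_max_left _ _)⟩
  have hgen : ∀ g, g ∈ T ∨ g⁻¹ ∈ T → ∀ x i, |stepPhi φ hΔ x g i| ≤ K := by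
    rintro g (hg | hg) x i
    · exact (le_add_of_nonneg_right (abs_nonneg _)).trans (hT1 g hg x i)
    · have := hT1 _ hg x i
      rw [inv_inv] at this
      exact (le_add_of_nonneg_left (abs_nonneg _)).trans this
  have hlist : ∀ l : List Γ, (∀ g ∈ l, g ∈ T ∨ g⁻¹ ∈ T) → ∀ x i,
      |stepPhi φ hΔ x l.prod i| ≤ K * l.length := by
    intro l
    induction l with
    | nil => intro _ x i; simp [stepPhi_one]
    | cons g l ih =>
      intro hl x i
      rw [List.prod_cons, stepPhi_mul, Pi.add_apply, List.length_cons]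
      refine (abs_add_le _ _).trans ?_
      have h1 := hgen g (hl g (by simp)) x i
      have h2 := ih (fun g' hg' => hl g' (by simp [hg'])) (cosetMul x g) i
      push_cast
      linarith
  refine ⟨K, hK, fun x s i => ?_⟩
  -- The infimum defining `wordLength` is attained only if some word exists; for an empty set it
  -- would be 0 by default.
  have hne : {n | ∃ l : List Γ, l.length = n ∧ (∀ g ∈ l, g ∈ (T : Set Γ) ∨ g⁻¹ ∈ (T : Set Γ)) ∧
      l.prod = s}.Nonempty := by
    have hs : s ∈ (Subgroup.closure (T : Set Γ)).toSubmonoid := by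
      rw [hT]; exact Subgroup.mem_top s
    rw [Subgroup.closure_toSubmonoid] at hs
    obtain ⟨l, hl, hs⟩ := Submonoid.exists_list_of_mem_closure hs
    exact ⟨_, l, rfl, hl, hs⟩
  obtain ⟨l, hl, hl2, rfl⟩ := Nat.sInf_mem hne
  have := hlist l hl2 x i
  rw [hl] at this
  exact this

variable {μ : PMF Γ} {T : Finset Γ}

theorem summable_stepPhi_sq (hT : Subgroup.closure (T : Set Γ) = ⊤)
    (hmom : FiniteSecondMoment (T : Set Γ) μ) (x : CosetSpace Λ) (i : Fin m) :
    Summable fun s => (μ s).toReal * stepPhi φ hΔ x s i ^ 2 := by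
  obtain ⟨K, hK, h⟩ := exists_abs_stepPhi_le φ hΔ hT
  refine Summable.of_nonneg_of_le (fun s => by positivity) (fun s => ?_) (hmom.mul_left (K ^ 2))
  have h1 : stepPhi φ hΔ x s i ^ 2 ≤ (K * wordLength (T : Set Γ) s) ^ 2 := by
    rw [← sq_abs]; gcongr; exact h x s i
  calc (μ s).toReal * stepPhi φ hΔ x s i ^ 2
      ≤ (μ s).toReal * (K * wordLength (T : Set Γ) s) ^ 2 := by gcongr
    _ = _ := by ring

theorem summable_mul_of_sq {α : Type*} (p : PMF α) {F G : α → ℝ}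
    (hF : Summable fun s => (p s).toReal * F s ^ 2)
    (hG : Summable fun s => (p s).toReal * G s ^ 2) :
    Summable fun s => (p s).toReal * (F s * G s) := by
  refine Summable.of_norm_bounded (hF.add hG) fun s => ?_
  rw [Real.norm_eq_abs, abs_mul, abs_of_nonneg ENNReal.toReal_nonneg, ← mul_add]
  refine mul_le_mul_of_nonneg_left ?_ ENNReal.toReal_nonneg
  rw [abs_mul]
  nlinarith [sq_nonneg (|F s| - |G s|), sq_abs (F s), sq_abs (G s), sq_nonneg (F s),
    sq_nonneg (G s)]

theorem summable_of_sq {α : Type*} (p : PMF α) {F : α → ℝ}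
    (hF : Summable fun s => (p s).toReal * F s ^ 2) :
    Summable fun s => (p s).toReal * F s := by
  have h1 : Summable fun s => (p s).toReal * (1 : ℝ) ^ 2 := by
    simpa using p.hasSum_toReal.summable
  simpa using summable_mul_of_sq p hF h1

theorem summable_sq_add {α : Type*} (p : PMF α) {F G : α → ℝ}
    (hF : Summable fun s => (p s).toReal * F s ^ 2)
    (hG : Summable fun s => (p s).toReal * G s ^ 2) :
    Summable fun s => (p s).toReal * (F s + G s) ^ 2 := by
  refine ((hF.add hG).add ((summable_mul_of_sq p hF hG).mul_left 2)).congr fun s => ?_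
  ring

theorem summable_sq_const_mul {α : Type*} (p : PMF α) {F : α → ℝ} (a : ℝ)
    (hF : Summable fun s => (p s).toReal * F s ^ 2) :
    Summable fun s => (p s).toReal * (a * F s) ^ 2 := by
  refine (hF.mul_left (a ^ 2)).congr fun s => ?_
  ring

theorem summable_sq_sum {α ι : Type*} (p : PMF α) {F : ι → α → ℝ} (t : Finset ι)
    (hF : ∀ i ∈ t, Summable fun s => (p s).toReal * F i s ^ 2) :
    Summable fun s => (p s).toReal * (∑ i ∈ t, F i s) ^ 2 := by
  classical
  induction t using Finset.induction_on with
  | empty => simp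
  | insert i t hi ih =>
    simp_rw [Finset.sum_insert hi]
    exact summable_sq_add p (hF i (by simp)) (ih fun j hj => hF j (by simp [hj]))

/-- The function `(x, s) ↦ ⟨v, Φ_e⟩ - df(e)` of the edge `e = (x, s)`. -/
def gradShift (v : Fin m → ℝ) (f : CosetSpace Λ → ℝ) (x : CosetSpace Λ) (s : Γ) : ℝ :=
  v ⬝ᵥ stepPhi φ hΔ x s - (f (cosetMul x s) - f x)

theorem summable_gradShift_sq (hT : Subgroup.closure (T : Set Γ) = ⊤)
    (hmom : FiniteSecondMoment (T : Set Γ) μ) (v : Fin m → ℝ) (f : CosetSpace Λ → ℝ)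
    (x : CosetSpace Λ) : Summable fun s => (μ s).toReal * gradShift φ hΔ v f x s ^ 2 := by
  have h1 : Summable fun s => (μ s).toReal * (v ⬝ᵥ stepPhi φ hΔ x s) ^ 2 :=
    summable_sq_sum μ Finset.univ fun i _ =>
      summable_sq_const_mul μ (v i) (summable_stepPhi_sq φ hΔ hT hmom x i)
  have h2 : Summable fun s => (μ s).toReal * (-(f (cosetMul x s) - f x)) ^ 2 :=
    summable_toReal_mul_comp μ (fun y => (-(f y - f x)) ^ 2) fun s => cosetMul x s
  exact summable_sq_add μ h1 h2

/-- The mean increment of `⟨v, Φ⟩` at the vertex `x`. -/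
def localDrift (μ : PMF Γ) (v : Fin m → ℝ) (x : CosetSpace Λ) : ℝ :=
  ∑' s, (μ s).toReal * (v ⬝ᵥ stepPhi φ hΔ x s)

theorem hasSum_gradShift (hT : Subgroup.closure (T : Set Γ) = ⊤)
    (hmom : FiniteSecondMoment (T : Set Γ) μ) (v : Fin m → ℝ) (f : CosetSpace Λ → ℝ)
    (x : CosetSpace Λ) : HasSum (fun s => (μ s).toReal * gradShift φ hΔ v f x s)
      (localDrift φ hΔ μ v x - (transOp Λ μ f x - f x)) := by
  have h1 : HasSum (fun s => (μ s).toReal * (v ⬝ᵥ stepPhi φ hΔ x s)) (localDrift φ hΔ μ v x) := by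
    have := summable_gradShift_sq φ hΔ hT hmom v 0 x
    simp only [gradShift, Pi.zero_apply, sub_self, sub_zero] at this
    exact (summable_of_sq μ this).hasSum
  have h2 := (summable_toReal_mul_comp μ f fun s => cosetMul x s).hasSum
  have h3 := μ.hasSum_toReal.mul_right (f x)
  refine (h1.sub (h2.sub h3)).of_eq (fun s => ?_) ?_
  · rw [gradShift]; ring
  · rw [one_mul]; rfl

theorem localDrift_eq_dotProduct (hT : Subgroup.closure (T : Set Γ) = ⊤)
    (hmom : FiniteSecondMoment (T : Set Γ) μ) (v : Fin m → ℝ) (x : CosetSpace Λ) :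
    localDrift φ hΔ μ v x = v ⬝ᵥ fun i => ∑' s, (μ s).toReal * stepPhi φ hΔ x s i := by
  have h := fun i => (summable_of_sq μ (summable_stepPhi_sq φ hΔ hT hmom x i)).hasSum
  have := hasSum_sum fun i (_ : i ∈ Finset.univ) => (h i).mul_left (v i)
  refine HasSum.tsum_eq (this.of_eq (fun s => ?_) rfl)
  rw [dotProduct, Finset.mul_sum]
  exact Finset.sum_congr rfl fun i _ => by ring

theorem summable_conductance_smul_PhiEdge (hT : Subgroup.closure (T : Set Γ) = ⊤)
    (hmom : FiniteSecondMoment (T : Set Γ) μ) {π : CosetSpace Λ → ℝ}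
    (hπ : ∀ x, π x = 1 / (Λ.index : ℝ)) :
    HasSum (fun e : QEdge Λ μ => (quotientDiagram Λ μ).conductance π e • PhiEdge φ hΔ e)
      (fun i => cosetMean fun x => ∑' s, (μ s).toReal * stepPhi φ hΔ x s i) := by
  rw [Pi.hasSum]
  intro i
  have h := fun x => (summable_of_sq μ (summable_stepPhi_sq φ hΔ hT hmom x i)).hasSum
  refine (hasSum_edge h π).of_eq (fun e => ?_) ?_
  · rw [PhiEdge_eq, Pi.smul_apply, smul_eq_mul, mul_comm]
  · rw [cosetMean, Finset.mul_sum]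
    exact Finset.sum_congr rfl fun x _ => by rw [hπ, one_div]

theorem dotProduct_drift (hT : Subgroup.closure (T : Set Γ) = ⊤)
    (hmom : FiniteSecondMoment (T : Set Γ) μ) {π : CosetSpace Λ → ℝ}
    (hπ : ∀ x, π x = 1 / (Λ.index : ℝ)) (v : Fin m → ℝ) :
    v ⬝ᵥ drift φ hΔ μ π = cosetMean (localDrift φ hΔ μ v) := by
  rw [drift, (summable_conductance_smul_PhiEdge φ hΔ hT hmom hπ).tsum_eq]
  simp only [cosetMean, localDrift_eq_dotProduct φ hΔ hT hmom, dotProduct]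
  rw [Finset.sum_comm, Finset.mul_sum]
  refine Finset.sum_congr rfl fun i _ => ?_
  rw [← Finset.mul_sum]
  ring

/-- `f` solves the Poisson equation that makes `v̂ - df` harmonic. -/
def IsCorrector (μ : PMF Γ) (v : Fin m → ℝ) (f : CosetSpace Λ → ℝ) : Prop :=
  ∀ x, transOp Λ μ f x - f x = localDrift φ hΔ μ v x - cosetMean (localDrift φ hΔ μ v)

theorem IsCorrector.hasSum {v : Fin m → ℝ} {f : CosetSpace Λ → ℝ}
    (hf : IsCorrector φ hΔ μ v f) (hT : Subgroup.closure (T : Set Γ) = ⊤)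
    (hmom : FiniteSecondMoment (T : Set Γ) μ) (x : CosetSpace Λ) :
    HasSum (fun s => (μ s).toReal * gradShift φ hΔ v f x s)
      (cosetMean (localDrift φ hΔ μ v)) :=
  (hasSum_gradShift φ hΔ hT hmom v f x).of_eq (fun _ => rfl) (by rw [hf x]; ring)

theorem sum_mul_eq_cosetMean {π : CosetSpace Λ → ℝ} (hπ : ∀ x, π x = 1 / (Λ.index : ℝ))
    (a : CosetSpace Λ → ℝ) : ∑ x, π x * a x = cosetMean a := by
  rw [cosetMean, Finset.mul_sum]
  exact Finset.sum_congr rfl fun x _ => by rw [hπ, one_div]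

/-- For u = v̂ - df, the codifferential at x is minus the mean increment there, and the pairing is
the average of `localDrift`, since df integrates to zero. Harmonicity is therefore the Poisson
equation for f, and the existence and uniqueness of u become those of f up to constants. -/
theorem isHarmonicPart_iff (hT : Subgroup.closure (T : Set Γ) = ⊤)
    (hmom : FiniteSecondMoment (T : Set Γ) μ) {π : CosetSpace Λ → ℝ}
    (hπ : ∀ x, π x = 1 / (Λ.index : ℝ)) (v : Fin m → ℝ) (u : QEdge Λ μ → ℝ) :
    (quotientDiagram Λ μ).IsHarmonicPart π (hatForm φ hΔ μ v) u ↔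
      ∃ f, IsCorrector φ hΔ μ v f ∧ u = fun e => gradShift φ hΔ v f e.1 e.2 := by
  have hd := index_pos Λ
  have hform : ∀ f, (hatForm φ hΔ μ v = u + (quotientDiagram Λ μ).diff f ↔
      u = fun e => gradShift φ hΔ v f e.1 e.2) := fun f => by
    rw [← sub_eq_iff_eq_add, eq_comm]
    refine iff_of_eq (congrArg (u = ·) (funext fun e => ?_))
    rw [Pi.sub_apply, hatForm, PhiEdge_eq]
    rfl
  have hharm : ∀ f, u = (fun e => gradShift φ hΔ v f e.1 e.2) →
      ((quotientDiagram Λ μ).IsHarmonic π u ↔ IsCorrector φ hΔ μ v f) := by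
    rintro f rfl
    have hl2 : (quotientDiagram Λ μ).IsL2Form π fun e => gradShift φ hΔ v f e.1 e.2 := by
      refine ⟨fun e => ?_, ?_⟩
      · change gradShift φ hΔ v f (cosetMul e.1 e.2) (e.2 : Γ)⁻¹ = -gradShift φ hΔ v f e.1 e.2
        rw [gradShift, gradShift, stepPhi_inv, cosetMul_mul_inv, dotProduct_neg]
        ring
      · exact (hasSum_edge (fun x => (summable_gradShift_sq φ hΔ hT hmom v f x).hasSum) π).summable
    have hpair : (quotientDiagram Λ μ).pairing π (fun e => gradShift φ hΔ v f e.1 e.2)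
        = cosetMean (localDrift φ hΔ μ v) := by
      rw [WeightedDiagram.pairing, (hasSum_edge (hasSum_gradShift φ hΔ hT hmom v f) π).tsum_eq,
        sum_mul_eq_cosetMean hπ, cosetMean_sub, cosetMean_sub, cosetMean_transOp]
      ring
    have hcod : ∀ x, (quotientDiagram Λ μ).codiff π (fun e => gradShift φ hΔ v f e.1 e.2) x
        = -(localDrift φ hΔ μ v x - (transOp Λ μ f x - f x)) := by
      intro x
      rw [WeightedDiagram.codiff]
      have k : (fun s : Label μ => (⟨(x, s), rfl⟩ : {e : QEdge Λ μ // e.1 = x})).Bijective := by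
        refine ⟨fun a b h => ?_, fun e => ⟨e.1.2, Subtype.ext (Prod.ext e.2.symm rfl)⟩⟩
        exact congrArg (fun e => e.1.2) h
      have h1 : HasSum (fun e : {e : QEdge Λ μ // e.1 = x} =>
          (quotientDiagram Λ μ).conductance π e * gradShift φ hΔ v f e.1.1 e.1.2)
          (π x * (localDrift φ hΔ μ v x - (transOp Λ μ f x - f x))) := by
        rw [← (Equiv.ofBijective _ k).hasSum_iff]
        refine ((hasSum_label_iff.2 (hasSum_gradShift φ hΔ hT hmom v f x)).mul_left (π x)).of_eq
          (fun s => ?_) rfl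
        exact mul_assoc (π x) (μ s).toReal (gradShift φ hΔ v f x s)
      have h2 := h1.tsum_eq
      change -(1 / π x) * (∑' e : {e : QEdge Λ μ // e.1 = x},
        (quotientDiagram Λ μ).conductance π e * gradShift φ hΔ v f e.1.1 e.1.2) = _
      rw [h2, hπ]
      field_simp
    rw [WeightedDiagram.IsHarmonic, and_iff_right hl2, hpair, IsCorrector]
    refine forall_congr' fun x => ?_
    rw [hcod]
    constructor <;> intro h <;> linarith
  rw [WeightedDiagram.IsHarmonicPart]
  constructor
  · rintro ⟨h1, f, h2⟩
    have h3 := (hform f).1 h2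
    exact ⟨f, (hharm f h3).1 h1, h3⟩
  · rintro ⟨f, h1, h2⟩
    exact ⟨(hharm f h2).2 h1, f, (hform f).2 h2⟩

theorem exists_isCorrector (hgen : Subsemigroup.closure μ.support = ⊤) (v : Fin m → ℝ) :
    ∃ f, IsCorrector φ hΔ μ v f :=
  exists_transOp_sub_eq hgen (localDrift φ hΔ μ v)

theorem IsCorrector.gradShift_eq (hgen : Subsemigroup.closure μ.support = ⊤) {v : Fin m → ℝ}
    {f g : CosetSpace Λ → ℝ} (hf : IsCorrector φ hΔ μ v f) (hg : IsCorrector φ hΔ μ v g) :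
    gradShift φ hΔ v f = gradShift φ hΔ v g := by
  have hharm : ∀ x, transOp Λ μ (f - g) x = (f - g) x := fun x => by
    have h1 := hf x
    have h2 := hg x
    rw [map_sub, Pi.sub_apply, Pi.sub_apply]
    linarith
  funext x s
  have := eq_of_harmonic hgen (f - g) hharm (cosetMul x s) x
  simp only [Pi.sub_apply] at this
  rw [gradShift, gradShift]
  linarith

theorem existsUnique_isHarmonicPart (hgen : Subsemigroup.closure μ.support = ⊤)
    (hT : Subgroup.closure (T : Set Γ) = ⊤)
    (hmom : FiniteSecondMoment (T : Set Γ) μ) {π : CosetSpace Λ → ℝ}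
    (hπ : ∀ x, π x = 1 / (Λ.index : ℝ)) (v : Fin m → ℝ) :
    ∃! u : QEdge Λ μ → ℝ, (quotientDiagram Λ μ).IsHarmonicPart π (hatForm φ hΔ μ v) u := by
  obtain ⟨f, hf⟩ := exists_isCorrector φ hΔ hgen v
  refine ⟨_, (isHarmonicPart_iff φ hΔ hT hmom hπ v _).2 ⟨f, hf, rfl⟩, fun u hu => ?_⟩
  obtain ⟨g, hg, rfl⟩ := (isHarmonicPart_iff φ hΔ hT hmom hπ v u).1 hu
  rw [hg.gradShift_eq φ hΔ hgen hf]

/-- The Poisson equation is linear in v, so correctors of the coordinate forms serve all directions;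
this allows the covariance to be defined as a matrix. -/
theorem isCorrector_sum (hT : Subgroup.closure (T : Set Γ) = ⊤)
    (hmom : FiniteSecondMoment (T : Set Γ) μ) {f : Fin m → CosetSpace Λ → ℝ}
    (hf : ∀ i, IsCorrector φ hΔ μ (Pi.single i 1) (f i)) (v : Fin m → ℝ) :
    IsCorrector φ hΔ μ v fun x => ∑ i, v i * f i x := by
  intro x
  have h0 : (fun x => ∑ i, v i * f i x) = ∑ i, v i • f i := by
    funext x; simp
  have h1 : ∀ i x, localDrift φ hΔ μ (Pi.single i 1) x
      = ∑' s, (μ s).toReal * stepPhi φ hΔ x s i := fun i x => by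
    rw [localDrift_eq_dotProduct φ hΔ hT hmom, single_one_dotProduct]
  have h2 : ∀ x, localDrift φ hΔ μ v x = ∑ i, v i * localDrift φ hΔ μ (Pi.single i 1) x := by
    intro x
    simp_rw [h1]
    exact localDrift_eq_dotProduct φ hΔ hT hmom v x
  have h3 : cosetMean (localDrift φ hΔ μ v)
      = ∑ i, v i * cosetMean (localDrift φ hΔ μ (Pi.single i 1)) := by
    simp only [cosetMean, h2]
    rw [Finset.sum_comm, Finset.mul_sum]
    refine Finset.sum_congr rfl fun i _ => ?_
    rw [← Finset.mul_sum]
    ring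
  rw [h0, map_sum, h2, h3, Finset.sum_apply, Finset.sum_apply, ← Finset.sum_sub_distrib,
    ← Finset.sum_sub_distrib]
  refine Finset.sum_congr rfl fun i _ => ?_
  have := hf i x
  rw [map_smul, Pi.smul_apply, Pi.smul_apply, smul_eq_mul, smul_eq_mul, ← mul_sub, this]
  ring

end Increments

/-! ### The covariance matrix and its positivity -/

section Covariance

variable {Γ : Type*} [Group Γ] {Λ : Subgroup Γ} {m : ℕ} {Δ : Set Γ}
  (φ : Λ ≃* Multiplicative (Fin m → ℤ)) (hΔ : Subgroup.IsComplement (Λ : Set Γ) Δ)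
  [Λ.FiniteIndex] {μ : PMF Γ} {T : Finset Γ}

variable (μ) in
/-- The centred increment `u(e) - ⟨c, u⟩` for `u = v̂ - df`. -/
def centredShift (v : Fin m → ℝ) (f : CosetSpace Λ → ℝ) (x : CosetSpace Λ) (s : Γ) : ℝ :=
  gradShift φ hΔ v f x s - cosetMean (localDrift φ hΔ μ v)

variable (μ) in
/-- The mean of the product of two centred increments over the steps from the vertex `x`. -/
def localCov (v w : Fin m → ℝ) (f g : CosetSpace Λ → ℝ) (x : CosetSpace Λ) : ℝ :=
  ∑' s, (μ s).toReal * (centredShift φ hΔ μ v f x s * centredShift φ hΔ μ w g x s)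

theorem summable_centredShift_sq (hT : Subgroup.closure (T : Set Γ) = ⊤)
    (hmom : FiniteSecondMoment (T : Set Γ) μ) (v : Fin m → ℝ) (f : CosetSpace Λ → ℝ)
    (x : CosetSpace Λ) : Summable fun s => (μ s).toReal * centredShift φ hΔ μ v f x s ^ 2 := by
  simp only [centredShift, sub_eq_add_neg]
  exact summable_sq_add μ (summable_gradShift_sq φ hΔ hT hmom v f x)
    (μ.hasSum_toReal.summable.mul_right _)

theorem hasSum_localCov (hT : Subgroup.closure (T : Set Γ) = ⊤)
    (hmom : FiniteSecondMoment (T : Set Γ) μ) (v w : Fin m → ℝ) (f g : CosetSpace Λ → ℝ)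
    (x : CosetSpace Λ) :
    HasSum (fun s => (μ s).toReal * (centredShift φ hΔ μ v f x s * centredShift φ hΔ μ w g x s))
      (localCov φ hΔ μ v w f g x) :=
  (summable_mul_of_sq μ (summable_centredShift_sq φ hΔ hT hmom v f x)
    (summable_centredShift_sq φ hΔ hT hmom w g x)).hasSum

theorem cosetMean_localDrift_eq_sum (hT : Subgroup.closure (T : Set Γ) = ⊤)
    (hmom : FiniteSecondMoment (T : Set Γ) μ) (v : Fin m → ℝ) :
    cosetMean (localDrift φ hΔ μ v)
      = ∑ i, v i * cosetMean (localDrift φ hΔ μ (Pi.single i 1)) := by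
  have hπ : ∀ x : CosetSpace Λ, (fun _ => 1 / (Λ.index : ℝ)) x = 1 / (Λ.index : ℝ) := fun _ => rfl
  simp_rw [← dotProduct_drift φ hΔ hT hmom hπ, single_one_dotProduct]
  rfl

theorem centredShift_sum (hT : Subgroup.closure (T : Set Γ) = ⊤)
    (hmom : FiniteSecondMoment (T : Set Γ) μ) (f : Fin m → CosetSpace Λ → ℝ) (v : Fin m → ℝ)
    (x : CosetSpace Λ) (s : Γ) :
    centredShift φ hΔ μ v (fun x => ∑ i, v i * f i x) x s
      = ∑ i, v i * centredShift φ hΔ μ (Pi.single i 1) (f i) x s := by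
  simp only [centredShift, gradShift, single_one_dotProduct,
    cosetMean_localDrift_eq_sum φ hΔ hT hmom v]
  simp only [dotProduct, ← Finset.sum_sub_distrib]
  exact Finset.sum_congr rfl fun i _ => by ring

variable (μ) in
/-- The covariance matrix of the walk, in terms of correctors of the coordinate forms. -/
def covMatrix (f : Fin m → CosetSpace Λ → ℝ) : Matrix (Fin m) (Fin m) ℝ :=
  Matrix.of fun i j => cosetMean (localCov φ hΔ μ (Pi.single i 1) (Pi.single j 1) (f i) (f j))

theorem dotProduct_covMatrix_mulVec (hT : Subgroup.closure (T : Set Γ) = ⊤)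
    (hmom : FiniteSecondMoment (T : Set Γ) μ) (f : Fin m → CosetSpace Λ → ℝ)
    (v w : Fin m → ℝ) :
    v ⬝ᵥ covMatrix φ hΔ μ f *ᵥ w = cosetMean (localCov φ hΔ μ v w (fun x => ∑ i, v i * f i x)
      fun x => ∑ i, w i * f i x) := by
  have h : ∀ x, localCov φ hΔ μ v w (fun x => ∑ i, v i * f i x) (fun x => ∑ i, w i * f i x) x
      = ∑ i, ∑ j, v i * w j *
        localCov φ hΔ μ (Pi.single i 1) (Pi.single j 1) (f i) (f j) x := fun x => by
    have h1 := hasSum_sum fun i (_ : i ∈ Finset.univ) => hasSum_sum fun j (_ : j ∈ Finset.univ) =>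
      (hasSum_localCov φ hΔ hT hmom (Pi.single i 1) (Pi.single j 1) (f i) (f j) x).mul_left
        (v i * w j)
    refine HasSum.tsum_eq (h1.of_eq (fun s => ?_) rfl)
    rw [centredShift_sum φ hΔ hT hmom, centredShift_sum φ hΔ hT hmom, Finset.sum_mul_sum,
      Finset.mul_sum]
    refine Finset.sum_congr rfl fun i _ => ?_
    rw [Finset.mul_sum]
    exact Finset.sum_congr rfl fun j _ => by ring
  simp only [cosetMean, h, covMatrix, dotProduct, Matrix.mulVec, Matrix.of_apply]
  rw [Finset.sum_comm, Finset.mul_sum]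
  refine Finset.sum_congr rfl fun i _ => ?_
  rw [Finset.sum_comm, Finset.mul_sum, Finset.mul_sum]
  refine Finset.sum_congr rfl fun j _ => ?_
  rw [← Finset.mul_sum]
  ring

/-- With correctors the mean increment is the same at every vertex, so the covariance over all edges
is the average of the local covariances, with no term between vertices. -/
theorem tsum_mul_conductance_sub_eq (hT : Subgroup.closure (T : Set Γ) = ⊤)
    (hmom : FiniteSecondMoment (T : Set Γ) μ) {π : CosetSpace Λ → ℝ}
    (hπ : ∀ x, π x = 1 / (Λ.index : ℝ)) {v w : Fin m → ℝ} {f g : CosetSpace Λ → ℝ}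
    (hf : IsCorrector φ hΔ μ v f) (hg : IsCorrector φ hΔ μ w g) :
    (∑' e : QEdge Λ μ, gradShift φ hΔ v f e.1 e.2 * gradShift φ hΔ w g e.1 e.2 *
        (quotientDiagram Λ μ).conductance π e) -
      (∑' e : QEdge Λ μ, gradShift φ hΔ v f e.1 e.2 * (quotientDiagram Λ μ).conductance π e) *
        ∑' e : QEdge Λ μ, gradShift φ hΔ w g e.1 e.2 * (quotientDiagram Λ μ).conductance π e
      = cosetMean (localCov φ hΔ μ v w f g) := by
  have h1 := fun x => hf.hasSum φ hΔ hT hmom x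
  have h2 := fun x => hg.hasSum φ hΔ hT hmom x
  have h3 := fun x => (summable_mul_of_sq μ (summable_gradShift_sq φ hΔ hT hmom v f x)
    (summable_gradShift_sq φ hΔ hT hmom w g x)).hasSum
  rw [(hasSum_edge h1 π).tsum_eq, (hasSum_edge h2 π).tsum_eq, (hasSum_edge h3 π).tsum_eq,
    sum_mul_eq_cosetMean hπ, sum_mul_eq_cosetMean hπ, sum_mul_eq_cosetMean hπ, cosetMean_const,
    cosetMean_const]
  have h4 : ∀ x, localCov φ hΔ μ v w f g x
      = (∑' s, (μ s).toReal * (gradShift φ hΔ v f x s * gradShift φ hΔ w g x s)) -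
        cosetMean (localDrift φ hΔ μ v) * cosetMean (localDrift φ hΔ μ w) := fun x => by
    have := (((h3 x).sub ((h1 x).mul_right (cosetMean (localDrift φ hΔ μ w)))).sub
      ((h2 x).mul_right (cosetMean (localDrift φ hΔ μ v)))).add (μ.hasSum_toReal.mul_right
        (cosetMean (localDrift φ hΔ μ v) * cosetMean (localDrift φ hΔ μ w)))
    refine HasSum.tsum_eq (this.of_eq (fun s => ?_) ?_)
    · rw [centredShift, centredShift]; ring
    · ring
  rw [funext h4, cosetMean_sub, cosetMean_const]

theorem covMatrix_apply_harmonicPart (hgen : Subsemigroup.closure μ.support = ⊤)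
    (hT : Subgroup.closure (T : Set Γ) = ⊤)
    (hmom : FiniteSecondMoment (T : Set Γ) μ) {π : CosetSpace Λ → ℝ}
    (hπ : ∀ x, π x = 1 / (Λ.index : ℝ)) {f : Fin m → CosetSpace Λ → ℝ}
    (hf : ∀ i, IsCorrector φ hΔ μ (Pi.single i 1) (f i)) (v₁ v₂ : Fin m → ℝ)
    (u₁ u₂ : QEdge Λ μ → ℝ)
    (h₁ : (quotientDiagram Λ μ).IsHarmonicPart π (hatForm φ hΔ μ v₁) u₁)
    (h₂ : (quotientDiagram Λ μ).IsHarmonicPart π (hatForm φ hΔ μ v₂) u₂) :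
    v₁ ⬝ᵥ covMatrix φ hΔ μ f *ᵥ v₂ =
      ∑' e, u₁ e * u₂ e * (quotientDiagram Λ μ).conductance π e -
        (∑' e, u₁ e * (quotientDiagram Λ μ).conductance π e) *
          ∑' e, u₂ e * (quotientDiagram Λ μ).conductance π e := by
  obtain ⟨g₁, hg₁, rfl⟩ := (isHarmonicPart_iff φ hΔ hT hmom hπ v₁ u₁).1 h₁
  obtain ⟨g₂, hg₂, rfl⟩ := (isHarmonicPart_iff φ hΔ hT hmom hπ v₂ u₂).1 h₂
  rw [dotProduct_covMatrix_mulVec φ hΔ hT hmom, tsum_mul_conductance_sub_eq φ hΔ hT hmom hπ hg₁ hg₂]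
  congr 1
  funext x
  simp only [localCov, centredShift,
    hg₁.gradShift_eq φ hΔ hgen (isCorrector_sum φ hΔ hT hmom hf v₁),
    hg₂.gradShift_eq φ hΔ hgen (isCorrector_sum φ hΔ hT hmom hf v₂)]

theorem covMatrix_isSymm (f : Fin m → CosetSpace Λ → ℝ) :
    (covMatrix φ hΔ μ f)ᵀ = covMatrix φ hΔ μ f := by
  ext i j
  simp only [Matrix.transpose_apply, covMatrix, Matrix.of_apply]
  congr 1
  funext x
  exact tsum_congr fun s => by ring

/-- `⟨v, Φ⟩ - f` as a function on `Γ`. -/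
def correctedPhi (v : Fin m → ℝ) (f : CosetSpace Λ → ℝ) (γ : Γ) : ℝ :=
  v ⬝ᵥ realPhi φ hΔ γ - f (cosetMk Λ γ)

omit [Λ.FiniteIndex] in
theorem correctedPhi_mul (v : Fin m → ℝ) (f : CosetSpace Λ → ℝ) (γ s : Γ) :
    correctedPhi φ hΔ v f (γ * s)
      = correctedPhi φ hΔ v f γ + gradShift φ hΔ v f (cosetMk Λ γ) s := by
  rw [correctedPhi, correctedPhi, gradShift, realPhi_mul, dotProduct_add, cosetMul_mk]
  ring

omit [Λ.FiniteIndex] in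
theorem realPhi_symm_mul (w : Fin m → ℤ) (γ : Γ) :
    realPhi φ hΔ (φ.symm (Multiplicative.ofAdd w) * γ) = (fun i => (w i : ℝ)) + realPhi φ hΔ γ := by
  funext i
  simp [realPhi, Phi_mul]

omit [Λ.FiniteIndex] in
theorem cosetMk_mem_mul {l : Γ} (hl : l ∈ Λ) (γ : Γ) : cosetMk Λ (l * γ) = cosetMk Λ γ :=
  Quotient.sound (QuotientGroup.rightRel_apply.2 (by simpa using Λ.inv_mem hl))

/-- Without variance, every step changes ⟨v, Φ⟩ - f by the same constant a. A loop at the identity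
forces a = 0, so the function is constant on Γ; but translation by the i-th basis vector changes it
by v i. -/
theorem eq_zero_of_localCov_eq_zero (hgen : Subsemigroup.closure μ.support = ⊤)
    (hT : Subgroup.closure (T : Set Γ) = ⊤) (hmom : FiniteSecondMoment (T : Set Γ) μ)
    {v : Fin m → ℝ} {f : CosetSpace Λ → ℝ} (h : cosetMean (localCov φ hΔ μ v v f f) = 0) :
    v = 0 := by
  set a := cosetMean (localDrift φ hΔ μ v)
  have hd := index_pos Λ
  have hnn : ∀ x s, 0 ≤ (μ s).toReal *
      (centredShift φ hΔ μ v f x s * centredShift φ hΔ μ v f x s) := fun x s =>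
    mul_nonneg ENNReal.toReal_nonneg (mul_self_nonneg _)
  have h1 : ∀ x, ∀ s ∈ μ.support, gradShift φ hΔ v f x s = a := by
    intro x s hs
    have h2 : ∑ x, localCov φ hΔ μ v v f f x = 0 := by
      rw [cosetMean] at h
      exact (mul_eq_zero.1 h).resolve_left (inv_ne_zero hd.ne')
    have h3 : localCov φ hΔ μ v v f f x = 0 := (Finset.sum_eq_zero_iff_of_nonneg fun x _ => tsum_nonneg (hnn x)).1 h2 x
      (Finset.mem_univ x)
    have h4 := hasSum_localCov φ hΔ hT hmom v v f f x
    rw [h3] at h4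
    have h5 := congrFun ((hasSum_zero_iff_of_nonneg (hnn x)).1 h4) s
    have hμ : (μ s).toReal ≠ 0 :=
      (ENNReal.toReal_pos ((PMF.mem_support_iff _ _).1 hs) (PMF.apply_ne_top _ _)).ne'
    simp only [Pi.zero_apply, mul_eq_zero, or_self, hμ, false_or, centredShift, sub_eq_zero] at h5
    exact h5
  have hlist : ∀ l : List Γ, (∀ s ∈ l, s ∈ μ.support) → ∀ γ,
      correctedPhi φ hΔ v f (γ * l.prod) = correctedPhi φ hΔ v f γ + l.length * a := by
    intro l
    induction l with
    | nil => intro _ γ; simp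
    | cons s l ih =>
      intro hl γ
      rw [List.prod_cons, ← mul_assoc, ih (fun t ht => hl t (by simp [ht])), correctedPhi_mul,
        h1 _ s (hl s (by simp)), List.length_cons]
      push_cast
      ring
  have ha : a = 0 := by
    obtain ⟨l, hl1, hl2, hl3⟩ := exists_list_of_closure_eq_top hgen (1 : Γ)
    have := hlist l hl2 1
    rw [hl3, mul_one, left_eq_add, mul_eq_zero] at this
    refine this.resolve_left ?_
    have : 0 < l.length := hl1
    positivity
  have hconst : ∀ γ, correctedPhi φ hΔ v f γ = correctedPhi φ hΔ v f 1 := by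
    intro γ
    obtain ⟨l, _, hl2, rfl⟩ := exists_list_of_closure_eq_top hgen γ
    have := hlist l hl2 1
    rwa [one_mul, ha, mul_zero, add_zero] at this
  funext i
  have h6 := hconst (φ.symm (Multiplicative.ofAdd (Pi.single i 1)) * 1)
  rw [correctedPhi, correctedPhi, realPhi_symm_mul, cosetMk_mem_mul (SetLike.coe_mem _),
    dotProduct_add] at h6
  have h7 : (fun k => ((Pi.single i 1 : Fin m → ℤ) k : ℝ)) = Pi.single i 1 := by
    funext k
    by_cases hk : k = i
    · subst hk; simp
    · simp [hk]
  rw [h7, dotProduct_single_one] at h6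
  simp only [Pi.zero_apply]
  linarith

theorem posDef_covMatrix (hgen : Subsemigroup.closure μ.support = ⊤)
    (hT : Subgroup.closure (T : Set Γ) = ⊤) (hmom : FiniteSecondMoment (T : Set Γ) μ)
    (f : Fin m → CosetSpace Λ → ℝ) : (covMatrix φ hΔ μ f).PosDef := by
  refine Matrix.PosDef.of_dotProduct_mulVec_pos ?_ fun v hv => ?_
  · rw [Matrix.IsHermitian, Matrix.conjTranspose_eq_transpose_of_trivial, covMatrix_isSymm]
  · rw [star_trivial, dotProduct_covMatrix_mulVec φ hΔ hT hmom]
    refine lt_of_le_of_ne ?_ fun h => hv (eq_zero_of_localCov_eq_zero φ hΔ hgen hT hmom h.symm)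
    exact mul_nonneg (inv_nonneg.2 (Nat.cast_nonneg _)) (Finset.sum_nonneg fun x _ =>
      tsum_nonneg fun s => mul_nonneg ENNReal.toReal_nonneg (mul_self_nonneg _))

end Covariance

/-! ### Taylor expansion of characteristic functions -/

/-- `e^{ix}`. -/
def expI (x : ℝ) : ℂ := Complex.exp (Complex.I * x)

theorem expI_add (x y : ℝ) : expI (x + y) = expI x * expI y := by
  simp [expI, mul_add, Complex.exp_add]

theorem expI_zero : expI 0 = 1 := by simp [expI]

theorem norm_expI (x : ℝ) : ‖expI x‖ = 1 := by
  rw [expI, mul_comm]; exact Complex.norm_exp_ofReal_mul_I x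

theorem continuous_expI : Continuous expI := by
  unfold expI; fun_prop

theorem norm_expI_sub_one_le (x : ℝ) : ‖expI x - 1‖ ≤ |x| :=
  Real.norm_exp_I_mul_ofReal_sub_one_le

theorem norm_expI_sub_expI_le (x y : ℝ) : ‖expI x - expI y‖ ≤ |x - y| := by
  have h : expI x - expI y = expI y * (expI (x - y) - 1) := by
    rw [mul_sub, ← expI_add, mul_one]; congr 2; ring
  rw [h, norm_mul, norm_expI, one_mul]
  exact norm_expI_sub_one_le _

/-- A quadratic bound valid for all x, used as the majorant in dominated convergence when only
second moments are finite. -/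
theorem norm_expI_sub_one_sub_le (x : ℝ) : ‖expI x - 1 - Complex.I * x‖ ≤ 3 * x ^ 2 := by
  have hn : ‖Complex.I * (x : ℂ)‖ = |x| := by simp
  rcases le_total |x| 1 with hx | hx
  · have := Complex.norm_exp_sub_one_sub_id_le (x := Complex.I * x) (by rwa [hn])
    rw [hn, sq_abs] at this
    refine this.trans ?_
    nlinarith [sq_nonneg x]
  · refine (norm_sub_le _ _).trans ?_
    rw [hn]
    have h1 := norm_sub_le (expI x) 1
    rw [norm_expI, norm_one] at h1
    nlinarith [sq_abs x]

theorem norm_expI_sub_taylor_le {x : ℝ} (hx : |x| ≤ 1) :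
    ‖expI x - 1 - Complex.I * x + x ^ 2 / 2‖ ≤ |x| ^ 3 := by
  have hn : ‖Complex.I * (x : ℂ)‖ = |x| := by simp
  have h := Complex.exp_bound (x := Complex.I * x) (by rwa [hn]) (n := 3) (by norm_num)
  rw [hn] at h
  have e : Complex.exp (Complex.I * x) - ∑ k ∈ Finset.range 3, (Complex.I * (x : ℂ)) ^ k / (k.factorial : ℂ)
      = expI x - 1 - Complex.I * x + x ^ 2 / 2 := by
    simp only [Finset.sum_range_succ, Finset.sum_range_zero, mul_pow, Complex.I_sq, expI]
    norm_num [Nat.factorial]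
    ring
  rw [e] at h
  refine h.trans ?_
  norm_num [Nat.factorial]
  nlinarith [pow_nonneg (abs_nonneg x) 3]

theorem tendsto_expI_taylor (y : ℝ) :
    Tendsto (fun h : ℝ => (expI (h * y) - 1 - Complex.I * (h * y : ℝ)) / (h : ℂ) ^ 2) (𝓝[≠] 0)
      (𝓝 (-(y : ℂ) ^ 2 / 2)) := by
  rw [tendsto_iff_norm_sub_tendsto_zero]
  have h0 : Tendsto (fun h : ℝ => |h| * |y| ^ 3) (𝓝[≠] 0) (𝓝 0) := by
    have : Continuous fun h : ℝ => |h| * |y| ^ 3 := by fun_prop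
    simpa using (this.tendsto 0).mono_left nhdsWithin_le_nhds
  have h1 : ∀ᶠ h : ℝ in 𝓝[≠] 0, |h * y| ≤ 1 := by
    have : Continuous fun h : ℝ => |h * y| := by fun_prop
    have := (this.tendsto 0).mono_left (nhdsWithin_le_nhds (s := {0}ᶜ))
    rw [zero_mul, abs_zero] at this
    exact this.eventually_le_const one_pos
  refine squeeze_zero' (Eventually.of_forall fun _ => norm_nonneg _) ?_ h0
  filter_upwards [h1, self_mem_nhdsWithin] with h hh (hne : h ≠ 0)
  have hc : (h : ℂ) ≠ 0 := by exact_mod_cast hne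
  have e : (expI (h * y) - 1 - Complex.I * (h * y : ℝ)) / (h : ℂ) ^ 2 - -(y : ℂ) ^ 2 / 2
      = (expI (h * y) - 1 - Complex.I * (h * y : ℝ) + ((h * y : ℝ) : ℂ) ^ 2 / 2) / (h : ℂ) ^ 2 := by
    push_cast
    field_simp
    ring
  rw [e, norm_div, norm_pow, Complex.norm_real, Real.norm_eq_abs, div_le_iff₀ (by positivity)]
  refine (norm_expI_sub_taylor_le hh).trans (le_of_eq ?_)
  rw [abs_mul]; ring

/-- Second order expansion of a centred characteristic function carrying a weight 1+h²k/2: the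
variance enters with a minus sign and the mean of k with a plus sign, so k can later offset
fluctuations of the variance. -/
theorem tendsto_tsum_expI_mul_taylor {α : Type*} (p : PMF α) {Y k : α → ℝ} {K b c : ℝ}
    (hk : ∀ s, |k s| ≤ K) (h1 : HasSum (fun s => (p s).toReal * Y s) 0)
    (h2 : HasSum (fun s => (p s).toReal * Y s ^ 2) b)
    (h3 : HasSum (fun s => (p s).toReal * k s) c) :
    Tendsto (fun h : ℝ => (∑' s, (p s).toReal • (expI (h * Y s) * (1 + h ^ 2 / 2 * k s)) - 1)
      / (h : ℂ) ^ 2) (𝓝[≠] 0) (𝓝 (((c - b) / 2 : ℝ) : ℂ)) := by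
  have hK : ∀ s, 0 ≤ K := fun s => (abs_nonneg _).trans (hk s)
  let G : ℝ → α → ℂ := fun h s =>
    (p s).toReal • ((expI (h * Y s) - 1 - Complex.I * (h * Y s : ℝ)) / (h : ℂ) ^ 2
      + expI (h * Y s) * (k s / 2))
  have hG : ∀ h : ℝ, h ≠ 0 → ∑' s, G h s
      = (∑' s, (p s).toReal • (expI (h * Y s) * (1 + h ^ 2 / 2 * k s)) - 1) / (h : ℂ) ^ 2 := by
    intro h hh
    have hc : (h : ℂ) ≠ 0 := by exact_mod_cast hh
    have s1 : Summable fun s => (p s).toReal • (expI (h * Y s) * (1 + (h : ℂ) ^ 2 / 2 * k s)) := by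
      refine p.summable_smul (K := 1 + |h| ^ 2 / 2 * K) fun s => ?_
      rw [norm_mul, norm_expI, one_mul]
      refine (norm_add_le _ _).trans ?_
      simp only [norm_one, norm_mul, norm_div, norm_pow, Complex.norm_real, Real.norm_eq_abs,
        Complex.norm_ofNat]
      gcongr
      exact hk s
    have s2 : HasSum (fun s => (((p s).toReal : ℝ) : ℂ)) 1 := by
      have := Complex.hasSum_ofReal.2 p.hasSum_toReal
      rwa [Complex.ofReal_one] at this
    have s3 : HasSum (fun s => (((p s).toReal * Y s : ℝ) : ℂ)) 0 := by
      have := Complex.hasSum_ofReal.2 h1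
      rwa [Complex.ofReal_zero] at this
    have := ((s1.hasSum.sub s2).sub (s3.mul_left (Complex.I * h))).div_const ((h : ℂ) ^ 2)
    rw [mul_zero, sub_zero] at this
    refine HasSum.tsum_eq (this.of_eq (fun s => ?_) rfl)
    simp only [G, Complex.real_smul]
    push_cast
    field_simp
    ring
  have hlim : ∑' s, (p s).toReal • (-(Y s : ℂ) ^ 2 / 2 + 1 * (k s / 2)) = (((c - b) / 2 : ℝ) : ℂ) := by
    have := Complex.hasSum_ofReal.2 ((h3.sub h2).div_const 2)
    refine HasSum.tsum_eq (this.of_eq (fun s => ?_) rfl)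
    rw [Complex.real_smul]
    push_cast
    ring
  rw [← hlim]
  refine Tendsto.congr' (f₁ := fun h => ∑' s, G h s) ?_ ?_
  · filter_upwards [self_mem_nhdsWithin] with h hh using hG h hh
  · refine tendsto_tsum_of_dominated_convergence
      (bound := fun s => (p s).toReal * (3 * Y s ^ 2) + (p s).toReal * (K / 2)) ?_ (fun s => ?_) ?_
    · exact ((h2.summable.mul_left 3).congr fun s => by ring).add (p.hasSum_toReal.summable.mul_right _)
    · refine Tendsto.const_smul ((tendsto_expI_taylor (Y s)).add (Tendsto.mul_const _ ?_)) _
      have : Continuous fun h : ℝ => expI (h * Y s) := continuous_expI.comp (by fun_prop)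
      have := (this.tendsto 0).mono_left (nhdsWithin_le_nhds (s := {0}ᶜ))
      rwa [zero_mul, expI_zero] at this
    · filter_upwards [self_mem_nhdsWithin] with h (hh : h ≠ 0) s
      rw [norm_smul, Real.norm_of_nonneg ENNReal.toReal_nonneg, ← mul_add]
      refine mul_le_mul_of_nonneg_left ((norm_add_le _ _).trans (add_le_add ?_ ?_))
        ENNReal.toReal_nonneg
      · rw [norm_div, norm_pow, Complex.norm_real, Real.norm_eq_abs, sq_abs,
          div_le_iff₀ (by positivity)]
        refine (norm_expI_sub_one_sub_le _).trans (le_of_eq (by ring))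
      · rw [norm_mul, norm_expI, one_mul, norm_div, Complex.norm_real, Real.norm_eq_abs,
          Complex.norm_ofNat]
        gcongr
        exact hk s

theorem norm_sub_pow_mul_le {A : ℕ → ℂ} {l : ℂ} (hl : ‖l‖ ≤ 1) {ε : ℝ}
    (h : ∀ n, ‖A (n + 1) - l * A n‖ ≤ ε) (n : ℕ) : ‖A n - l ^ n * A 0‖ ≤ n * ε := by
  induction n with
  | zero => simp
  | succ n ih =>
    have e : A (n + 1) - l ^ (n + 1) * A 0 = (A (n + 1) - l * A n) + l * (A n - l ^ n * A 0) := by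
      ring
    rw [e]
    refine (norm_add_le _ _).trans ?_
    rw [norm_mul]
    push_cast
    have := mul_le_mul hl ih (norm_nonneg _) zero_le_one
    linarith [h n]

theorem norm_tsum_smul_sub_le {α : Type*} (p : PMF α) {F G : α → ℂ} {K L ε : ℝ}
    (hF : ∀ a, ‖F a‖ ≤ K) (hG : ∀ a, ‖G a‖ ≤ L) (h : ∀ a, ‖F a - G a‖ ≤ ε) :
    ‖∑' a, (p a).toReal • F a - ∑' a, (p a).toReal • G a‖ ≤ ε := by
  rw [← (p.summable_smul hF).tsum_sub (p.summable_smul hG)]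
  simp_rw [← smul_sub]
  exact p.norm_tsum_smul_le h

theorem tsum_convPow_zero {Γ : Type*} [Group Γ] (μ : PMF Γ) (F : Γ → ℂ) :
    ∑' γ, (convPow μ 0 γ).toReal • F γ = F 1 := by
  rw [tsum_eq_single 1]
  · simp [convPow]
  · intro γ hγ
    simp [convPow, hγ]

/-! ### Central limit theorem for the corrected process -/

section CharFun

variable {Γ : Type*} [Group Γ] {Λ : Subgroup Γ} {m : ℕ} {Δ : Set Γ}
  (φ : Λ ≃* Multiplicative (Fin m → ℤ)) (hΔ : Subgroup.IsComplement (Λ : Set Γ) Δ)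
  [Λ.FiniteIndex] {μ : PMF Γ} {T : Finset Γ} {v : Fin m → ℝ} {f : CosetSpace Λ → ℝ}

theorem IsCorrector.hasSum_centredShift (hf : IsCorrector φ hΔ μ v f)
    (hT : Subgroup.closure (T : Set Γ) = ⊤)
    (hmom : FiniteSecondMoment (T : Set Γ) μ) (x : CosetSpace Λ) :
    HasSum (fun s => (μ s).toReal * centredShift φ hΔ μ v f x s) 0 := by
  have := (hf.hasSum φ hΔ hT hmom x).sub (μ.hasSum_toReal.mul_right (cosetMean (localDrift φ hΔ μ v)))
  refine this.of_eq (fun s => ?_) (by ring)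
  rw [centredShift]; ring

/-- The one-step mean from x is 1 + h²(Pk - σ²)/2 + o(h²), where σ² is the local variance at x. The
Poisson equation replaces Pk - σ² by k - b, so the multiplier e^(-h²b/2) is the same at all
vertices. There are finitely many x, so the error is uniform. -/
theorem eventually_norm_char_step_le (hf : IsCorrector φ hΔ μ v f)
    (hT : Subgroup.closure (T : Set Γ) = ⊤)
    (hmom : FiniteSecondMoment (T : Set Γ) μ) {k : CosetSpace Λ → ℝ} {b : ℝ}
    (hk : ∀ x, transOp Λ μ k x - k x = localCov φ hΔ μ v v f f x - b) {ε : ℝ} (hε : 0 < ε) :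
    ∀ᶠ h : ℝ in 𝓝[≠] 0, ∀ x, ‖∑' s, (μ s).toReal • (expI (h * centredShift φ hΔ μ v f x s) *
        (1 + h ^ 2 / 2 * k (cosetMul x s)))
      - (Real.exp (-(h ^ 2 * b / 2)) : ℂ) * (1 + h ^ 2 / 2 * k x)‖ ≤ ε * h ^ 2 := by
  rw [eventually_all]
  intro x
  have h1 := tendsto_tsum_expI_mul_taylor μ (Y := centredShift φ hΔ μ v f x)
    (k := fun s => k (cosetMul x s)) (K := ‖k‖) (b := localCov φ hΔ μ v v f f x)
    (c := transOp Λ μ k x) (fun s => norm_le_pi_norm k _) (hf.hasSum_centredShift φ hΔ hT hmom x)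
    ((hasSum_localCov φ hΔ hT hmom v v f f x).of_eq (fun s => by ring) rfl)
    (summable_toReal_mul_comp μ k _).hasSum
  have h2 : Tendsto (fun h : ℝ => (Real.exp (-(h ^ 2 * b / 2)) - 1) / h ^ 2) (𝓝[≠] 0)
      (𝓝 (-(b / 2))) := by
    have hd : HasDerivAt (fun u : ℝ => Real.exp (-(u * b / 2))) (-(b / 2)) 0 := by
      have : HasDerivAt (fun u : ℝ => -(u * b / 2)) (-(b / 2)) 0 := by
        have := (((hasDerivAt_id (0 : ℝ)).mul_const b).div_const 2).fun_neg
        simpa using this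
      simpa using this.exp
    have hs := hd.tendsto_slope_zero
    have hsq : Tendsto (fun h : ℝ => h ^ 2) (𝓝[≠] 0) (𝓝[≠] 0) := by
      refine tendsto_nhdsWithin_iff.2 ⟨?_, ?_⟩
      · have : Continuous fun h : ℝ => h ^ 2 := by fun_prop
        simpa using (this.tendsto 0).mono_left nhdsWithin_le_nhds
      · filter_upwards [self_mem_nhdsWithin] with h (hh : h ≠ 0)
        exact pow_ne_zero 2 hh
    refine (hs.comp hsq).congr fun h => ?_
    simp [div_eq_inv_mul]
  have h3 : Tendsto (fun h : ℝ => Real.exp (-(h ^ 2 * b / 2)) * (k x / 2)) (𝓝[≠] 0)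
      (𝓝 (k x / 2)) := by
    have : Continuous fun h : ℝ => Real.exp (-(h ^ 2 * b / 2)) * (k x / 2) := by fun_prop
    simpa using (this.tendsto 0).mono_left (nhdsWithin_le_nhds (s := {0}ᶜ))
  have h4 := h1.sub ((Complex.continuous_ofReal.tendsto _).comp (h2.add h3))
  have h5 : ((((transOp Λ μ k x - localCov φ hΔ μ v v f f x) / 2 : ℝ) : ℂ)
      - ((-(b / 2) + k x / 2 : ℝ) : ℂ)) = 0 := by
    rw [← Complex.ofReal_sub, Complex.ofReal_eq_zero]
    linarith [hk x]
  rw [h5] at h4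
  have h6 := (tendsto_zero_iff_norm_tendsto_zero.1 h4).eventually_le_const hε
  filter_upwards [h6, self_mem_nhdsWithin] with h hh (hne : h ≠ 0)
  have hc : (h : ℂ) ≠ 0 := by exact_mod_cast hne
  rw [← div_le_iff₀ (by positivity)]
  refine le_trans (le_of_eq ?_) hh
  have e : ∀ z : ℂ, ‖z‖ / h ^ 2 = ‖z / (h : ℂ) ^ 2‖ := fun z => by simp
  rw [e]
  congr 1
  generalize ∑' s, (μ s).toReal • (expI (h * centredShift φ hΔ μ v f x s) *
        (1 + (h : ℂ) ^ 2 / 2 * k (cosetMul x s))) = S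
  simp only [Function.comp_apply]
  push_cast
  field_simp
  ring

theorem correctedPhi_mul_sub (γ s : Γ) (N : ℕ) :
    correctedPhi φ hΔ v f (γ * s) - ((N + 1 : ℕ) : ℝ) * cosetMean (localDrift φ hΔ μ v)
      = (correctedPhi φ hΔ v f γ - N * cosetMean (localDrift φ hΔ μ v))
        + centredShift φ hΔ μ v f (cosetMk Λ γ) s := by
  rw [correctedPhi_mul, centredShift]
  push_cast
  ring

theorem norm_expI_mul_one_add_le (x h : ℝ) (k : CosetSpace Λ → ℝ) (y : CosetSpace Λ) :
    ‖expI x * (1 + (h : ℂ) ^ 2 / 2 * k y)‖ ≤ 1 + h ^ 2 / 2 * ‖k‖ := by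
  rw [norm_mul, norm_expI, one_mul]
  refine (norm_add_le _ _).trans ?_
  simp only [norm_one, norm_mul, norm_div, norm_pow, Complex.norm_real, Complex.norm_ofNat]
  rw [Real.norm_eq_abs h, sq_abs]
  gcongr
  exact norm_le_pi_norm k y

/-- Central limit theorem for the corrected process. -/
theorem tendsto_char_correctedPhi (hgen : Subsemigroup.closure μ.support = ⊤)
    (hf : IsCorrector φ hΔ μ v f) (hT : Subgroup.closure (T : Set Γ) = ⊤)
    (hmom : FiniteSecondMoment (T : Set Γ) μ) {h : ℕ → ℝ} {N : ℕ → ℕ} {t : ℝ}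
    (hh : Tendsto h atTop (𝓝[≠] 0)) (hN : Tendsto (fun n => N n * h n ^ 2) atTop (𝓝 t)) :
    Tendsto (fun n => ∑' γ, (convPow μ (N n) γ).toReal • expI (h n *
        (correctedPhi φ hΔ v f γ - N n * cosetMean (localDrift φ hΔ μ v)))) atTop
      (𝓝 (Real.exp (-(t * cosetMean (localCov φ hΔ μ v v f f) / 2)) : ℂ)) := by
  set a := cosetMean (localDrift φ hΔ μ v) with ha
  set b := cosetMean (localCov φ hΔ μ v v f f) with hb
  obtain ⟨k, hk⟩ := exists_transOp_sub_eq hgen (localCov φ hΔ μ v v f f)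
  rw [← hb] at hk
  have hb0 : 0 ≤ b := mul_nonneg (inv_nonneg.2 (Nat.cast_nonneg _)) (Finset.sum_nonneg fun x _ =>
      tsum_nonneg fun s => mul_nonneg ENNReal.toReal_nonneg (mul_self_nonneg _))
  have hh0 : Tendsto h atTop (𝓝 0) := hh.mono_right nhdsWithin_le_nhds
  -- The characteristic function with the weight 1+h²k/2, for which each step is nearly
  -- multiplication by e^(-h²b/2). The weight tends to 1 and is removed at the end.
  let A : ℝ → ℕ → ℂ := fun h N => ∑' γ, (convPow μ N γ).toReal •
    (expI (h * (correctedPhi φ hΔ v f γ - N * a)) * (1 + (h : ℂ) ^ 2 / 2 * k (cosetMk Λ γ)))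
  have hstep : ∀ ε > 0, ∀ᶠ h : ℝ in 𝓝[≠] 0, ∀ N,
      ‖A h (N + 1) - (Real.exp (-(h ^ 2 * b / 2)) : ℂ) * A h N‖ ≤ ε * h ^ 2 := by
    intro ε hε
    filter_upwards [eventually_norm_char_step_le φ hΔ hf hT hmom hk hε] with h hx N
    simp only [A]
    rw [tsum_convPow_succ μ N fun γ => norm_expI_mul_one_add_le _ h k (cosetMk Λ γ),
      ← tsum_mul_left]
    have e1 : ∀ γ, ∑' s, (μ s).toReal • (expI (h * (correctedPhi φ hΔ v f (γ * s)
          - ((N + 1 : ℕ) : ℝ) * a)) * (1 + (h : ℂ) ^ 2 / 2 * k (cosetMk Λ (γ * s))))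
        = expI (h * (correctedPhi φ hΔ v f γ - N * a)) * ∑' s, (μ s).toReal •
          (expI (h * centredShift φ hΔ μ v f (cosetMk Λ γ) s) *
            (1 + (h : ℂ) ^ 2 / 2 * k (cosetMul (cosetMk Λ γ) s))) := fun γ => by
      rw [← tsum_mul_left]
      refine tsum_congr fun s => ?_
      rw [correctedPhi_mul_sub, mul_add h, expI_add, cosetMul_mk, mul_smul_comm, mul_assoc]
    simp_rw [e1]
    have hb1 : ∀ x, ‖∑' s, (μ s).toReal •
          (expI (h * centredShift φ hΔ μ v f x s) *
            (1 + (h : ℂ) ^ 2 / 2 * k (cosetMul x s)))‖ ≤ 1 + h ^ 2 / 2 * ‖k‖ := fun x =>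
      μ.norm_tsum_smul_le fun s => norm_expI_mul_one_add_le _ h k _
    have e2 : ∀ γ, (Real.exp (-(h ^ 2 * b / 2)) : ℂ) * ((convPow μ N γ).toReal •
        (expI (h * (correctedPhi φ hΔ v f γ - N * a)) * (1 + (h : ℂ) ^ 2 / 2 * k (cosetMk Λ γ))))
        = (convPow μ N γ).toReal • (expI (h * (correctedPhi φ hΔ v f γ - N * a)) *
          ((Real.exp (-(h ^ 2 * b / 2)) : ℂ) * (1 + (h : ℂ) ^ 2 / 2 * k (cosetMk Λ γ)))) :=
      fun γ => by
        rw [mul_smul_comm]; congr 1; ring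
    simp_rw [e2]
    have hexp : ‖(Real.exp (-(h ^ 2 * b / 2)) : ℂ)‖ ≤ 1 := by
      rw [Complex.norm_real, Real.norm_of_nonneg (Real.exp_pos _).le, Real.exp_le_one_iff]
      have := mul_nonneg (sq_nonneg h) hb0
      linarith
    refine norm_tsum_smul_sub_le (K := 1 + h ^ 2 / 2 * ‖k‖) (L := 1 * (1 + h ^ 2 / 2 * ‖k‖)) _
      (fun γ => ?_) (fun γ => ?_) fun γ => ?_
    · rw [norm_mul, norm_expI, one_mul]
      exact hb1 _
    · rw [norm_mul, norm_expI, one_mul, norm_mul]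
      refine mul_le_mul hexp ?_ (norm_nonneg _) zero_le_one
      have := norm_expI_mul_one_add_le 0 h k (cosetMk Λ γ)
      rwa [expI_zero, one_mul] at this
    · rw [← mul_sub, norm_mul, norm_expI, one_mul]
      exact hx _
  have hA0 : Tendsto (fun n => A (h n) 0) atTop (𝓝 1) := by
    simp only [A, tsum_convPow_zero]
    have hc : Continuous fun h : ℝ => expI (h * (correctedPhi φ hΔ v f 1 - ((0 : ℕ) : ℝ) * a)) *
        (1 + (h : ℂ) ^ 2 / 2 * k (cosetMk Λ 1)) :=
      (continuous_expI.comp (by fun_prop)).mul (by fun_prop)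
    have := (hc.tendsto 0).comp hh0
    simpa [expI_zero, Function.comp_def] using this
  have hlam : Tendsto (fun n => (Real.exp (-(h n ^ 2 * b / 2)) : ℂ) ^ N n) atTop
      (𝓝 (Real.exp (-(t * b / 2)) : ℂ)) := by
    have e : ∀ n, (Real.exp (-(h n ^ 2 * b / 2)) : ℂ) ^ N n
        = (Real.exp (-(N n * h n ^ 2 * b / 2)) : ℂ) := fun n => by
      rw [← Complex.ofReal_pow, ← Real.exp_nat_mul]
      congr 2; ring
    simp_rw [e]
    refine (Complex.continuous_ofReal.tendsto _).comp ?_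
    exact (Real.continuous_exp.tendsto _).comp (((hN.mul_const b).div_const 2).neg)
  -- N steps, each with error o(h²), accumulate to o(1) because N h² stays bounded.
  have hdiff : Tendsto (fun n => A (h n) (N n) -
      (Real.exp (-(h n ^ 2 * b / 2)) : ℂ) ^ N n * A (h n) 0) atTop (𝓝 0) := by
    rw [Metric.tendsto_atTop']
    intro ε hε
    have hden : 0 < |t| + 2 := by positivity
    have ev1 := hh.eventually (hstep (ε / (|t| + 2)) (by positivity))
    have ev2 : ∀ᶠ n in atTop, N n * h n ^ 2 < |t| + 1 :=
      hN.eventually_lt_const (lt_of_le_of_lt (le_abs_self t) (by linarith))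
    obtain ⟨n0, hn0⟩ := (ev1.and ev2).exists_forall_of_atTop
    refine ⟨n0, fun n hn => ?_⟩
    obtain ⟨h1, h2⟩ := hn0 n hn.le
    rw [dist_zero_right]
    have hexp : ‖(Real.exp (-(h n ^ 2 * b / 2)) : ℂ)‖ ≤ 1 := by
      rw [Complex.norm_real, Real.norm_of_nonneg (Real.exp_pos _).le, Real.exp_le_one_iff]
      have := mul_nonneg (sq_nonneg (h n)) hb0
      linarith
    refine (norm_sub_pow_mul_le hexp h1 (N n)).trans_lt ?_
    calc (N n : ℝ) * (ε / (|t| + 2) * h n ^ 2) = ε / (|t| + 2) * (N n * h n ^ 2) := by ring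
      _ ≤ ε / (|t| + 2) * (|t| + 1) := by gcongr
      _ < ε / (|t| + 2) * (|t| + 2) := by
        apply mul_lt_mul_of_pos_left _ (by positivity); linarith
      _ = ε := by field_simp
  have hmain := hdiff.add (hlam.mul hA0)
  simp only [sub_add_cancel, zero_add, mul_one] at hmain
  have hlast : Tendsto (fun n => (∑' γ, (convPow μ (N n) γ).toReal • expI (h n *
        (correctedPhi φ hΔ v f γ - N n * a))) - A (h n) (N n)) atTop (𝓝 0) := by
    have hz : Tendsto (fun n => h n ^ 2 / 2 * ‖k‖) atTop (𝓝 0) := by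
      have := ((hh0.pow 2).div_const 2).mul_const ‖k‖
      simpa using this
    refine squeeze_zero_norm (fun n => ?_) hz
    refine norm_tsum_smul_sub_le _ (fun γ => (norm_expI _).le)
      (fun γ => norm_expI_mul_one_add_le _ (h n) k (cosetMk Λ γ)) fun γ => ?_
    have e : ∀ z w : ℂ, z - z * (1 + w) = -(z * w) := fun z w => by ring
    rw [e, norm_neg, norm_mul, norm_expI, one_mul, norm_mul]
    have : ‖(h n : ℂ) ^ 2 / 2‖ = h n ^ 2 / 2 := by
      rw [norm_div, norm_pow, Complex.norm_real, Real.norm_eq_abs, sq_abs, Complex.norm_ofNat]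
    rw [this, Complex.norm_real]
    gcongr
    exact norm_le_pi_norm k _
  simpa using hlast.add hmain

end CharFun

theorem norm_tsum_smul_sub_tsum_smul_le {α : Type*} (p p' : PMF α) {F : α → ℂ} {K : ℝ}
    (hF : ∀ a, ‖F a‖ ≤ K) :
    ‖∑' a, (p a).toReal • F a - ∑' a, (p' a).toReal • F a‖
      ≤ (∑' a, |(p a).toReal - (p' a).toReal|) * K := by
  rw [← (p.summable_smul hF).tsum_sub (p'.summable_smul hF)]
  have hs := (p.hasSum_toReal.summable.sub p'.hasSum_toReal.summable).abs
  refine tsum_of_norm_bounded (hs.hasSum.mul_right K) fun a => ?_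
  rw [← sub_smul, norm_smul, Real.norm_eq_abs]
  exact mul_le_mul_of_nonneg_left (hF a) (abs_nonneg _)

/-! ### Equidistribution in Λ\Γ jointly with the central limit theorem -/

section CharFun

variable {Γ : Type*} [Group Γ] {Λ : Subgroup Γ} {m : ℕ} {Δ : Set Γ}
  (φ : Λ ≃* Multiplicative (Fin m → ℤ)) (hΔ : Subgroup.IsComplement (Λ : Set Γ) Δ)
  [Λ.FiniteIndex] {μ : PMF Γ} {T : Finset Γ} {v : Fin m → ℝ} {f : CosetSpace Λ → ℝ}

theorem norm_expI_mul_le (x : ℝ) (g : CosetSpace Λ → ℝ) (y : CosetSpace Λ) :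
    ‖expI x * g y‖ ≤ ‖g‖ := by
  rw [norm_mul, norm_expI, one_mul, Complex.norm_real]
  exact norm_le_pi_norm g y

/-- The phase changes by O(h) in mean during one step, so the mean of phase times G changes by the
mean of phase times PG - G = g, up to O(h). -/
theorem exists_norm_poisson_step_le (hT : Subgroup.closure (T : Set Γ) = ⊤)
    (hmom : FiniteSecondMoment (T : Set Γ) μ) {G g : CosetSpace Λ → ℝ}
    (hG : ∀ x, transOp Λ μ G x - G x = g x) (v : Fin m → ℝ) (f : CosetSpace Λ → ℝ) :
    ∃ L : ℝ, ∀ (h : ℝ) (N : ℕ),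
      ‖(∑' γ, (convPow μ (N + 1) γ).toReal • (expI (h * (correctedPhi φ hΔ v f γ
            - ((N + 1 : ℕ) : ℝ) * cosetMean (localDrift φ hΔ μ v))) * G (cosetMk Λ γ)))
        - (∑' γ, (convPow μ N γ).toReal • (expI (h * (correctedPhi φ hΔ v f γ
            - N * cosetMean (localDrift φ hΔ μ v))) * G (cosetMk Λ γ)))
        - ∑' γ, (convPow μ N γ).toReal • (expI (h * (correctedPhi φ hΔ v f γ
            - N * cosetMean (localDrift φ hΔ μ v))) * g (cosetMk Λ γ))‖ ≤ |h| * L := by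
  have hY : ∀ x, HasSum (fun s => (μ s).toReal * |centredShift φ hΔ μ v f x s|)
      (∑' s, (μ s).toReal * |centredShift φ hΔ μ v f x s|) := fun x =>
    (summable_of_sq μ ((summable_centredShift_sq φ hΔ hT hmom v f x).congr
      fun s => by rw [sq_abs])).hasSum
  have hY0 : ∀ x, 0 ≤ ∑' s, (μ s).toReal * |centredShift φ hΔ μ v f x s| := fun x =>
    tsum_nonneg fun s => by positivity
  refine ⟨(∑ x, ∑' s, (μ s).toReal * |centredShift φ hΔ μ v f x s|) * ‖G‖, fun h N => ?_⟩
  set a := cosetMean (localDrift φ hΔ μ v) with ha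
  let e : Γ → ℂ := fun γ => expI (h * (correctedPhi φ hΔ v f γ - N * a))
  have he : ∀ γ, ‖e γ‖ = 1 := fun γ => norm_expI _
  let R : CosetSpace Λ → ℂ := fun x =>
    ∑' s, (μ s).toReal • (expI (h * centredShift φ hΔ μ v f x s) * G (cosetMul x s))
  have hR : ∀ x, ‖R x‖ ≤ ‖G‖ := fun x => μ.norm_tsum_smul_le fun s => norm_expI_mul_le _ G _
  rw [tsum_convPow_succ μ N fun γ => norm_expI_mul_le _ G _]
  have e1 : ∀ γ, ∑' s, (μ s).toReal • (expI (h * (correctedPhi φ hΔ v f (γ * s)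
        - ((N + 1 : ℕ) : ℝ) * a)) * G (cosetMk Λ (γ * s))) = e γ * R (cosetMk Λ γ) := fun γ => by
    rw [← tsum_mul_left]
    refine tsum_congr fun s => ?_
    rw [correctedPhi_mul_sub, mul_add h, expI_add, cosetMul_mk, mul_smul_comm, mul_assoc]
  simp_rw [e1]
  have e2 : (∑' γ, (convPow μ N γ).toReal • (e γ * G (cosetMk Λ γ)))
      + ∑' γ, (convPow μ N γ).toReal • (e γ * g (cosetMk Λ γ))
      = ∑' γ, (convPow μ N γ).toReal • (e γ * (transOp Λ μ G (cosetMk Λ γ) : ℝ)) := by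
    rw [← ((convPow μ N).summable_smul fun γ => norm_expI_mul_le _ G _).tsum_add
      ((convPow μ N).summable_smul fun γ => norm_expI_mul_le _ g _)]
    refine tsum_congr fun γ => ?_
    rw [← smul_add, ← mul_add, ← Complex.ofReal_add, ← hG]
    congr 4
    ring
  rw [sub_sub, e2]
  refine norm_tsum_smul_sub_le _ (K := ‖G‖) (L := ‖transOp Λ μ G‖) (fun γ => ?_)
    (fun γ => norm_expI_mul_le _ _ _) fun γ => ?_
  · rw [norm_mul, he, one_mul]; exact hR _
  · rw [← mul_sub, norm_mul, he, one_mul]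
    set x := cosetMk Λ γ
    have e3 : ((transOp Λ μ G x : ℝ) : ℂ) = ∑' s, (μ s).toReal • ((1 : ℂ) * G (cosetMul x s)) := by
      rw [transOp_apply, Complex.ofReal_tsum]
      refine tsum_congr fun s => ?_
      rw [Complex.real_smul, one_mul, Complex.ofReal_mul]
    have hone : ∀ s, ‖(1 : ℂ) * G (cosetMul x s)‖ ≤ ‖G‖ := fun s => by
      simpa [expI_zero] using norm_expI_mul_le 0 G (cosetMul x s)
    rw [e3]
    simp only [R]
    rw [← (μ.summable_smul fun s => norm_expI_mul_le _ G _).tsum_sub (μ.summable_smul hone)]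
    have hb := ((hY x).mul_left |h|).mul_right ‖G‖
    refine (tsum_of_norm_bounded hb fun s => ?_).trans ?_
    · rw [← smul_sub, ← sub_mul, norm_smul, Real.norm_of_nonneg ENNReal.toReal_nonneg, norm_mul,
        Complex.norm_real]
      calc (μ s).toReal * (‖expI (h * centredShift φ hΔ μ v f x s) - 1‖ * ‖G (cosetMul x s)‖)
          ≤ (μ s).toReal * (|h * centredShift φ hΔ μ v f x s| * ‖G‖) := by
            gcongr
            · exact norm_expI_sub_one_le _
            · exact norm_le_pi_norm G _
        _ = _ := by rw [abs_mul]; ring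
    · rw [mul_assoc]
      gcongr
      exact Finset.single_le_sum (f := fun x => ∑' s, (μ s).toReal *
        |centredShift φ hΔ μ v f x s|) (fun x _ => hY0 x) (Finset.mem_univ x)

theorem norm_sub_sub_sum_le {S E : ℕ → ℂ} {ε : ℝ} (h : ∀ n, ‖S (n + 1) - S n - E n‖ ≤ ε)
    (N q : ℕ) : ‖S (N + q) - S N - ∑ i ∈ Finset.range q, E (N + i)‖ ≤ q * ε := by
  induction q with
  | zero => simp
  | succ q ih =>
    rw [Finset.sum_range_succ]
    have e : S (N + (q + 1)) - S N - (∑ i ∈ Finset.range q, E (N + i) + E (N + q))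
      = (S (N + q) - S N - ∑ i ∈ Finset.range q, E (N + i))
        + (S (N + q + 1) - S (N + q) - E (N + q)) := by
      rw [← add_assoc]; ring
    rw [e]
    push_cast
    have := norm_add_le (S (N + q) - S N - ∑ i ∈ Finset.range q, E (N + i))
      (S (N + q + 1) - S (N + q) - E (N + q))
    linarith [h (N + q)]

/-- Over one period the one-step identities telescope to a difference between times M+q and M, which
vanishes since the two laws agree asymptotically. At a single time the coset need not
equidistribute, as the walk may be periodic. -/
theorem tendsto_sum_char_poisson (hgen : Subsemigroup.closure μ.support = ⊤) {q : ℕ}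
    (hq : IsPeriod μ q) (hT : Subgroup.closure (T : Set Γ) = ⊤)
    (hmom : FiniteSecondMoment (T : Set Γ) μ) {G g : CosetSpace Λ → ℝ}
    (hG : ∀ x, transOp Λ μ G x - G x = g x) (v : Fin m → ℝ) (f : CosetSpace Λ → ℝ)
    {h : ℕ → ℝ} {M : ℕ → ℕ} (hh : Tendsto h atTop (𝓝 0)) (hM : Tendsto M atTop atTop) :
    Tendsto (fun n => ∑ i ∈ Finset.range q, ∑' γ, (convPow μ (M n + i) γ).toReal •
      (expI (h n * (correctedPhi φ hΔ v f γ - ((M n + i : ℕ) : ℝ) *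
        cosetMean (localDrift φ hΔ μ v))) * g (cosetMk Λ γ))) atTop (𝓝 0) := by
  obtain ⟨L, hL⟩ := exists_norm_poisson_step_le φ hΔ hT hmom hG v f
  set a := cosetMean (localDrift φ hΔ μ v) with ha
  let S : ℝ → ℕ → ℂ := fun h N => ∑' γ, (convPow μ N γ).toReal •
    (expI (h * (correctedPhi φ hΔ v f γ - N * a)) * G (cosetMk Λ γ))
  have hS : ∀ h N, ‖S h (N + q) - S h N‖
      ≤ (∑' γ, |(convPow μ (N + q) γ).toReal - (convPow μ N γ).toReal|) * ‖G‖
        + |h| * (q * |a| * ‖G‖) := fun h N => by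
    have e1 := norm_tsum_smul_sub_tsum_smul_le (convPow μ (N + q)) (convPow μ N)
      (F := fun γ => expI (h * (correctedPhi φ hΔ v f γ - N * a)) * G (cosetMk Λ γ))
      fun γ => norm_expI_mul_le _ G _
    have e2 := norm_tsum_smul_sub_le (convPow μ (N + q)) (ε := |h| * (q * |a| * ‖G‖))
      (F := fun γ => expI (h * (correctedPhi φ hΔ v f γ - ((N + q : ℕ) : ℝ) * a)) *
        G (cosetMk Λ γ))
      (G := fun γ => expI (h * (correctedPhi φ hΔ v f γ - N * a)) * G (cosetMk Λ γ))
      (fun γ => norm_expI_mul_le _ G _) (fun γ => norm_expI_mul_le _ G _) fun γ => by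
        rw [← sub_mul, norm_mul, Complex.norm_real]
        calc _ ≤ |h * (correctedPhi φ hΔ v f γ - ((N + q : ℕ) : ℝ) * a)
              - h * (correctedPhi φ hΔ v f γ - N * a)| * ‖G‖ := by
                gcongr
                · exact norm_expI_sub_expI_le _ _
                · exact norm_le_pi_norm G _
          _ = |h * (-(q * a))| * ‖G‖ := by congr 2; push_cast; ring
          _ = _ := by rw [abs_mul, abs_neg, abs_mul, Nat.abs_cast]; ring
    have := norm_add_le _ _ |>.trans (add_le_add e1 e2)
    refine le_trans (le_of_eq ?_) this
    congr 1
    simp only [S]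
    ring
  have hbound : ∀ n, ‖∑ i ∈ Finset.range q, ∑' γ, (convPow μ (M n + i) γ).toReal •
      (expI (h n * (correctedPhi φ hΔ v f γ - ((M n + i : ℕ) : ℝ) * a)) * g (cosetMk Λ γ))‖
      ≤ (∑' γ, |(convPow μ (M n + q) γ).toReal - (convPow μ (M n) γ).toReal|) * ‖G‖
        + |h n| * (q * |a| * ‖G‖) + q * (|h n| * L) := fun n => by
    have e1 := norm_sub_sub_sum_le (S := S (h n)) (E := fun N => ∑' γ, (convPow μ N γ).toReal •
      (expI (h n * (correctedPhi φ hΔ v f γ - N * a)) * g (cosetMk Λ γ))) (hL (h n)) (M n) q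
    have e2 := norm_le_norm_add_norm_sub' (∑ i ∈ Finset.range q, ∑' γ,
      (convPow μ (M n + i) γ).toReal • (expI (h n * (correctedPhi φ hΔ v f γ
        - ((M n + i : ℕ) : ℝ) * a)) * g (cosetMk Λ γ))) (S (h n) (M n + q) - S (h n) (M n))
    refine e2.trans (add_le_add (hS _ _) ?_)
    rw [norm_sub_rev]
    exact e1
  refine squeeze_zero_norm hbound ?_
  have habs : Tendsto (fun n => |h n|) atTop (𝓝 0) := by simpa using hh.abs
  have t1 := ((tendsto_tsum_abs_convPow_add_period_sub hgen hq).comp hM).mul_const ‖G‖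
  have t2 := habs.mul_const (q * |a| * ‖G‖)
  have t3 := (habs.mul_const L).const_mul (q : ℝ)
  simpa using (t1.add t2).add t3

theorem tsum_avgProb_smul (μ : PMF Γ) (q N : ℕ) {F : Γ → ℂ} {K : ℝ} (hF : ∀ γ, ‖F γ‖ ≤ K) :
    ∑' γ, avgProb μ q N γ • F γ
      = (q : ℝ)⁻¹ • ∑ i ∈ Finset.range q, ∑' γ, (convPow μ (N + i) γ).toReal • F γ := by
  have := (hasSum_sum fun i (_ : i ∈ Finset.range q) =>
    ((convPow μ (N + i)).summable_smul hF).hasSum).const_smul (q : ℝ)⁻¹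
  refine HasSum.tsum_eq (this.of_eq (fun γ => ?_) rfl)
  rw [avgProb, mul_smul, Finset.sum_smul]

/-- Central limit theorem, jointly with equidistribution in `Λ \ Γ`. -/
theorem tendsto_char_avgProb (hgen : Subsemigroup.closure μ.support = ⊤) {q : ℕ}
    (hq : IsPeriod μ q) (hf : IsCorrector φ hΔ μ v f)
    (hT : Subgroup.closure (T : Set Γ) = ⊤)
    (hmom : FiniteSecondMoment (T : Set Γ) μ) (g : CosetSpace Λ → ℝ) {h : ℕ → ℝ} {M : ℕ → ℕ}
    (hh : Tendsto h atTop (𝓝[≠] 0)) (hM : Tendsto M atTop atTop)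
    (hMh : Tendsto (fun n => M n * h n ^ 2) atTop (𝓝 1)) :
    Tendsto (fun n => ∑' γ, avgProb μ q (M n) γ • (expI (h n * (v ⬝ᵥ realPhi φ hΔ γ
        - M n * cosetMean (localDrift φ hΔ μ v))) * g (cosetMk Λ γ))) atTop
      (𝓝 ((cosetMean g * Real.exp (-(cosetMean (localCov φ hΔ μ v v f f) / 2)) : ℝ) : ℂ)) := by
  set a := cosetMean (localDrift φ hΔ μ v) with ha
  set b := cosetMean (localCov φ hΔ μ v v f f) with hb
  have hq0 : (0 : ℝ) < q := by exact_mod_cast hq.pos hgen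
  have hh0 : Tendsto h atTop (𝓝 0) := hh.mono_right nhdsWithin_le_nhds
  obtain ⟨G, hG⟩ := exists_transOp_sub_eq hgen g
  -- The part of g of mean zero disappears in the limit; the mean of g multiplies the limit of the
  -- characteristic functions.
  have t1 := tendsto_sum_char_poisson φ hΔ hgen hq hT hmom
    (g := fun x => g x - cosetMean g) hG v f hh0 hM
  have t2 : Tendsto (fun n => ∑ i ∈ Finset.range q, ∑' γ, (convPow μ (M n + i) γ).toReal •
      expI (h n * (correctedPhi φ hΔ v f γ - ((M n + i : ℕ) : ℝ) * a))) atTop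
      (𝓝 (∑ i ∈ Finset.range q, (Real.exp (-(1 * b / 2)) : ℂ))) := by
    refine tendsto_finsetSum _ fun i _ =>
      tendsto_char_correctedPhi φ hΔ hgen hf hT hmom hh ?_
    have := hMh.add ((hh0.pow 2).const_mul (i : ℝ))
    simp only [ne_eq, OfNat.ofNat_ne_zero, not_false_eq_true, zero_pow, mul_zero, add_zero] at this
    refine this.congr fun n => ?_
    push_cast; ring
  have t3 := (t1.add (t2.mul_const (cosetMean g : ℂ))).const_smul (q : ℝ)⁻¹
  rw [Finset.sum_const, Finset.card_range, zero_add, one_mul] at t3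
  have e1 : (q : ℝ)⁻¹ • (q • (Real.exp (-(b / 2)) : ℂ) * (cosetMean g : ℂ))
      = ((cosetMean g * Real.exp (-(b / 2)) : ℝ) : ℂ) := by
    have : (q : ℂ) ≠ 0 := by exact_mod_cast hq0.ne'
    rw [Complex.real_smul, nsmul_eq_mul]
    push_cast
    field_simp
  rw [e1] at t3
  -- Dropping f and replacing the centring at time M+i by that at time M shifts the phase by at most
  -- |h|(‖f‖ + q|a|), which tends to 0.
  refine (tendsto_iff_of_dist ?_).1 t3
  have habs : Tendsto (fun n => |h n|) atTop (𝓝 0) := by simpa using hh0.abs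
  have hz : Tendsto (fun n => |h n| * (‖f‖ + q * |a|) * ‖g‖) atTop (𝓝 0) := by
    simpa using (habs.mul_const (‖f‖ + q * |a|)).mul_const ‖g‖
  refine squeeze_zero (fun n => dist_nonneg) (fun n => ?_) hz
  rw [dist_eq_norm, tsum_avgProb_smul μ q _ fun γ => norm_expI_mul_le _ g _, ← smul_sub,
    Finset.sum_mul, ← Finset.sum_add_distrib, ← Finset.sum_sub_distrib, norm_smul,
    norm_inv, Real.norm_of_nonneg hq0.le, inv_mul_le_iff₀ hq0]
  refine (norm_sum_le_of_le (f := _) _ (n := fun _ => |h n| * (‖f‖ + q * |a|) * ‖g‖)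
    fun i hi => ?_).trans (le_of_eq (by rw [Finset.sum_const, Finset.card_range, nsmul_eq_mul]))
  have hs : Summable fun γ => (convPow μ (M n + i) γ).toReal • expI (h n *
      (correctedPhi φ hΔ v f γ - ((M n + i : ℕ) : ℝ) * a)) * (cosetMean g : ℂ) :=
    ((convPow μ (M n + i)).summable_smul fun γ => (norm_expI _).le).mul_right _
  rw [← tsum_mul_right, ← ((convPow μ (M n + i)).summable_smul
    fun γ => norm_expI_mul_le _ (fun x => g x - cosetMean g) _).tsum_add hs]
  have e2 : ∀ γ, (convPow μ (M n + i) γ).toReal • (expI (h n * (correctedPhi φ hΔ v f γ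
        - ((M n + i : ℕ) : ℝ) * a)) * ((g (cosetMk Λ γ) - cosetMean g : ℝ) : ℂ))
      + (convPow μ (M n + i) γ).toReal • expI (h n * (correctedPhi φ hΔ v f γ
        - ((M n + i : ℕ) : ℝ) * a)) * (cosetMean g : ℂ)
      = (convPow μ (M n + i) γ).toReal • (expI (h n * (correctedPhi φ hΔ v f γ
        - ((M n + i : ℕ) : ℝ) * a)) * g (cosetMk Λ γ)) := fun γ => by
    rw [smul_mul_assoc, ← smul_add, ← mul_add, ← Complex.ofReal_add, sub_add_cancel]
  rw [tsum_congr e2]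
  refine norm_tsum_smul_sub_le _ (fun γ => norm_expI_mul_le _ g _)
    (fun γ => norm_expI_mul_le _ g _) fun γ => ?_
  rw [← sub_mul, norm_mul, Complex.norm_real]
  refine mul_le_mul ((norm_expI_sub_expI_le _ _).trans ?_) (norm_le_pi_norm g _) (norm_nonneg _)
    (by positivity)
  have e3 : h n * (correctedPhi φ hΔ v f γ - ((M n + i : ℕ) : ℝ) * a)
      - h n * (v ⬝ᵥ realPhi φ hΔ γ - M n * a) = -(h n * (f (cosetMk Λ γ) + i * a)) := by
    rw [correctedPhi]; push_cast; ring
  rw [e3, abs_neg, abs_mul]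
  have hi' : (i : ℝ) ≤ q := by exact_mod_cast (Finset.mem_range.1 hi).le
  have h1 : |f (cosetMk Λ γ)| ≤ ‖f‖ := norm_le_pi_norm f _
  gcongr
  refine (abs_add_le _ _).trans ?_
  rw [abs_mul, Nat.abs_cast]
  gcongr

end CharFun

/-! ### Gaussian integrals and Fourier transforms for a positive definite form -/

section Gaussian

variable {m : ℕ} {A : Matrix (Fin m) (Fin m) ℝ}

/-- The quadratic form of a matrix. -/
def quadForm (A : Matrix (Fin m) (Fin m) ℝ) (x : Fin m → ℝ) : ℝ := x ⬝ᵥ A *ᵥ x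

theorem continuous_quadForm (A : Matrix (Fin m) (Fin m) ℝ) : Continuous (quadForm A) := by
  unfold quadForm dotProduct Matrix.mulVec dotProduct
  fun_prop

theorem quadForm_smul (A : Matrix (Fin m) (Fin m) ℝ) (c : ℝ) (x : Fin m → ℝ) :
    quadForm A (c • x) = c ^ 2 * quadForm A x := by
  simp only [quadForm, Matrix.mulVec_smul, smul_dotProduct, dotProduct_smul, smul_eq_mul]
  ring

theorem quadForm_neg (A : Matrix (Fin m) (Fin m) ℝ) (x : Fin m → ℝ) :
    quadForm A (-x) = quadForm A x := by
  have := quadForm_smul A (-1) x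
  simpa using this

theorem Matrix.PosDef.quadForm_nonneg (hA : A.PosDef) (x : Fin m → ℝ) : 0 ≤ quadForm A x := by
  have := hA.posSemidef.dotProduct_mulVec_nonneg x
  rwa [star_trivial] at this

/-- Positivity of the form at ηx - y bounds the cross term. -/
theorem Matrix.PosDef.quadForm_add_le (hA : A.PosDef) {η : ℝ} (hη : 0 < η) (x y : Fin m → ℝ) :
    quadForm A (x + y) ≤ (1 + η) * quadForm A x + (1 + 1 / η) * quadForm A y := by
  have hsymm : y ⬝ᵥ A *ᵥ x = x ⬝ᵥ A *ᵥ y := by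
    have h : Aᵀ = A := by
      have := hA.isHermitian
      rwa [Matrix.IsHermitian, Matrix.conjTranspose_eq_transpose_of_trivial] at this
    rw [Matrix.dotProduct_mulVec, ← Matrix.mulVec_transpose, h, dotProduct_comm]
  have h := hA.quadForm_nonneg (η • x - y)
  have e1 : quadForm A (η • x - y) = η ^ 2 * quadForm A x - 2 * η * (x ⬝ᵥ A *ᵥ y)
      + quadForm A y := by
    simp only [quadForm, Matrix.mulVec_sub, Matrix.mulVec_smul, sub_dotProduct, dotProduct_sub,
      smul_dotProduct, dotProduct_smul, smul_eq_mul, hsymm]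
    ring
  have e2 : quadForm A (x + y) = quadForm A x + 2 * (x ⬝ᵥ A *ᵥ y) + quadForm A y := by
    simp only [quadForm, Matrix.mulVec_add, add_dotProduct, dotProduct_add, hsymm]
    ring
  rw [e1] at h
  rw [e2]
  have h2 : 2 * (x ⬝ᵥ A *ᵥ y) ≤ η * quadForm A x + 1 / η * quadForm A y := by
    rw [← mul_le_mul_iff_right₀ hη]
    have : η * (η * quadForm A x + 1 / η * quadForm A y)
      = η ^ 2 * quadForm A x + quadForm A y := by field_simp
    rw [this]
    linarith
  linarith

open scoped MatrixOrder Matrix.Norms.L2Operator in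
theorem Matrix.PosDef.exists_transpose_mul_self (hA : A.PosDef) :
    ∃ P : Matrix (Fin m) (Fin m) ℝ, IsUnit P ∧ A = Pᵀ * P := by
  obtain ⟨P, hP, h⟩ := CStarAlgebra.isStrictlyPositive_iff_eq_star_mul_self.mp
    hA.isStrictlyPositive
  refine ⟨P, hP, ?_⟩
  rw [h, Matrix.star_eq_conjTranspose, Matrix.conjTranspose_eq_transpose_of_trivial]

theorem quadForm_transpose_mul_self (P : Matrix (Fin m) (Fin m) ℝ) (x : Fin m → ℝ) :
    quadForm (Pᵀ * P) x = ∑ i, (P *ᵥ x) i ^ 2 := by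
  rw [quadForm, ← Matrix.mulVec_mulVec, Matrix.dotProduct_mulVec, Matrix.vecMul_transpose,
    dotProduct]
  exact Finset.sum_congr rfl fun i _ => by ring

/-- Relates the ℓ¹ length of the regularity estimate to the quadratic form of the smoothing
Gaussian. With A = PᵀP, the coordinates of x are recovered from Px by P⁻¹, and Cauchy–Schwarz
applies. -/
theorem Matrix.PosDef.exists_abs_apply_le (hA : A.PosDef) :
    ∃ c : ℝ, 0 ≤ c ∧ ∀ x : Fin m → ℝ, ∑ i, |x i| ≤ c * √(quadForm A x) := by
  obtain ⟨P, hP, rfl⟩ := hA.exists_transpose_mul_self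
  have hdet : IsUnit P.det := (Matrix.isUnit_iff_isUnit_det P).1 hP
  refine ⟨∑ i, √(∑ j, P⁻¹ i j ^ 2), Finset.sum_nonneg fun i _ => Real.sqrt_nonneg _, fun x => ?_⟩
  rw [Finset.sum_mul]
  refine Finset.sum_le_sum fun i _ => ?_
  rw [quadForm_transpose_mul_self, ← Real.sqrt_mul (Finset.sum_nonneg fun j _ => sq_nonneg _)]
  refine Real.le_sqrt_of_sq_le ?_
  rw [sq_abs]
  have hx : x i = ∑ j, P⁻¹ i j * (P *ᵥ x) j := by
    conv_lhs => rw [← Matrix.one_mulVec x, ← Matrix.nonsing_inv_mul P hdet, ← Matrix.mulVec_mulVec]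
    rfl
  rw [hx]
  exact Finset.sum_mul_sq_le_sq_mul_sq _ _ _

/-- The unnormalized Gaussian `exp(-⟨x, A x⟩ / (2s))`. -/
def gaussExp (A : Matrix (Fin m) (Fin m) ℝ) (s : ℝ) (x : Fin m → ℝ) : ℝ :=
  Real.exp (-(quadForm A x / (2 * s)))

theorem gaussExp_pos (A : Matrix (Fin m) (Fin m) ℝ) (s : ℝ) (x : Fin m → ℝ) :
    0 < gaussExp A s x := Real.exp_pos _

theorem continuous_gaussExp (A : Matrix (Fin m) (Fin m) ℝ) (s : ℝ) :
    Continuous (gaussExp A s) := by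
  have := continuous_quadForm A
  unfold gaussExp
  fun_prop

theorem gaussExp_smul (A : Matrix (Fin m) (Fin m) ℝ) {s t : ℝ} (ht : 0 < t) (x : Fin m → ℝ) :
    gaussExp A s ((√t)⁻¹ • x) = gaussExp A (t * s) x := by
  rw [gaussExp, gaussExp, quadForm_smul, inv_pow, Real.sq_sqrt ht.le]
  congr 2
  rw [inv_mul_eq_div, div_div]; congr 1; ring

theorem integral_comp_mulVec (P : Matrix (Fin m) (Fin m) ℝ) (hP : IsUnit P)
    {f : (Fin m → ℝ) → ℂ} (hf : Continuous f) :
    ∫ x, f (P *ᵥ x) = |P.det⁻¹| • ∫ x, f x := by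
  have hdet : P.det ≠ 0 := ((Matrix.isUnit_iff_isUnit_det P).1 hP).ne_zero
  have hc : Continuous (Matrix.toLin' P) := LinearMap.continuous_on_pi _
  have h := MeasureTheory.integral_map (μ := MeasureTheory.volume) hc.aemeasurable
    (f := f) hf.aestronglyMeasurable
  rw [Real.map_matrix_volume_pi_eq_smul_volume_pi hdet, MeasureTheory.integral_smul_measure,
    ENNReal.toReal_ofReal (abs_nonneg _)] at h
  exact h.symm

theorem integrable_comp_mulVec (P : Matrix (Fin m) (Fin m) ℝ) (hP : IsUnit P)
    {f : (Fin m → ℝ) → ℂ} (hf : Continuous f) (hi : MeasureTheory.Integrable f) :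
    MeasureTheory.Integrable fun x => f (P *ᵥ x) := by
  have hdet : P.det ≠ 0 := ((Matrix.isUnit_iff_isUnit_det P).1 hP).ne_zero
  have hc : Continuous (Matrix.toLin' P) := LinearMap.continuous_on_pi _
  have h := MeasureTheory.integrable_map_measure (μ := MeasureTheory.volume)
    (f := Matrix.toLin' P) (g := f) hf.aestronglyMeasurable hc.aemeasurable
  rw [Real.map_matrix_volume_pi_eq_smul_volume_pi hdet] at h
  exact h.1 (hi.smul_measure ENNReal.ofReal_ne_top)

theorem Matrix.PosDef.integrable_gaussExp (hA : A.PosDef) {s : ℝ} (hs : 0 < s) :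
    MeasureTheory.Integrable (gaussExp A s) := by
  obtain ⟨P, hP, rfl⟩ := hA.exists_transpose_mul_self
  have h := GaussianFourier.integrable_cexp_neg_mul_sum_add (ι := Fin m) (b := ((2 * s)⁻¹ : ℝ))
    (by rw [Complex.ofReal_re]; positivity) 0
  have h2 := (integrable_comp_mulVec P hP (by fun_prop) h).re
  refine h2.congr (Eventually.of_forall fun x => ?_)
  simp only [gaussExp, quadForm_transpose_mul_self]
  have e : (-(((2 * s)⁻¹ : ℝ) : ℂ) * ∑ i, (((P *ᵥ x) i : ℝ) : ℂ) ^ 2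
      + ∑ i, (0 : Fin m → ℂ) i * (((P *ᵥ x) i : ℝ) : ℂ))
      = ((-((∑ i, (P *ᵥ x) i ^ 2) / (2 * s)) : ℝ) : ℂ) := by
    simp only [Pi.zero_apply, zero_mul, Finset.sum_const_zero, add_zero]
    push_cast
    rw [div_eq_inv_mul]; ring
  rw [e, ← Complex.ofReal_exp]
  rfl

theorem integral_gaussExp_mul (A : Matrix (Fin m) (Fin m) ℝ) {t : ℝ} (ht : 0 < t) (s : ℝ) :
    ∫ x, gaussExp A (t * s) x = √t ^ m * ∫ x, gaussExp A s x := by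
  have h := MeasureTheory.Measure.integral_comp_smul (MeasureTheory.volume : MeasureTheory.Measure
    (Fin m → ℝ)) (gaussExp A s) (√t)⁻¹
  simp_rw [gaussExp_smul A ht] at h
  rw [h, Module.finrank_fin_fun, smul_eq_mul, inv_pow, inv_inv, abs_of_nonneg (by positivity)]

theorem Matrix.PosDef.integral_gaussExp_pos (hA : A.PosDef) {s : ℝ} (hs : 0 < s) :
    0 < ∫ x, gaussExp A s x := by
  refine (MeasureTheory.integral_pos_iff_support_of_nonneg (fun x => (gaussExp_pos A s x).le)
    (hA.integrable_gaussExp hs)).2 ?_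
  have : Function.support (gaussExp A s) = Set.univ :=
    Set.eq_univ_of_forall fun x => (gaussExp_pos A s x).ne'
  rw [this]
  exact MeasureTheory.Measure.measure_univ_pos.2 (NeZero.ne _)

/-- The Fourier transform of a Gaussian. -/
theorem Matrix.PosDef.integral_expI_mul_gaussExp (hA : A.PosDef) {s : ℝ} (hs : 0 < s)
    (y : Fin m → ℝ) :
    ∫ x, expI (x ⬝ᵥ y) * (gaussExp A s⁻¹ x : ℂ)
      = ((∫ x, gaussExp A s⁻¹ x : ℝ) : ℂ) * (gaussExp A⁻¹ s y : ℂ) := by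
  obtain ⟨P, hP, rfl⟩ := hA.exists_transpose_mul_self
  have hdet : IsUnit P.det := (Matrix.isUnit_iff_isUnit_det P).1 hP
  have key : ∀ y : Fin m → ℝ, ∫ x, expI (x ⬝ᵥ y) * (gaussExp (Pᵀ * P) s⁻¹ x : ℂ)
      = (|P.det⁻¹| • ((Real.pi : ℂ) / ((s / 2 : ℝ) : ℂ)) ^ ((Fintype.card (Fin m) : ℂ) / 2))
        * (gaussExp (Pᵀ * P)⁻¹ s y : ℂ) := by
    intro y
    -- The dual variable: ⟨x, y⟩ = ⟨Px, z⟩, so the substitution Px leads to the standard Gaussian.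
    set z : Fin m → ℝ := P⁻¹ᵀ *ᵥ y with hz
    let f : (Fin m → ℝ) → ℂ := fun v => Complex.exp (-((s / 2 : ℝ) : ℂ) * ∑ i, (v i : ℂ) ^ 2
      + ∑ i, (Complex.I * z i) * v i)
    have hf : Continuous f := by fun_prop
    have h1 := GaussianFourier.integral_cexp_neg_mul_sum_add (ι := Fin m) (b := ((s / 2 : ℝ) : ℂ))
      (by rw [Complex.ofReal_re]; positivity) (fun i => Complex.I * z i)
    have h2 := integral_comp_mulVec P hP hf
    rw [h1] at h2
    have e1 : ∀ x, f (P *ᵥ x) = expI (x ⬝ᵥ y) * (gaussExp (Pᵀ * P) s⁻¹ x : ℂ) := fun x => by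
      have e : x ⬝ᵥ y = ∑ i, z i * (P *ᵥ x) i := by
        have : ∑ i, z i * (P *ᵥ x) i = z ⬝ᵥ (P *ᵥ x) := rfl
        rw [this, Matrix.dotProduct_mulVec, hz, ← Matrix.mulVec_transpose, Matrix.mulVec_mulVec,
          ← Matrix.transpose_mul, Matrix.nonsing_inv_mul P hdet, Matrix.transpose_one,
          Matrix.one_mulVec, dotProduct_comm]
      simp only [f, expI, gaussExp, quadForm_transpose_mul_self]
      rw [Complex.ofReal_exp, ← Complex.exp_add, e]
      congr 1
      push_cast
      simp only [mul_assoc, ← Finset.mul_sum]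
      have hs' : (s : ℂ) ≠ 0 := by exact_mod_cast hs.ne'
      field_simp
      ring
    have e2 : (∑ i, (Complex.I * (z i : ℂ)) ^ 2) / (4 * ((s / 2 : ℝ) : ℂ))
        = ((-(quadForm (Pᵀ * P)⁻¹ y / (2 * s)) : ℝ) : ℂ) := by
      have e3 : quadForm (Pᵀ * P)⁻¹ y = ∑ i, z i ^ 2 := by
        have := quadForm_transpose_mul_self P⁻¹ᵀ y
        rw [Matrix.transpose_transpose] at this
        rw [← this, Matrix.mul_inv_rev, Matrix.transpose_nonsing_inv]
      rw [e3]
      simp only [mul_pow, Complex.I_sq]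
      push_cast
      rw [← Finset.mul_sum]
      ring
    simp_rw [e1] at h2
    rw [h2, e2, gaussExp, Complex.ofReal_exp, smul_mul_assoc]
  -- The value at y = 0 identifies the constant as the total integral, so it need not be computed.
  have h0 := key 0
  have e0 : gaussExp (Pᵀ * P)⁻¹ s 0 = 1 := by simp [gaussExp, quadForm]
  simp only [dotProduct_zero, expI_zero, one_mul, e0, Complex.ofReal_one, mul_one] at h0
  rw [key y, ← h0, integral_complex_ofReal]

end Gaussian

/-! ### Gaussian sums over shifted lattices as Riemann sums -/

section Lattice

variable {m : ℕ} {A : Matrix (Fin m) (Fin m) ℝ}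

/-- The unit cube with lower corner `w`. -/
def unitCube (w : Fin m → ℤ) : Set (Fin m → ℝ) := {z | (fun i => ⌊z i⌋) = w}

theorem measurableSet_unitCube (w : Fin m → ℤ) : MeasurableSet (unitCube w) := by
  have : Measurable fun (z : Fin m → ℝ) i => ⌊z i⌋ :=
    measurable_pi_lambda _ fun i => Int.measurable_floor.comp (measurable_pi_apply i)
  exact this (measurableSet_singleton w)

theorem volume_unitCube (w : Fin m → ℤ) : MeasureTheory.volume (unitCube w) = 1 := by
  have : unitCube w = Set.univ.pi fun i => Set.Ico (w i : ℝ) (w i + 1) := by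
    ext z
    simp only [unitCube, Set.mem_ofPred_eq, funext_iff, Set.mem_pi, Set.mem_univ, true_implies,
      Set.mem_Ico, Int.floor_eq_iff]
  rw [this, MeasureTheory.volume_pi_pi]
  simp

theorem hasSum_integral_unitCube {g : (Fin m → ℝ) → ℝ} (hg : MeasureTheory.Integrable g) :
    HasSum (fun w => ∫ z in unitCube w, g z) (∫ z, g z) := by
  have hU : ⋃ w : Fin m → ℤ, unitCube w = Set.univ :=
    Set.eq_univ_of_forall fun z => Set.mem_iUnion.2 ⟨_, rfl⟩
  have := MeasureTheory.hasSum_integral_iUnion (f := g) (μ := MeasureTheory.volume)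
    (measurableSet_unitCube (m := m)) (fun w w' h => Set.disjoint_left.2
      fun z (hz : _ = w) (hz' : _ = w') => h (hz.symm.trans hz')) (by
        rw [hU]; exact hg.integrableOn)
  rwa [hU, MeasureTheory.setIntegral_univ] at this

theorem le_setIntegral_unitCube {g : (Fin m → ℝ) → ℝ} (hg : MeasureTheory.Integrable g)
    {w : Fin m → ℤ} {c : ℝ} (h : ∀ z ∈ unitCube w, c ≤ g z) : c ≤ ∫ z in unitCube w, g z := by
  have hv := volume_unitCube w
  have := MeasureTheory.setIntegral_mono_on (μ := MeasureTheory.volume) (f := fun _ => c) (g := g)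
    (MeasureTheory.integrableOn_const (by rw [hv]; exact ENNReal.one_ne_top)) hg.integrableOn
    (measurableSet_unitCube w) h
  simpa [MeasureTheory.measureReal_def, hv] using this

theorem setIntegral_unitCube_le {g : (Fin m → ℝ) → ℝ} (hg : MeasureTheory.Integrable g)
    {w : Fin m → ℤ} {c : ℝ} (h : ∀ z ∈ unitCube w, g z ≤ c) : ∫ z in unitCube w, g z ≤ c := by
  have := le_setIntegral_unitCube hg.neg (c := -c) fun z hz => neg_le_neg (h z hz)
  simp only [Pi.neg_apply, MeasureTheory.integral_neg] at this
  linarith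

theorem exists_quadForm_sub_le (A : Matrix (Fin m) (Fin m) ℝ) :
    ∃ B : ℝ, 0 ≤ B ∧ ∀ w : Fin m → ℤ, ∀ z ∈ unitCube w, quadForm A (z - fun i => (w i : ℝ)) ≤ B := by
  have hc : IsCompact (Set.univ.pi fun _ : Fin m => Set.Icc (0 : ℝ) 1) :=
    isCompact_univ_pi fun _ => isCompact_Icc
  obtain ⟨B, hB⟩ := hc.bddAbove_image (continuous_quadForm A).continuousOn
  refine ⟨max B 0, le_max_right _ _, fun w z hz => (hB ⟨_, ?_, rfl⟩).trans (le_max_left _ _)⟩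
  intro i _
  have hz' : ⌊z i⌋ = w i := congrFun hz i
  rw [Int.floor_eq_iff] at hz'
  simp only [Pi.sub_apply, Set.mem_Icc]
  constructor <;> linarith

/-- Moving a lattice point inside its cube costs a constant factor and a widening of the variance by
1+η, by `quadForm_add_le`; neither depends on the centre x. -/
theorem Matrix.PosDef.gaussExp_le_of_mem_unitCube (hA : A.PosDef) {B : ℝ}
    (hB : ∀ w : Fin m → ℤ, ∀ z ∈ unitCube w, quadForm A (z - fun i => (w i : ℝ)) ≤ B)
    {s η : ℝ} (hs : 0 < s) (hη : 0 < η) (x : Fin m → ℝ) {w : Fin m → ℤ} {z : Fin m → ℝ}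
    (hz : z ∈ unitCube w) : gaussExp A s ((fun i => (w i : ℝ)) - x)
      ≤ Real.exp (B / (2 * s * η)) * gaussExp A ((1 + η) * s) (z - x) := by
  have h := hA.quadForm_add_le hη ((fun i => (w i : ℝ)) - x) (z - fun i => (w i : ℝ))
  rw [add_comm, sub_add_sub_cancel] at h
  have h2 := hB w z hz
  rw [gaussExp, gaussExp, ← Real.exp_add, Real.exp_le_exp]
  set a := quadForm A ((fun i => (w i : ℝ)) - x)
  set b := quadForm A (z - x)
  have h3 : b ≤ (1 + η) * a + (1 + 1 / η) * B := h.trans (by gcongr)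
  have e : B / (2 * s * η) + -(b / (2 * ((1 + η) * s))) - -(a / (2 * s))
      = ((1 + η) * a + (1 + 1 / η) * B - b) / (2 * ((1 + η) * s)) := by
    field_simp; ring
  have : 0 ≤ ((1 + η) * a + (1 + 1 / η) * B - b) / (2 * ((1 + η) * s)) :=
    div_nonneg (by linarith) (by positivity)
  linarith

theorem Matrix.PosDef.le_gaussExp_of_mem_unitCube (hA : A.PosDef) {B : ℝ}
    (hB : ∀ w : Fin m → ℤ, ∀ z ∈ unitCube w, quadForm A (z - fun i => (w i : ℝ)) ≤ B)
    {s η : ℝ} (hs : 0 < s) (hη : 0 < η) (x : Fin m → ℝ) {w : Fin m → ℤ} {z : Fin m → ℝ}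
    (hz : z ∈ unitCube w) : Real.exp (-((1 + 1 / η) * B / (2 * s))) *
      gaussExp A ((1 + η)⁻¹ * s) (z - x) ≤ gaussExp A s ((fun i => (w i : ℝ)) - x) := by
  have h := hA.quadForm_add_le hη (z - x) (-(z - fun i => (w i : ℝ)))
  rw [quadForm_neg, show z - x + -(z - fun i => (w i : ℝ)) = (fun i => (w i : ℝ)) - x by abel] at h
  have h2 := hB w z hz
  rw [gaussExp, gaussExp, ← Real.exp_add, Real.exp_le_exp]
  set a := quadForm A ((fun i => (w i : ℝ)) - x)
  set b := quadForm A (z - x)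
  have h3 : a ≤ (1 + η) * b + (1 + 1 / η) * B := h.trans (by gcongr)
  have e : -(a / (2 * s)) - (-((1 + 1 / η) * B / (2 * s)) + -(b / (2 * ((1 + η)⁻¹ * s))))
      = ((1 + η) * b + (1 + 1 / η) * B - a) / (2 * s) := by
    field_simp; ring
  have : 0 ≤ ((1 + η) * b + (1 + 1 / η) * B - a) / (2 * s) :=
    div_nonneg (by linarith) (by positivity)
  linarith

theorem Matrix.PosDef.summable_gaussExp (hA : A.PosDef) {s : ℝ} (hs : 0 < s) (x : Fin m → ℝ) :
    Summable fun w : Fin m → ℤ => gaussExp A s ((fun i => (w i : ℝ)) - x) := by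
  obtain ⟨B, -, hB⟩ := exists_quadForm_sub_le A
  have hg := ((hA.integrable_gaussExp (s := (1 + 1) * s) (by positivity)).comp_sub_right x).const_mul
    (Real.exp (B / (2 * s * 1)))
  exact Summable.of_nonneg_of_le (fun w => (gaussExp_pos _ _ _).le)
    (fun w => le_setIntegral_unitCube hg fun z hz => hA.gaussExp_le_of_mem_unitCube hB hs one_pos x hz)
    (hasSum_integral_unitCube hg).summable

theorem Matrix.PosDef.tsum_gaussExp_le (hA : A.PosDef) {B : ℝ}
    (hB : ∀ w : Fin m → ℤ, ∀ z ∈ unitCube w, quadForm A (z - fun i => (w i : ℝ)) ≤ B)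
    {s η : ℝ} (hs : 0 < s) (hη : 0 < η) (x : Fin m → ℝ) :
    ∑' w : Fin m → ℤ, gaussExp A s ((fun i => (w i : ℝ)) - x)
      ≤ Real.exp (B / (2 * s * η)) * (√((1 + η) * s) ^ m * ∫ z, gaussExp A 1 z) := by
  have hg := ((hA.integrable_gaussExp (s := (1 + η) * s) (by positivity)).comp_sub_right x).const_mul
    (Real.exp (B / (2 * s * η)))
  have h := hasSum_integral_unitCube hg
  have e := integral_gaussExp_mul A (t := (1 + η) * s) (by positivity) 1
  rw [mul_one] at e
  rw [MeasureTheory.integral_const_mul, MeasureTheory.integral_sub_right_eq_self (gaussExp A _),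
    e] at h
  exact hasSum_le (fun w => le_setIntegral_unitCube hg fun z hz =>
    hA.gaussExp_le_of_mem_unitCube hB hs hη x hz) (hA.summable_gaussExp hs x).hasSum h

theorem Matrix.PosDef.le_tsum_gaussExp (hA : A.PosDef) {B : ℝ}
    (hB : ∀ w : Fin m → ℤ, ∀ z ∈ unitCube w, quadForm A (z - fun i => (w i : ℝ)) ≤ B)
    {s η : ℝ} (hs : 0 < s) (hη : 0 < η) (x : Fin m → ℝ) :
    Real.exp (-((1 + 1 / η) * B / (2 * s))) * (√((1 + η)⁻¹ * s) ^ m * ∫ z, gaussExp A 1 z)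
      ≤ ∑' w : Fin m → ℤ, gaussExp A s ((fun i => (w i : ℝ)) - x) := by
  have hg := ((hA.integrable_gaussExp (s := (1 + η)⁻¹ * s) (by positivity)).comp_sub_right
    x).const_mul (Real.exp (-((1 + 1 / η) * B / (2 * s))))
  have h := hasSum_integral_unitCube hg
  have e := integral_gaussExp_mul A (t := (1 + η)⁻¹ * s) (by positivity) 1
  rw [mul_one] at e
  rw [MeasureTheory.integral_const_mul, MeasureTheory.integral_sub_right_eq_self (gaussExp A _),
    e] at h
  exact hasSum_le (fun w => setIntegral_unitCube_le hg fun z hz =>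
    hA.le_gaussExp_of_mem_unitCube hB hs hη x hz) h (hA.summable_gaussExp hs x).hasSum

/-- Riemann sums of Gaussians over shifted lattices. -/
theorem Matrix.PosDef.tendsto_tsum_gaussExp (hA : A.PosDef) {s : ℕ → ℝ} (hs : Tendsto s atTop atTop)
    (x : ℕ → Fin m → ℝ) :
    Tendsto (fun n => (∑' w : Fin m → ℤ, gaussExp A (s n) ((fun i => (w i : ℝ)) - x n)) / √(s n) ^ m)
      atTop (𝓝 (∫ z, gaussExp A 1 z)) := by
  obtain ⟨B, hB0, hB⟩ := exists_quadForm_sub_le A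
  set J := ∫ z, gaussExp A 1 z
  have hpos : ∀ᶠ n in atTop, 0 < s n := hs.eventually_gt_atTop 0
  -- The choice η = 1/√s makes both η and B/(sη) tend to 0.
  have hr : Tendsto (fun n => (√(s n))⁻¹) atTop (𝓝 0) :=
    tendsto_inv_atTop_zero.comp (Real.tendsto_sqrt_atTop.comp hs)
  have hi : Tendsto (fun n => (s n)⁻¹) atTop (𝓝 0) := tendsto_inv_atTop_zero.comp hs
  have hup : Tendsto (fun n => Real.exp (B / 2 * (√(s n))⁻¹) * (√(1 + (√(s n))⁻¹) ^ m * J)) atTop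
      (𝓝 J) := by
    have : Continuous fun r : ℝ => Real.exp (B / 2 * r) * (√(1 + r) ^ m * J) := by fun_prop
    have := (this.tendsto 0).comp hr
    simpa [Function.comp_def] using this
  have hlo : Tendsto (fun n => Real.exp (-(B / 2 * (s n)⁻¹ + B / 2 * (√(s n))⁻¹)) *
      (√(1 + (√(s n))⁻¹)⁻¹ ^ m * J)) atTop (𝓝 J) := by
    have h1 : Tendsto (fun n => Real.exp (-(B / 2 * (s n)⁻¹ + B / 2 * (√(s n))⁻¹))) atTop
        (𝓝 (Real.exp (-(B / 2 * 0 + B / 2 * 0)))) :=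
      (Real.continuous_exp.tendsto _).comp ((hi.const_mul _).add (hr.const_mul _)).neg
    have h2 : Tendsto (fun n => √(1 + (√(s n))⁻¹)⁻¹ ^ m * J) atTop (𝓝 (√(1 + 0 : ℝ)⁻¹ ^ m * J)) :=
      (((hr.const_add 1).inv₀ (by norm_num)).sqrt.pow m).mul_const J
    simpa using h1.mul h2
  refine tendsto_of_tendsto_of_tendsto_of_le_of_le' hlo hup ?_ ?_
  · filter_upwards [hpos] with n hn
    have hq : 0 < √(s n) := Real.sqrt_pos.2 hn
    have h := hA.le_tsum_gaussExp hB hn (inv_pos.2 hq) (x n)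
    rw [le_div_iff₀ (by positivity)]
    refine le_trans (le_of_eq ?_) h
    rw [Real.sqrt_mul (by positivity), mul_pow, one_div, inv_inv]
    have e : -((1 + √(s n)) * B / (2 * s n)) = -(B / 2 * (s n)⁻¹ + B / 2 * (√(s n))⁻¹) := by
      nth_rewrite 2 [← Real.sq_sqrt hn.le]
      nth_rewrite 3 [← Real.sq_sqrt hn.le]
      field_simp
    rw [e]
    ring
  · filter_upwards [hpos] with n hn
    have hq : 0 < √(s n) := Real.sqrt_pos.2 hn
    have h := hA.tsum_gaussExp_le hB hn (inv_pos.2 hq) (x n)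
    rw [div_le_iff₀ (by positivity)]
    refine h.trans (le_of_eq ?_)
    rw [Real.sqrt_mul (by positivity), mul_pow]
    have e : B / (2 * s n * (√(s n))⁻¹) = B / 2 * (√(s n))⁻¹ := by
      nth_rewrite 1 [← Real.sq_sqrt hn.le]
      field_simp
    rw [e]
    ring

end Lattice

/-! ### Coordinates on Γ and smoothing along Λ -/

section Lattice

variable {Γ : Type*} [Group Γ] {Λ : Subgroup Γ} {m : ℕ} {Δ : Set Γ}
  (φ : Λ ≃* Multiplicative (Fin m → ℤ)) (hΔ : Subgroup.IsComplement (Λ : Set Γ) Δ)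

/-- The element of `Λ` with coordinates `w`. -/
abbrev latticeElem (w : Fin m → ℤ) : Γ := (φ.symm (Multiplicative.ofAdd w) : Γ)

theorem latticeElem_inv (w : Fin m → ℤ) : (latticeElem φ w)⁻¹ = latticeElem φ (-w) := by
  simp [latticeElem]

theorem Phi_latticeElem_mul (w : Fin m → ℤ) (γ : Γ) :
    Phi φ hΔ (latticeElem φ w * γ) = w + Phi φ hΔ γ := by
  simp [latticeElem, Phi_mul]

theorem cosetMk_latticeElem_mul (w : Fin m → ℤ) (γ : Γ) :
    cosetMk Λ (latticeElem φ w * γ) = cosetMk Λ γ := cosetMk_mem_mul (SetLike.coe_mem _) γ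

/-- An element of `Γ` is determined by its coset and its image under `Φ`. -/
def cosetLatticeEquiv : Γ ≃ CosetSpace Λ × (Fin m → ℤ) where
  toFun γ := (cosetMk Λ γ, Phi φ hΔ γ)
  invFun p := latticeElem φ (p.2 - Phi φ hΔ p.1.out) * p.1.out
  left_inv γ := by
    obtain ⟨l, hl, h⟩ := exists_mul_eq_out (Λ := Λ) γ
    have h1 := Phi_mul φ hΔ ⟨l, hl⟩ γ
    simp only at h1
    simp only [h, h1]
    rw [sub_add_cancel_right, ← latticeElem_inv]
    simp [latticeElem]
  right_inv p := by
    refine Prod.ext ?_ ?_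
    · simp only [cosetMk_latticeElem_mul]
      exact Quotient.out_eq _
    · simp only [Phi_latticeElem_mul, sub_add_cancel]

theorem hasSum_comp_Phi [Λ.FiniteIndex] {g : (Fin m → ℤ) → ℝ} {S : ℝ} (hg : HasSum g S) :
    HasSum (fun γ => g (Phi φ hΔ γ)) (Λ.index * S) := by
  have h := hasSum_prod_of_fintype (f := fun p : CosetSpace Λ × (Fin m → ℤ) => g p.2)
    (a := fun _ => S) fun _ => hg
  rw [Finset.sum_const, Finset.card_univ, card_cosetSpace, nsmul_eq_mul] at h
  exact (cosetLatticeEquiv φ hΔ).hasSum_iff.2 h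

/-- Summation over the coset of `γ`. -/
theorem tsum_latticeElem_inv_mul {B : Type*} [AddCommMonoid B] [TopologicalSpace B]
    [T2Space B] (F : Γ → B) (γ : Γ) (hF : ∀ γ', cosetMk Λ γ' ≠ cosetMk Λ γ → F γ' = 0) :
    ∑' w : Fin m → ℤ, F ((latticeElem φ w)⁻¹ * γ) = ∑' γ', F γ' := by
  refine Function.Injective.tsum_eq (g := fun w => (latticeElem φ w)⁻¹ * γ) (fun w w' h => ?_) ?_
  · simpa [latticeElem] using h
  · intro γ' hγ'
    have h : cosetMk Λ γ' = cosetMk Λ γ := by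
      by_contra h
      exact hγ' (hF γ' h)
    have h' : γ * γ'⁻¹ ∈ Λ := QuotientGroup.rightRel_apply.1 (Quotient.exact h)
    exact ⟨Multiplicative.toAdd (φ ⟨_, h'⟩), by simp [latticeElem]⟩

theorem summable_uncurry_of_abs {α β : Type*} {f : α → β → ℝ} (hs : ∀ a, Summable (f a))
    {D : α → ℝ} (hD : ∀ a, ∑' b, |f a b| ≤ D a) (hsum : Summable D) :
    Summable (Function.uncurry f) := by
  refine Summable.of_abs ((summable_prod_of_nonneg fun _ => abs_nonneg _).2 ⟨fun a => (hs a).abs, ?_⟩)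
  exact Summable.of_nonneg_of_le (fun a => tsum_nonneg fun b => abs_nonneg _) hD hsum

/-- The average of the translates of `ν` with weights `p`. -/
def smoothing (p : (Fin m → ℤ) → ℝ) (ν : Γ → ℝ) (γ : Γ) : ℝ :=
  ∑' w, p w * ν ((latticeElem φ w)⁻¹ * γ)

theorem hasSum_comp_mul_left {ν : Γ → ℝ} {S : ℝ} (hν : HasSum ν S) (g : Γ) :
    HasSum (fun γ => ν (g * γ)) S :=
  (Equiv.mulLeft g).hasSum_iff.2 hν

theorem summable_smoothing_uncurry {p : (Fin m → ℤ) → ℝ} (hp : ∀ w, 0 ≤ p w) (hps : Summable p)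
    {ν : Γ → ℝ} (hν : ∀ γ, 0 ≤ ν γ) (hνs : HasSum ν 1) :
    Summable (Function.uncurry fun w γ => p w * ν ((latticeElem φ w)⁻¹ * γ)) := by
  have h := fun w => (hasSum_comp_mul_left hνs (latticeElem φ w)⁻¹).mul_left (p w)
  refine summable_uncurry_of_abs (fun w => (h w).summable) (fun w => le_of_eq ?_) hps
  have e : ∀ γ, |p w * ν ((latticeElem φ w)⁻¹ * γ)| = p w * ν ((latticeElem φ w)⁻¹ * γ) :=
    fun γ => abs_of_nonneg (mul_nonneg (hp w) (hν _))
  simp_rw [e, (h w).tsum_eq, mul_one]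

theorem hasSum_smoothing {p : (Fin m → ℤ) → ℝ} (hp : ∀ w, 0 ≤ p w) (hps : HasSum p 1)
    {ν : Γ → ℝ} (hν : ∀ γ, 0 ≤ ν γ) (hνs : HasSum ν 1) : HasSum (smoothing φ p ν) 1 := by
  have h := summable_smoothing_uncurry φ hp hps.summable hν hνs
  have hc := h.prod_symm.prod
  have e := h.tsum_comm
  have e1 : ∀ w, ∑' γ, p w * ν ((latticeElem φ w)⁻¹ * γ) = p w := fun w => by
    rw [((hasSum_comp_mul_left hνs _).mul_left (p w)).tsum_eq, mul_one]
  have e2 : ∑' γ, smoothing φ p ν γ = 1 := by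
    have e3 : ∑' w, ∑' γ, p w * ν ((latticeElem φ w)⁻¹ * γ) = 1 := by
      simp_rw [e1]; exact hps.tsum_eq
    exact e.trans e3
  rw [← e2]
  exact Summable.hasSum hc

theorem smoothing_nonneg {p : (Fin m → ℤ) → ℝ} (hp : ∀ w, 0 ≤ p w)
    {ν : Γ → ℝ} (hν : ∀ γ, 0 ≤ ν γ) (γ : Γ) : 0 ≤ smoothing φ p ν γ :=
  tsum_nonneg fun w => mul_nonneg (hp w) (hν _)

/-- As p has mass 1, the difference is a p-average of translates minus ν; apply the triangle
inequality and interchange the sums. -/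
theorem tsum_abs_smoothing_sub_le {p : (Fin m → ℤ) → ℝ} (hp : ∀ w, 0 ≤ p w) (hps : HasSum p 1)
    {ν : Γ → ℝ} (hν : ∀ γ, 0 ≤ ν γ) (hνs : HasSum ν 1) {D : (Fin m → ℤ) → ℝ}
    (hD : ∀ w, ∑' γ, |ν ((latticeElem φ w)⁻¹ * γ) - ν γ| ≤ D w)
    (hpD : Summable fun w => p w * D w) :
    ∑' γ, |smoothing φ p ν γ - ν γ| ≤ ∑' w, p w * D w := by
  have h := summable_smoothing_uncurry φ hp hps.summable hν hνs
  have hd : ∀ w, Summable fun γ => |ν ((latticeElem φ w)⁻¹ * γ) - ν γ| := fun w =>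
    ((hasSum_comp_mul_left hνs _).sub hνs).summable.abs
  have e1 : ∀ w, ∑' γ, |p w * (|ν ((latticeElem φ w)⁻¹ * γ) - ν γ|)| ≤ p w * D w := fun w => by
    simp_rw [abs_mul, abs_abs, abs_of_nonneg (hp w), tsum_mul_left]
    exact mul_le_mul_of_nonneg_left (hD w) (hp w)
  have hu : Summable (Function.uncurry fun w γ => p w * |ν ((latticeElem φ w)⁻¹ * γ) - ν γ|) :=
    summable_uncurry_of_abs (fun w => (hd w).mul_left _) e1 hpD
  have hc := hu.prod_symm
  have hle : ∀ γ, |smoothing φ p ν γ - ν γ|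
      ≤ ∑' w, p w * |ν ((latticeElem φ w)⁻¹ * γ) - ν γ| := fun γ => by
    have h1 : HasSum (fun w => p w * (ν ((latticeElem φ w)⁻¹ * γ) - ν γ))
        (smoothing φ p ν γ - ν γ) := by
      have h2 := (h.prod_symm.prod_factor γ).hasSum.sub (hps.mul_right (ν γ))
      exact h2.of_eq (fun w => by simp only [Prod.swap, Function.uncurry]; ring)
        (by rw [one_mul]; rfl)
    rw [← h1.tsum_eq]
    have h3 : Summable fun w => |p w * (ν ((latticeElem φ w)⁻¹ * γ) - ν γ)| := h1.summable.abs
    have h4 := norm_tsum_le_tsum_norm (f := fun w => p w * (ν ((latticeElem φ w)⁻¹ * γ) - ν γ)) h3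
    simp only [Real.norm_eq_abs, abs_mul, abs_of_nonneg (hp _)] at h4
    simpa only [abs_mul, abs_of_nonneg (hp _)] using h4
  calc ∑' γ, |smoothing φ p ν γ - ν γ|
      ≤ ∑' γ, ∑' w, p w * |ν ((latticeElem φ w)⁻¹ * γ) - ν γ| :=
        Summable.tsum_le_tsum hle
          ((hasSum_smoothing φ hp hps hν hνs).sub hνs).summable.abs hc.prod
    _ = ∑' w, ∑' γ, p w * |ν ((latticeElem φ w)⁻¹ * γ) - ν γ| := hu.tsum_comm
    _ ≤ ∑' w, p w * D w := by
        refine Summable.tsum_le_tsum (fun w => ?_) hu.prod hpD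
        rw [tsum_mul_left]
        exact mul_le_mul_of_nonneg_left (hD w) (hp w)

end Lattice

/-! ### Fourier inversion for the smoothed law -/

section Fourier

variable {Γ : Type*} [Group Γ] {Λ : Subgroup Γ} {m : ℕ} {Δ : Set Γ}
  (φ : Λ ≃* Multiplicative (Fin m → ℤ)) (hΔ : Subgroup.IsComplement (Λ : Set Γ) Δ)

open Classical in
/-- The indicator of a coset. -/
def cosetIndicator (x y : CosetSpace Λ) : ℝ := if y = x then 1 else 0

theorem abs_cosetIndicator_le (x y : CosetSpace Λ) : |cosetIndicator x y| ≤ 1 := by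
  unfold cosetIndicator; split_ifs <;> simp

theorem cosetMean_cosetIndicator [Λ.FiniteIndex] (x : CosetSpace Λ) :
    cosetMean (cosetIndicator x) = (Λ.index : ℝ)⁻¹ := by
  classical
  simp [cosetMean, cosetIndicator]

/-- The characteristic function of the part of `ν` on a coset, after centring at `c` and
scaling by `h`. -/
def cosetChar (ν : Γ → ℝ) (h : ℝ) (c : Fin m → ℝ) (x : CosetSpace Λ) (v : Fin m → ℝ) : ℂ :=
  ∑' γ, ν γ • (expI (h * (v ⬝ᵥ realPhi φ hΔ γ - v ⬝ᵥ c)) * (cosetIndicator x (cosetMk Λ γ) : ℂ))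

theorem norm_smul_expI_mul_cosetIndicator_le {ν : Γ → ℝ} (hν : ∀ γ, 0 ≤ ν γ) (γ : Γ) (r : ℝ)
    (x y : CosetSpace Λ) : ‖ν γ • (expI r * (cosetIndicator x y : ℂ))‖ ≤ ν γ := by
  rw [norm_smul, norm_mul, norm_expI, one_mul, Complex.norm_real, Real.norm_of_nonneg (hν γ)]
  exact mul_le_of_le_one_right (hν γ) (abs_cosetIndicator_le x y)

theorem norm_cosetChar_le {ν : Γ → ℝ} (hν : ∀ γ, 0 ≤ ν γ) (hνs : HasSum ν 1) (h : ℝ)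
    (c : Fin m → ℝ) (x : CosetSpace Λ) (v : Fin m → ℝ) : ‖cosetChar φ hΔ ν h c x v‖ ≤ 1 :=
  tsum_of_norm_bounded hνs fun γ => norm_smul_expI_mul_cosetIndicator_le hν γ _ _ _

theorem continuous_cosetChar {ν : Γ → ℝ} (hν : ∀ γ, 0 ≤ ν γ) (hνs : HasSum ν 1) (h : ℝ)
    (c : Fin m → ℝ) (x : CosetSpace Λ) : Continuous (cosetChar φ hΔ ν h c x) := by
  refine continuous_tsum (fun γ => ?_) hνs.summable
    fun γ v => norm_smul_expI_mul_cosetIndicator_le hν γ _ _ _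
  have h1 : Continuous fun v : Fin m → ℝ => h * (v ⬝ᵥ realPhi φ hΔ γ - v ⬝ᵥ c) := by
    unfold dotProduct; fun_prop
  exact ((continuous_expI.comp h1).mul continuous_const).const_smul (ν γ)

variable {C : Matrix (Fin m) (Fin m) ℝ}

theorem gaussExp_mul_gaussExp (C : Matrix (Fin m) (Fin m) ℝ) (t : ℝ) (x : Fin m → ℝ) :
    gaussExp C 1 x * gaussExp C t⁻¹ x = gaussExp C (1 + t)⁻¹ x := by
  rw [gaussExp, gaussExp, gaussExp, ← Real.exp_add]
  congr 1
  simp only [mul_one, div_eq_mul_inv, mul_inv, inv_inv]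
  ring

theorem Matrix.PosDef.integrable_expI_mul_gaussExp (hC : C.PosDef) {t : ℝ} (ht : 0 < t)
    (y : Fin m → ℝ) :
    MeasureTheory.Integrable fun x => expI (x ⬝ᵥ y) * (gaussExp C t x : ℂ) := by
  refine (hC.integrable_gaussExp ht).mono' ?_ (Eventually.of_forall fun x => ?_)
  · have h1 : Continuous fun x : Fin m → ℝ => x ⬝ᵥ y := by unfold dotProduct; fun_prop
    have h2 := continuous_gaussExp C t
    exact ((continuous_expI.comp h1).mul (Complex.continuous_ofReal.comp h2)).aestronglyMeasurable
  · rw [norm_mul, norm_expI, one_mul, Complex.norm_real,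
      Real.norm_of_nonneg (gaussExp_pos C t x).le]

/-- Each Gaussian weight is a Fourier integral. Interchanging sum and integral collects the values
of ν on the coset of γ into its characteristic function. -/
theorem tsum_gaussExp_mul_eq_integral (hC : C.PosDef) {t M : ℝ} (ht : 0 < t) (hM : 0 < M)
    {ν : Γ → ℝ} (hν : ∀ γ, 0 ≤ ν γ) (hνs : HasSum ν 1) (c : Fin m → ℝ) (γ : Γ) :
    (((∫ x, gaussExp C t⁻¹ x) * ∑' w : Fin m → ℤ,
        gaussExp C⁻¹ (M * t) (fun i => (w i : ℝ)) * ν ((latticeElem φ w)⁻¹ * γ) : ℝ) : ℂ)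
      = ∫ τ, expI ((√M)⁻¹ * (τ ⬝ᵥ realPhi φ hΔ γ - τ ⬝ᵥ c)) *
        cosetChar φ hΔ ν (√M)⁻¹ c (cosetMk Λ γ) (-τ) * (gaussExp C t⁻¹ τ : ℂ) := by
  set h := (√M)⁻¹ with hh
  have hinj : Function.Injective fun w : Fin m → ℤ => (latticeElem φ w)⁻¹ * γ :=
    fun w w' hw => by simpa [latticeElem] using hw
  let F : (Fin m → ℤ) → (Fin m → ℝ) → ℂ := fun w τ => (ν ((latticeElem φ w)⁻¹ * γ) : ℂ) *
    (expI (τ ⬝ᵥ (h • fun i => (w i : ℝ))) * (gaussExp C t⁻¹ τ : ℂ))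
  have hF : ∀ w, MeasureTheory.Integrable (F w) := fun w =>
    (hC.integrable_expI_mul_gaussExp (inv_pos.2 ht) _).const_mul _
  have hFn : ∀ w τ, ‖F w τ‖ = ν ((latticeElem φ w)⁻¹ * γ) * gaussExp C t⁻¹ τ := fun w τ => by
    rw [norm_mul, norm_mul, norm_expI, one_mul, Complex.norm_real, Complex.norm_real,
      Real.norm_of_nonneg (hν _), Real.norm_of_nonneg (gaussExp_pos _ _ _).le]
  have hsum : Summable fun w => ∫ τ, ‖F w τ‖ := by
    simp_rw [hFn, MeasureTheory.integral_const_mul]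
    exact (hνs.summable.comp_injective hinj).mul_right _
  have h1 := MeasureTheory.integral_tsum_of_summable_integral_norm hF hsum
  have h2 : ∀ w, ∫ τ, F w τ = (((∫ x, gaussExp C t⁻¹ x) * (gaussExp C⁻¹ (M * t)
      (fun i => (w i : ℝ)) * ν ((latticeElem φ w)⁻¹ * γ)) : ℝ) : ℂ) := fun w => by
    simp only [F]
    rw [MeasureTheory.integral_const_mul, hC.integral_expI_mul_gaussExp ht,
      gaussExp_smul C⁻¹ hM]
    push_cast
    ring
  simp_rw [h2] at h1
  rw [← Complex.ofReal_tsum, tsum_mul_left] at h1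
  rw [h1]
  congr 1
  funext τ
  let W : Γ → ℂ := fun γ' => expI (h * (τ ⬝ᵥ realPhi φ hΔ γ - τ ⬝ᵥ c)) *
    (ν γ' • (expI (h * (-τ ⬝ᵥ realPhi φ hΔ γ' - -τ ⬝ᵥ c)) *
      (cosetIndicator (cosetMk Λ γ) (cosetMk Λ γ') : ℂ))) * (gaussExp C t⁻¹ τ : ℂ)
  have e1 : ∀ w, F w τ = W ((latticeElem φ w)⁻¹ * γ) := fun w => by
    have e2 : realPhi φ hΔ ((latticeElem φ w)⁻¹ * γ)
        = realPhi φ hΔ γ - fun i => (w i : ℝ) := by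
      rw [latticeElem_inv]
      refine (realPhi_symm_mul φ hΔ (-w) γ).trans ?_
      funext i
      simp only [Pi.add_apply, Pi.sub_apply, Pi.neg_apply]
      push_cast; ring
    have e3 : cosetIndicator (cosetMk Λ γ) (cosetMk Λ ((latticeElem φ w)⁻¹ * γ)) = 1 := by
      rw [latticeElem_inv, cosetMk_latticeElem_mul, cosetIndicator, if_pos rfl]
    have e4 : τ ⬝ᵥ (h • fun i => (w i : ℝ)) = h * (τ ⬝ᵥ realPhi φ hΔ γ - τ ⬝ᵥ c)
        + h * (-τ ⬝ᵥ realPhi φ hΔ ((latticeElem φ w)⁻¹ * γ) - -τ ⬝ᵥ c) := by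
      rw [e2, dotProduct_sub, dotProduct_smul, neg_dotProduct, neg_dotProduct, neg_dotProduct,
        smul_eq_mul]
      ring
    simp only [F, W]
    rw [e4, expI_add, e3, Complex.real_smul, Complex.ofReal_one]
    ring
  simp_rw [e1]
  -- The translates of γ by ℤ^m run through its coset, and the indicator kills the other elements of
  -- Γ.
  rw [tsum_latticeElem_inv_mul φ W γ fun γ' hγ' => by
    simp [W, cosetIndicator, if_neg hγ']]
  rw [cosetChar, ← tsum_mul_left, ← tsum_mul_right]

variable [Λ.FiniteIndex]

/-- The defect in the convergence of characteristic functions to a Gaussian. -/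
def charDefect (C : Matrix (Fin m) (Fin m) ℝ) (t : ℝ) (ν : Γ → ℝ) (h : ℝ) (c : Fin m → ℝ) : ℝ :=
  ∑ x : CosetSpace Λ, ∫ τ, ‖cosetChar φ hΔ ν h c x (-τ) - ((Λ.index : ℝ)⁻¹ * gaussExp C 1 τ : ℝ)‖
    * gaussExp C t⁻¹ τ

/-- The second term is the same Fourier integral with the characteristic function replaced by its
limit, since the Gaussians of parameters 1 and 1/t multiply to parameter 1/(1+t). Phases have
modulus one, so the bound does not depend on γ. -/
theorem abs_tsum_gaussExp_mul_sub_le (hC : C.PosDef) {t M : ℝ} (ht : 0 < t) (hM : 0 < M)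
    {ν : Γ → ℝ} (hν : ∀ γ, 0 ≤ ν γ) (hνs : HasSum ν 1) (c : Fin m → ℝ) (γ : Γ) :
    |(∫ x, gaussExp C t⁻¹ x) * (∑' w : Fin m → ℤ,
        gaussExp C⁻¹ (M * t) (fun i => (w i : ℝ)) * ν ((latticeElem φ w)⁻¹ * γ))
      - (Λ.index : ℝ)⁻¹ * ((∫ x, gaussExp C (1 + t)⁻¹ x) *
        gaussExp C⁻¹ (M * (1 + t)) (realPhi φ hΔ γ - c))|
      ≤ charDefect φ hΔ C t ν (√M)⁻¹ c := by
  set h := (√M)⁻¹ with hh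
  let D : CosetSpace Λ → (Fin m → ℝ) → ℂ := fun x τ =>
    cosetChar φ hΔ ν h c x (-τ) - ((Λ.index : ℝ)⁻¹ * gaussExp C 1 τ : ℝ)
  have hG := hC.integrable_gaussExp (inv_pos.2 ht)
  have hcG := continuous_gaussExp C t⁻¹
  have hcG1 := continuous_gaussExp C 1
  have hc1 : ∀ x, Continuous fun τ => cosetChar φ hΔ ν h c x (-τ) := fun x =>
    (continuous_cosetChar φ hΔ hν hνs h c x).comp continuous_neg
  have hc2 : Continuous fun τ : Fin m → ℝ => expI (h * (τ ⬝ᵥ realPhi φ hΔ γ - τ ⬝ᵥ c)) := by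
    refine continuous_expI.comp ?_
    unfold dotProduct; fun_prop
  have hi1 : MeasureTheory.Integrable fun τ => expI (h * (τ ⬝ᵥ realPhi φ hΔ γ - τ ⬝ᵥ c)) *
        cosetChar φ hΔ ν h c (cosetMk Λ γ) (-τ) * (gaussExp C t⁻¹ τ : ℂ) := by
    refine hG.mono' ((hc2.mul (hc1 _)).mul
      (Complex.continuous_ofReal.comp hcG)).aestronglyMeasurable (Eventually.of_forall fun τ => ?_)
    rw [norm_mul, norm_mul, norm_expI, one_mul, Complex.norm_real,
      Real.norm_of_nonneg (gaussExp_pos _ _ _).le]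
    exact mul_le_of_le_one_left (gaussExp_pos _ _ _).le (norm_cosetChar_le φ hΔ hν hνs _ _ _ _)
  have e0 : ∀ τ : Fin m → ℝ, h * (τ ⬝ᵥ realPhi φ hΔ γ - τ ⬝ᵥ c)
      = τ ⬝ᵥ (h • (realPhi φ hΔ γ - c)) := fun τ => by
    rw [dotProduct_smul, dotProduct_sub, smul_eq_mul]
  have e1 : ∀ τ : Fin m → ℝ, expI (h * (τ ⬝ᵥ realPhi φ hΔ γ - τ ⬝ᵥ c)) *
      (((Λ.index : ℝ)⁻¹ * gaussExp C 1 τ : ℝ) : ℂ) * (gaussExp C t⁻¹ τ : ℂ)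
      = ((Λ.index : ℝ)⁻¹ : ℝ) * (expI (τ ⬝ᵥ (h • (realPhi φ hΔ γ - c))) *
        (gaussExp C (1 + t)⁻¹ τ : ℂ)) := fun τ => by
    rw [e0, ← gaussExp_mul_gaussExp]
    push_cast
    ring
  have ht1 : 0 < 1 + t := by positivity
  have hi2 : MeasureTheory.Integrable fun τ => expI (h * (τ ⬝ᵥ realPhi φ hΔ γ - τ ⬝ᵥ c)) *
      (((Λ.index : ℝ)⁻¹ * gaussExp C 1 τ : ℝ) : ℂ) * (gaussExp C t⁻¹ τ : ℂ) := by
    simp_rw [e1]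
    exact (hC.integrable_expI_mul_gaussExp (inv_pos.2 ht1) _).const_mul _
  have e2 : (((Λ.index : ℝ)⁻¹ * ((∫ x, gaussExp C (1 + t)⁻¹ x) *
        gaussExp C⁻¹ (M * (1 + t)) (realPhi φ hΔ γ - c)) : ℝ) : ℂ)
      = ∫ τ, expI (h * (τ ⬝ᵥ realPhi φ hΔ γ - τ ⬝ᵥ c)) *
      (((Λ.index : ℝ)⁻¹ * gaussExp C 1 τ : ℝ) : ℂ) * (gaussExp C t⁻¹ τ : ℂ) := by
    simp_rw [e1]
    rw [MeasureTheory.integral_const_mul, hC.integral_expI_mul_gaussExp ht1, gaussExp_smul C⁻¹ hM]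
    push_cast
    ring
  rw [← Real.norm_eq_abs, ← Complex.norm_real, Complex.ofReal_sub,
    tsum_gaussExp_mul_eq_integral φ hΔ hC ht hM hν hνs c γ, e2,
    ← MeasureTheory.integral_sub hi1 hi2]
  have e3 : ∀ τ, ‖expI (h * (τ ⬝ᵥ realPhi φ hΔ γ - τ ⬝ᵥ c)) *
        cosetChar φ hΔ ν h c (cosetMk Λ γ) (-τ) * (gaussExp C t⁻¹ τ : ℂ) -
      expI (h * (τ ⬝ᵥ realPhi φ hΔ γ - τ ⬝ᵥ c)) *
      (((Λ.index : ℝ)⁻¹ * gaussExp C 1 τ : ℝ) : ℂ) * (gaussExp C t⁻¹ τ : ℂ)‖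
      = ‖D (cosetMk Λ γ) τ‖ * gaussExp C t⁻¹ τ := fun τ => by
    rw [← sub_mul, ← mul_sub, norm_mul, norm_mul, norm_expI, one_mul, Complex.norm_real,
      Real.norm_of_nonneg (gaussExp_pos _ _ _).le]
  refine (MeasureTheory.norm_integral_le_integral_norm _).trans ?_
  simp_rw [e3]
  exact Finset.single_le_sum (f := fun x => ∫ τ, ‖D x τ‖ * gaussExp C t⁻¹ τ)
    (fun x _ => MeasureTheory.integral_nonneg fun τ =>
      mul_nonneg (norm_nonneg _) (gaussExp_pos _ _ _).le) (Finset.mem_univ _)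

theorem charDefect_nonneg (C : Matrix (Fin m) (Fin m) ℝ) (t : ℝ) (ν : Γ → ℝ) (h : ℝ)
    (c : Fin m → ℝ) : 0 ≤ charDefect φ hΔ C t ν h c :=
  Finset.sum_nonneg fun _ _ => MeasureTheory.integral_nonneg fun _ =>
      mul_nonneg (norm_nonneg _) (gaussExp_pos _ _ _).le

variable {μ : PMF Γ} {T : Finset Γ}

/-- The Gaussian factor from the smoothing is an integrable majorant, so pointwise convergence of
the characteristic functions suffices and no high-frequency estimate is needed. -/
theorem tendsto_charDefect (hgen : Subsemigroup.closure μ.support = ⊤) {q : ℕ}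
    (hq : IsPeriod μ q) (hT : Subgroup.closure (T : Set Γ) = ⊤)
    (hmom : FiniteSecondMoment (T : Set Γ) μ) {f : Fin m → CosetSpace Λ → ℝ}
    (hf : ∀ i, IsCorrector φ hΔ μ (Pi.single i 1) (f i)) {π : CosetSpace Λ → ℝ}
    (hπ : ∀ x, π x = 1 / (Λ.index : ℝ)) {t : ℝ} (ht : 0 < t) :
    Tendsto (fun n : ℕ => charDefect φ hΔ (covMatrix φ hΔ μ f) t (avgProb μ q (q * n))
      (√(q * n : ℕ))⁻¹ (((q * n : ℕ) : ℝ) • drift φ hΔ μ π)) atTop (𝓝 0) := by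
  have hC := posDef_covMatrix φ hΔ hgen hT hmom f
  set C := covMatrix φ hΔ μ f with hCdef
  have hq0 := hq.pos hgen
  have hM : Tendsto (fun n : ℕ => q * n) atTop atTop := tendsto_id.const_mul_atTop' hq0
  have hMr : Tendsto (fun n : ℕ => ((q * n : ℕ) : ℝ)) atTop atTop :=
    tendsto_natCast_atTop_atTop.comp hM
  have hpos : ∀ᶠ n : ℕ in atTop, (0 : ℝ) < (q * n : ℕ) := hMr.eventually_gt_atTop 0
  have hh : Tendsto (fun n : ℕ => (√(q * n : ℕ))⁻¹) atTop (𝓝[≠] 0) := by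
    refine tendsto_nhdsWithin_iff.2 ⟨tendsto_inv_atTop_zero.comp (Real.tendsto_sqrt_atTop.comp hMr),
      ?_⟩
    filter_upwards [hpos] with n hn
    exact inv_ne_zero (Real.sqrt_pos.2 hn).ne'
  have hMh : Tendsto (fun n : ℕ => ((q * n : ℕ) : ℝ) * (√(q * n : ℕ))⁻¹ ^ 2) atTop (𝓝 1) := by
    refine tendsto_const_nhds.congr' ?_
    filter_upwards [hpos] with n hn
    rw [inv_pow, Real.sq_sqrt hn.le, mul_inv_cancel₀ hn.ne']
  have hG := hC.integrable_gaussExp (inv_pos.2 ht)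
  have hcG := continuous_gaussExp C t⁻¹
  have hcG1 := continuous_gaussExp C 1
  have hd := index_pos Λ
  rw [← Finset.sum_const_zero (s := (Finset.univ : Finset (CosetSpace Λ)))]
  refine tendsto_finsetSum _ fun x _ => ?_
  have hν := fun n : ℕ => avgProb_nonneg μ q (q * n)
  have hνs := fun n : ℕ => hasSum_avgProb μ hq0 (q * n)
  rw [← MeasureTheory.integral_zero (Fin m → ℝ) ℝ (μ := MeasureTheory.volume)]
  refine MeasureTheory.tendsto_integral_of_dominated_convergence
    (fun τ => (1 + (Λ.index : ℝ)⁻¹) * gaussExp C t⁻¹ τ) (fun n => ?_) (hG.const_mul _)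
    (fun n => Eventually.of_forall fun τ => ?_) (Eventually.of_forall fun τ => ?_)
  · have h1 := (continuous_cosetChar φ hΔ (hν n) (hνs n) (√(q * n : ℕ))⁻¹
      (((q * n : ℕ) : ℝ) • drift φ hΔ μ π) x).comp continuous_neg
    exact ((h1.sub (Complex.continuous_ofReal.comp (hcG1.const_mul _))).norm.mul
      hcG).aestronglyMeasurable
  · rw [norm_mul, norm_norm, Real.norm_of_nonneg (gaussExp_pos C t⁻¹ τ).le]
    refine mul_le_mul_of_nonneg_right ((norm_sub_le _ _).trans (add_le_add
      (norm_cosetChar_le φ hΔ (hν n) (hνs n) _ _ _ _) ?_)) (gaussExp_pos _ _ _).le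
    rw [Complex.norm_real, Real.norm_of_nonneg (mul_nonneg (inv_nonneg.2 hd.le)
      (gaussExp_pos _ _ _).le)]
    refine mul_le_of_le_one_right (inv_nonneg.2 hd.le) ?_
    rw [gaussExp, Real.exp_le_one_iff, neg_nonpos]
    exact div_nonneg (hC.quadForm_nonneg τ) (by norm_num)
  · have h1 := tendsto_char_avgProb φ hΔ hgen hq (isCorrector_sum φ hΔ hT hmom hf (-τ)) hT hmom
      (cosetIndicator x) hh hM hMh
    rw [cosetMean_cosetIndicator, ← dotProduct_covMatrix_mulVec φ hΔ hT hmom,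
      ← dotProduct_drift φ hΔ hT hmom hπ] at h1
    have e1 : Real.exp (-(-τ ⬝ᵥ C *ᵥ -τ / 2)) = gaussExp C 1 τ := by
      rw [gaussExp, mul_one, ← quadForm_neg C τ]; rfl
    rw [← hCdef, e1] at h1
    have h2 : Tendsto (fun n : ℕ => cosetChar φ hΔ (avgProb μ q (q * n)) (√(q * n : ℕ))⁻¹
        (((q * n : ℕ) : ℝ) • drift φ hΔ μ π) x (-τ)) atTop
        (𝓝 (((Λ.index : ℝ)⁻¹ * gaussExp C 1 τ : ℝ) : ℂ)) := by
      refine h1.congr fun n => ?_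
      rw [cosetChar]
      simp only [dotProduct_smul, smul_eq_mul]
    have h3 := ((h2.sub_const (((Λ.index : ℝ)⁻¹ * gaussExp C 1 τ : ℝ) : ℂ)).norm).mul_const
      (gaussExp C t⁻¹ τ)
    rwa [sub_self, norm_zero, zero_mul] at h3

end Fourier

/-! ### From a one-sided bound to ℓ¹ distance, and asymptotics of lattice sums -/

/-- One has |a - N| = (a - N) + 2(N - a)⁺, and the first term sums to 1 - S. The positive part is at
most |1-r|N + min(κ, N), and min(κ, N) ≤ √κ √N, which is summable; this replaces a truncation of the
tails. -/
theorem tsum_abs_sub_le_of_le {α : Type*} {a N : α → ℝ} (ha0 : ∀ x, 0 ≤ a x) (ha : HasSum a 1)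
    (hN0 : ∀ x, 0 ≤ N x) {S R r κ : ℝ} (hN : HasSum N S) (hκ : 0 ≤ κ)
    (hsq : HasSum (fun x => √(N x)) R) (h : ∀ x, r * N x - κ ≤ a x) :
    ∑' x, |a x - N x| ≤ 1 - S + 2 * (|1 - r| * S + √κ * R) := by
  have hs := (ha.sub hN).add (((hN.mul_left |1 - r|).add (hsq.mul_left √κ)).mul_left 2)
  refine (Summable.tsum_le_tsum (fun x => ?_) (ha.sub hN).summable.abs hs.summable).trans_eq
    hs.tsum_eq
  have h1 := mul_nonneg (abs_nonneg (1 - r)) (hN0 x)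
  have h2 := mul_nonneg (Real.sqrt_nonneg κ) (Real.sqrt_nonneg (N x))
  rcases le_total (N x) (a x) with hle | hle
  · rw [abs_of_nonneg (sub_nonneg.2 hle)]
    linarith
  · rw [abs_of_nonpos (sub_nonpos.2 hle)]
    suffices N x - a x ≤ |1 - r| * N x + √κ * √(N x) by linarith
    have h3 : (1 - r) * N x ≤ |1 - r| * N x := mul_le_mul_of_nonneg_right (le_abs_self _) (hN0 x)
    rcases le_total κ (N x) with hk | hk
    · have h4 : κ ≤ √κ * √(N x) := by
        calc κ = √κ * √κ := (Real.mul_self_sqrt hκ).symm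
          _ ≤ _ := by gcongr
      linarith [h x]
    · have h4 : N x ≤ √κ * √(N x) := by
        calc N x = √(N x) * √(N x) := (Real.mul_self_sqrt (hN0 x)).symm
          _ ≤ _ := by gcongr
      linarith [ha0 x]

section Lattice

variable {m : ℕ} {A : Matrix (Fin m) (Fin m) ℝ}

/-- The sum of a Gaussian over a shifted lattice. -/
def latticeSum (A : Matrix (Fin m) (Fin m) ℝ) (s : ℝ) (x : Fin m → ℝ) : ℝ :=
  ∑' w : Fin m → ℤ, gaussExp A s ((fun i => (w i : ℝ)) - x)

theorem Matrix.PosDef.hasSum_latticeSum (hA : A.PosDef) {s : ℝ} (hs : 0 < s) (x : Fin m → ℝ) :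
    HasSum (fun w : Fin m → ℤ => gaussExp A s ((fun i => (w i : ℝ)) - x)) (latticeSum A s x) :=
  (hA.summable_gaussExp hs x).hasSum

theorem Matrix.PosDef.latticeSum_pos (hA : A.PosDef) {s : ℝ} (hs : 0 < s) (x : Fin m → ℝ) :
    0 < latticeSum A s x :=
  (hA.summable_gaussExp hs x).tsum_pos (fun _ => (gaussExp_pos _ _ _).le) 0 (gaussExp_pos _ _ _)

theorem Matrix.PosDef.tendsto_latticeSum (hA : A.PosDef) {M : ℕ → ℝ} (hM : Tendsto M atTop atTop)
    {t : ℝ} (ht : 0 < t) (x : ℕ → Fin m → ℝ) :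
    Tendsto (fun n => latticeSum A (M n * t) (x n) / √(M n) ^ m) atTop
      (𝓝 (√t ^ m * ∫ z, gaussExp A 1 z)) := by
  have h := (hA.tendsto_tsum_gaussExp (hM.atTop_mul_const ht) x).const_mul (√t ^ m)
  refine h.congr fun n => ?_
  have h1 : 0 < √t := Real.sqrt_pos.2 ht
  rw [Real.sqrt_mul' _ ht.le, mul_pow, latticeSum]
  field_simp

theorem Matrix.PosDef.tendsto_latticeSum_div (hA : A.PosDef) {M : ℕ → ℝ}
    (hM : Tendsto M atTop atTop) {t t' : ℝ} (ht : 0 < t) (ht' : 0 < t')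
    (x x' : ℕ → Fin m → ℝ) :
    Tendsto (fun n => latticeSum A (M n * t) (x n) / latticeSum A (M n * t') (x' n)) atTop
      (𝓝 (√t ^ m / √t' ^ m)) := by
  have hJ := hA.integral_gaussExp_pos one_pos
  have h2 : 0 < √t' := Real.sqrt_pos.2 ht'
  have h := (hA.tendsto_latticeSum hM ht x).div (hA.tendsto_latticeSum hM ht' x') (by positivity)
  rw [mul_div_mul_right _ _ hJ.ne'] at h
  refine h.congr' ?_
  filter_upwards [hM.eventually_gt_atTop 0] with n hn
  have : 0 < √(M n) := Real.sqrt_pos.2 hn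
  exact div_div_div_cancel_right₀ (by positivity) _ _

theorem gaussExp_mul_exp (A : Matrix (Fin m) (Fin m) ℝ) (s : ℝ) (x : Fin m → ℝ) :
    gaussExp A s x * Real.exp (quadForm A x / (4 * s)) = gaussExp A (s * 2) x := by
  rw [gaussExp, gaussExp, ← Real.exp_add]
  congr 1
  simp only [div_eq_mul_inv, mul_inv]
  ring

theorem sqrt_gaussExp (A : Matrix (Fin m) (Fin m) ℝ) (s : ℝ) (x : Fin m → ℝ) :
    √(gaussExp A s x) = gaussExp A (s * 2) x := by
  rw [Real.sqrt_eq_iff_mul_self_eq (gaussExp_pos _ _ _).le (gaussExp_pos _ _ _).le, gaussExp,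
    gaussExp, ← Real.exp_add]
  congr 1
  simp only [div_eq_mul_inv, mul_inv]
  ring

theorem Matrix.PosDef.gaussExp_mono (hA : A.PosDef) {s t : ℝ} (hs : 0 < s) (hst : s ≤ t)
    (x : Fin m → ℝ) : gaussExp A s x ≤ gaussExp A t x := by
  rw [gaussExp, gaussExp, Real.exp_le_exp, neg_le_neg_iff]
  exact div_le_div_of_nonneg_left (hA.quadForm_nonneg x) (by positivity) (by linarith)

/-- Absorbs a first moment into a Gaussian of twice the variance, so that moments of the smoothing
weights become ratios of lattice sums. -/
theorem sqrt_le_sqrt_mul_exp {Q s : ℝ} (hQ : 0 ≤ Q) (hs : 0 < s) :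
    √Q ≤ √s * Real.exp (Q / (4 * s)) := by
  have h0 : Q = s * (Q / s) := by field_simp
  have h1 : √Q = √s * √(Q / s) := by rw [← Real.sqrt_mul hs.le, ← h0]
  rw [h1]
  gcongr
  -- The inequality √u ≤ u/4 + 1 is the square (√u/2 - 1)² ≥ 0, and u/4 + 1 ≤ e^(u/4).
  have h2 : √(Q / s) ≤ Q / (4 * s) + 1 := by
    have h3 := Real.sq_sqrt (div_nonneg hQ hs.le)
    have h4 : Q / (4 * s) = √(Q / s) ^ 2 / 4 := by rw [h3]; field_simp
    rw [h4]
    nlinarith [sq_nonneg (√(Q / s) / 2 - 1)]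
  exact h2.trans (Real.add_one_le_exp _)

end Lattice

/-! ### Cost of smoothing and comparison with the discretized Gaussian -/

section Final

variable {Γ : Type*} [Group Γ] {Λ : Subgroup Γ} {m : ℕ} {Δ : Set Γ}
  (φ : Λ ≃* Multiplicative (Fin m → ℤ)) (hΔ : Subgroup.IsComplement (Λ : Set Γ) Δ)
  {C : Matrix (Fin m) (Fin m) ℝ}

/-- The normalized Gaussian weights on `ℤ^m`. -/
def gaussWeight (A : Matrix (Fin m) (Fin m) ℝ) (s : ℝ) (w : Fin m → ℤ) : ℝ :=
  gaussExp A s (fun i => (w i : ℝ)) / latticeSum A s 0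

theorem Matrix.PosDef.gaussWeight_nonneg {A : Matrix (Fin m) (Fin m) ℝ} (hA : A.PosDef) {s : ℝ}
    (hs : 0 < s) (w : Fin m → ℤ) : 0 ≤ gaussWeight A s w :=
  div_nonneg (gaussExp_pos _ _ _).le (hA.latticeSum_pos hs 0).le

theorem Matrix.PosDef.hasSum_gaussWeight {A : Matrix (Fin m) (Fin m) ℝ} (hA : A.PosDef) {s : ℝ}
    (hs : 0 < s) : HasSum (gaussWeight A s) 1 := by
  have h := (hA.hasSum_latticeSum hs 0).div_const (latticeSum A s 0)
  rw [div_self (hA.latticeSum_pos hs 0).ne'] at h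
  exact h.of_eq (fun w => by rw [gaussWeight, sub_zero]) rfl

/-- Under the weights w has size about √(Mt), while translation by w costs B|w|/√(M+1) + η. The main
cost is therefore of order √t, whatever M is. -/
theorem tsum_abs_smoothing_gaussWeight_sub_le {A : Matrix (Fin m) (Fin m) ℝ} (hA : A.PosDef)
    {M t B c η : ℝ} (hM : 0 < M) (ht : 0 < t) (hB : 0 ≤ B) (hc0 : 0 ≤ c)
    (hc : ∀ x : Fin m → ℝ, ∑ i, |x i| ≤ c * √(quadForm A x))
    {ν : Γ → ℝ} (hν : ∀ γ, 0 ≤ ν γ) (hνs : HasSum ν 1)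
    (hreg : ∀ w : Fin m → ℤ, ∑' γ, |ν ((latticeElem φ w)⁻¹ * γ) - ν γ|
      ≤ B * (∑ i, |(w i : ℝ)|) / √(M + 1) + η) :
    ∑' γ, |smoothing φ (gaussWeight A (M * t)) ν γ - ν γ|
      ≤ B * c * √t * (latticeSum A (M * t * 2) 0 / latticeSum A (M * t) 0) + η := by
  have hs : 0 < M * t := mul_pos hM ht
  let D : (Fin m → ℤ) → ℝ := fun w =>
    B * c * √t * Real.exp (quadForm A (fun i => (w i : ℝ)) / (4 * (M * t))) + η
  have hD : ∀ w, ∑' γ, |ν ((latticeElem φ w)⁻¹ * γ) - ν γ| ≤ D w := fun w => by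
    refine (hreg w).trans (add_le_add ?_ le_rfl)
    have h1 := hc fun i => (w i : ℝ)
    have h2 := sqrt_le_sqrt_mul_exp (hA.quadForm_nonneg fun i => (w i : ℝ)) hs
    have h3 : 0 < √(M + 1) := Real.sqrt_pos.2 (by linarith)
    have h4 : √M ≤ √(M + 1) := Real.sqrt_le_sqrt (by linarith)
    rw [div_le_iff₀ h3]
    rw [Real.sqrt_mul hM.le] at h2
    set e := Real.exp (quadForm A (fun i => (w i : ℝ)) / (4 * (M * t)))
    have he : 0 < e := Real.exp_pos _
    calc B * ∑ i, |(w i : ℝ)| ≤ B * (c * (√M * √t * e)) := by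
          gcongr; exact h1.trans (by gcongr)
      _ ≤ B * (c * (√(M + 1) * √t * e)) := by gcongr
      _ = B * c * √t * e * √(M + 1) := by ring
  have hsum : HasSum (fun w => gaussWeight A (M * t) w * D w)
      (B * c * √t * (latticeSum A (M * t * 2) 0 / latticeSum A (M * t) 0) + η) := by
    have h1 := ((hA.hasSum_latticeSum (s := M * t * 2) (by positivity) 0).div_const
      (latticeSum A (M * t) 0)).mul_left (B * c * √t)
    have h2 := (hA.hasSum_gaussWeight hs).mul_right η
    rw [one_mul] at h2
    refine (h1.add h2).of_eq (fun w => ?_) rfl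
    simp only [D, gaussWeight]
    rw [sub_zero, ← gaussExp_mul_exp]
    ring
  rw [← hsum.tsum_eq]
  exact tsum_abs_smoothing_sub_le φ (fun w => hA.gaussWeight_nonneg hs w)
    (hA.hasSum_gaussWeight hs) hν hνs hD hsum.summable

variable [Λ.FiniteIndex]

omit [Λ.FiniteIndex] in
-- The determinant and the powers of 2π cancel between the density and its sum over ℤ^m.
theorem discreteGaussian_eq (hC : C.PosDef) {π : CosetSpace Λ → ℝ}
    (hπ : ∀ x, π x = 1 / (Λ.index : ℝ)) {n : ℕ} (hn : 0 < n) (ζ : Fin m → ℝ) (γ : Γ) :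
    discreteGaussian φ hΔ π n C ζ γ = (Λ.index : ℝ)⁻¹ *
      (gaussExp C⁻¹ n (realPhi φ hΔ γ - (n : ℝ) • ζ) / latticeSum C⁻¹ n 0) := by
  have hn' : (0 : ℝ) < n := by exact_mod_cast hn
  have hdet : 0 < ((n : ℝ) • C).det := by
    rw [Matrix.det_smul]
    have := hC.det_pos
    positivity
  set κ := 1 / ((2 * Real.pi) ^ ((m : ℝ) / 2) * Real.sqrt ((n : ℝ) • C).det) with hκ
  have hκ0 : κ ≠ 0 := by
    have := Real.sqrt_pos.2 hdet
    have := Real.pi_pos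
    positivity
  have hinv : ((n : ℝ) • C)⁻¹ = (n : ℝ)⁻¹ • C⁻¹ := by
    refine Matrix.inv_eq_left_inv ?_
    rw [smul_mul_smul_comm, Matrix.nonsing_inv_mul _ (hC.det_pos.ne'.isUnit),
      inv_mul_cancel₀ hn'.ne', one_smul]
  have hg : ∀ v, gaussDensity ((n : ℝ) • C) v = κ * gaussExp C⁻¹ n v := fun v => by
    rw [gaussDensity, gaussExp, quadForm, hinv, Matrix.smul_mulVec, dotProduct_smul, smul_eq_mul]
    congr 2
    field_simp
  rw [discreteGaussian, hπ]
  simp_rw [hg]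
  rw [tsum_mul_left]
  have h0 : ∑' w : Fin m → ℤ, gaussExp C⁻¹ n (fun i => (w i : ℝ)) = latticeSum C⁻¹ n 0 := by
    rw [latticeSum]; simp_rw [sub_zero]
  have h1 : (fun i => (Phi φ hΔ γ i : ℝ) - n * ζ i) = realPhi φ hΔ γ - (n : ℝ) • ζ := rfl
  have h2 := (hC.inv.latticeSum_pos hn' 0).ne'
  rw [h0, h1, one_div, one_div]
  field_simp

theorem hasSum_gaussExp_realPhi {A : Matrix (Fin m) (Fin m) ℝ} (hA : A.PosDef) {s : ℝ}
    (hs : 0 < s) (c : Fin m → ℝ) :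
    HasSum (fun γ => gaussExp A s (realPhi φ hΔ γ - c)) (Λ.index * latticeSum A s c) :=
  hasSum_comp_Phi φ hΔ (g := fun w => gaussExp A s ((fun i => (w i : ℝ)) - c))
    (hA.hasSum_latticeSum hs c)

/-- Comparison of a smoothed law with the discretized Gaussian. -/
theorem tsum_abs_smoothing_sub_discreteGaussian_le (hC : C.PosDef) {π : CosetSpace Λ → ℝ}
    (hπ : ∀ x, π x = 1 / (Λ.index : ℝ)) {n : ℕ} (hn : 0 < n) (ζ : Fin m → ℝ) {t : ℝ} (ht : 0 < t)
    {ν : Γ → ℝ} (hν : ∀ γ, 0 ≤ ν γ) (hνs : HasSum ν 1) :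
    ∑' γ, |smoothing φ (gaussWeight C⁻¹ (n * t)) ν γ - discreteGaussian φ hΔ π n C ζ γ|
      ≤ 1 - latticeSum C⁻¹ n ((n : ℝ) • ζ) / latticeSum C⁻¹ n 0 + 2 *
        (|1 - (∫ x, gaussExp C (1 + t)⁻¹ x) / (∫ x, gaussExp C t⁻¹ x) *
            (latticeSum C⁻¹ n 0 / latticeSum C⁻¹ (n * t) 0)| *
          (latticeSum C⁻¹ n ((n : ℝ) • ζ) / latticeSum C⁻¹ n 0) +
        √(charDefect φ hΔ C t ν (√n)⁻¹ ((n : ℝ) • ζ) * (Λ.index / ∫ x, gaussExp C t⁻¹ x) *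
          (latticeSum C⁻¹ (n * 2) ((n : ℝ) • ζ) / latticeSum C⁻¹ n 0 *
          (latticeSum C⁻¹ (n * 2) ((n : ℝ) • ζ) / latticeSum C⁻¹ (n * t) 0)))) := by
  have hn' : (0 : ℝ) < n := by exact_mod_cast hn
  have hA := hC.inv
  have hd := index_pos Λ
  have hs : 0 < (n : ℝ) * t := mul_pos hn' ht
  have hZ := hA.latticeSum_pos hs 0
  have hZ' := hA.latticeSum_pos hn' 0
  have hK := hC.integral_gaussExp_pos (inv_pos.2 ht)
  have hW := hA.latticeSum_pos (s := n * 2) (by positivity) ((n : ℝ) • ζ)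
  have hδ := charDefect_nonneg φ hΔ C t ν (√n)⁻¹ ((n : ℝ) • ζ)
  set Z := latticeSum C⁻¹ (n * t) 0 with hZdef
  set Z' := latticeSum C⁻¹ n 0
  set V := latticeSum C⁻¹ n ((n : ℝ) • ζ)
  set W := latticeSum C⁻¹ (n * 2) ((n : ℝ) • ζ)
  set K := ∫ x, gaussExp C t⁻¹ x
  set K' := ∫ x, gaussExp C (1 + t)⁻¹ x
  have hK' : 0 < K' := hC.integral_gaussExp_pos (inv_pos.2 (by positivity))
  set δ := charDefect φ hΔ C t ν (√n)⁻¹ ((n : ℝ) • ζ)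
  have hN := discreteGaussian_eq φ hΔ hC hπ hn ζ
  have hNs : HasSum (discreteGaussian φ hΔ π n C ζ) (V / Z') := by
    have h := ((hasSum_gaussExp_realPhi φ hΔ hA hn' ((n : ℝ) • ζ)).div_const Z').mul_left
      (Λ.index : ℝ)⁻¹
    refine h.of_eq hN ?_
    simp only [V]
    field_simp
  have hN0 : ∀ γ, 0 ≤ discreteGaussian φ hΔ π n C ζ γ := fun γ => by
    rw [hN]
    exact mul_nonneg (inv_nonneg.2 hd.le) (div_nonneg (gaussExp_pos _ _ _).le hZ'.le)
  have hsq : HasSum (fun γ => √(discreteGaussian φ hΔ π n C ζ γ))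
      (√((Λ.index : ℝ)⁻¹ / Z') * (Λ.index * W)) := by
    have h := (hasSum_gaussExp_realPhi φ hΔ hA (s := n * 2) (by positivity)
      ((n : ℝ) • ζ)).mul_left √((Λ.index : ℝ)⁻¹ / Z')
    refine h.of_eq (fun γ => ?_) rfl
    rw [hN, ← sqrt_gaussExp, ← Real.sqrt_mul (by positivity)]
    congr 1
    ring
  -- The Fourier estimate compares with variance n(1+t). That Gaussian dominates pointwise the one
  -- of variance n, so a lower bound in terms of the target follows.
  have hlow : ∀ γ, K' / K * (Z' / Z) * discreteGaussian φ hΔ π n C ζ γ - δ / (K * Z)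
      ≤ smoothing φ (gaussWeight C⁻¹ (n * t)) ν γ := fun γ => by
    have h1 := (abs_le.1 (abs_tsum_gaussExp_mul_sub_le φ hΔ hC ht hn' hν hνs
      ((n : ℝ) • ζ) γ)).1
    have h2 : ∑' w : Fin m → ℤ,
        gaussExp C⁻¹ (n * t) (fun i => (w i : ℝ)) * ν ((latticeElem φ w)⁻¹ * γ)
        = Z * smoothing φ (gaussWeight C⁻¹ (n * t)) ν γ := by
      rw [smoothing, ← tsum_mul_left]
      refine tsum_congr fun w => ?_
      rw [gaussWeight, ← hZdef]
      field_simp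
    rw [h2] at h1
    have h3 := hA.gaussExp_mono hn' (t := n * (1 + t)) (by nlinarith)
      (realPhi φ hΔ γ - (n : ℝ) • ζ)
    have h4 : (Λ.index : ℝ)⁻¹ * (K' * gaussExp C⁻¹ n (realPhi φ hΔ γ - (n : ℝ) • ζ))
        ≤ (Λ.index : ℝ)⁻¹ * (K' * gaussExp C⁻¹ (n * (1 + t)) (realPhi φ hΔ γ - (n : ℝ) • ζ)) := by
      gcongr
    rw [hN]
    have e : K' / K * (Z' / Z) * ((Λ.index : ℝ)⁻¹ *
        (gaussExp C⁻¹ n (realPhi φ hΔ γ - (n : ℝ) • ζ) / Z')) - δ / (K * Z)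
        = ((Λ.index : ℝ)⁻¹ * (K' * gaussExp C⁻¹ n (realPhi φ hΔ γ - (n : ℝ) • ζ)) - δ) / (K * Z) := by
      field_simp
    rw [e, div_le_iff₀ (by positivity)]
    linarith
  have h := tsum_abs_sub_le_of_le
    (smoothing_nonneg φ (fun w => hA.gaussWeight_nonneg hs w) hν)
    (hasSum_smoothing φ (fun w => hA.gaussWeight_nonneg hs w) (hA.hasSum_gaussWeight hs) hν hνs)
    hN0 hNs (κ := δ / (K * Z)) (by positivity) hsq hlow
  refine h.trans (le_of_eq ?_)
  congr 3
  -- Here κ = δ/(KZ) is of order δ n^(-m/2) and the sum of square roots is of order n^(m/4). Under a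
  -- single root the powers of n combine into ratios of lattice sums that converge.
  rw [← Real.sqrt_sq (show 0 ≤ (Λ.index : ℝ) * W by positivity), ← Real.sqrt_mul (by positivity),
    ← Real.sqrt_mul (by positivity)]
  congr 1
  field_simp

end Final

/-! ### The limits in n and then in the smoothing parameter -/

section Final

variable {Γ : Type*} [Group Γ] {Λ : Subgroup Γ} {m : ℕ} {Δ : Set Γ}
  (φ : Λ ≃* Multiplicative (Fin m → ℤ)) (hΔ : Subgroup.IsComplement (Λ : Set Γ) Δ)
  [Λ.FiniteIndex] {μ : PMF Γ} {T : Finset Γ}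

omit [Λ.FiniteIndex] in
-- The limit of the factor r in the lower bound for the smoothed law; it tends to 1 as t → 0.
theorem Matrix.PosDef.integral_gaussExp_div {C : Matrix (Fin m) (Fin m) ℝ} (hC : C.PosDef) {t : ℝ}
    (ht : 0 < t) : (∫ x, gaussExp C (1 + t)⁻¹ x) / (∫ x, gaussExp C t⁻¹ x) * (1 / √t ^ m)
      = √(1 + t)⁻¹ ^ m := by
  have hJ := hC.integral_gaussExp_pos one_pos
  have h1 := integral_gaussExp_mul C (inv_pos.2 ht) 1
  have h2 := integral_gaussExp_mul C (t := (1 + t)⁻¹) (by positivity) 1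
  rw [mul_one] at h1 h2
  have h3 : 0 < √t := Real.sqrt_pos.2 ht
  rw [h1, h2, Real.sqrt_inv t, inv_pow]
  field_simp

theorem summable_discreteGaussian {C : Matrix (Fin m) (Fin m) ℝ} (hC : C.PosDef)
    {π : CosetSpace Λ → ℝ} (hπ : ∀ x, π x = 1 / (Λ.index : ℝ)) {n : ℕ} (hn : 0 < n)
    (ζ : Fin m → ℝ) : Summable (discreteGaussian φ hΔ π n C ζ) := by
  have hn' : (0 : ℝ) < n := by exact_mod_cast hn
  have h := ((hasSum_gaussExp_realPhi φ hΔ hC.inv hn' ((n : ℝ) • ζ)).div_const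
    (latticeSum C⁻¹ n 0)).mul_left (Λ.index : ℝ)⁻¹
  exact (h.of_eq (discreteGaussian_eq φ hΔ hC hπ hn ζ) rfl).summable

/-- For fixed t, as n → ∞ only two errors survive: the cost of smoothing, of order √t, and the
mismatch between the variances 1 and 1+t. -/
theorem exists_tendsto_tsum_abs_avgProb_sub_le (hgen : Subsemigroup.closure μ.support = ⊤) {q : ℕ}
    (hq : IsPeriod μ q) (hT : Subgroup.closure (T : Set Γ) = ⊤)
    (hmom : FiniteSecondMoment (T : Set Γ) μ) {f : Fin m → CosetSpace Λ → ℝ}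
    (hf : ∀ i, IsCorrector φ hΔ μ (Pi.single i 1) (f i)) {π : CosetSpace Λ → ℝ}
    (hπ : ∀ x, π x = 1 / (Λ.index : ℝ)) {B c : ℝ} {η : ℕ → ℝ} (hB : 0 ≤ B) (hc0 : 0 ≤ c)
    (hc : ∀ x : Fin m → ℝ, ∑ i, |x i| ≤ c * √(quadForm (covMatrix φ hΔ μ f)⁻¹ x))
    (hη : Tendsto η atTop (𝓝 0))
    (hreg : ∀ (N : ℕ) (w : Fin m → ℤ), ∑' γ, |avgProb μ q N ((latticeElem φ w)⁻¹ * γ)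
      - avgProb μ q N γ| ≤ B * (∑ i, |(w i : ℝ)|) / √(N + 1) + η N) {t : ℝ} (ht : 0 < t) :
    ∃ u : ℕ → ℝ, Tendsto u atTop (𝓝 (B * c * √t * √2 ^ m + 2 * |1 - √(1 + t)⁻¹ ^ m|)) ∧
      ∀ᶠ n in atTop, ∑' γ, |avgProb μ q (q * n) γ - discreteGaussian φ hΔ π (q * n)
        (covMatrix φ hΔ μ f) (drift φ hΔ μ π) γ| ≤ u n := by
  have hC := posDef_covMatrix φ hΔ hgen hT hmom f
  have hδ := tendsto_charDefect φ hΔ hgen hq hT hmom hf hπ ht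
  set C := covMatrix φ hΔ μ f
  set ζ := drift φ hΔ μ π
  have hA := hC.inv
  have hq0 := hq.pos hgen
  have hM : Tendsto (fun n : ℕ => q * n) atTop atTop := tendsto_id.const_mul_atTop' hq0
  have hMr : Tendsto (fun n : ℕ => ((q * n : ℕ) : ℝ)) atTop atTop :=
    tendsto_natCast_atTop_atTop.comp hM
  have hK := hC.integral_gaussExp_pos (inv_pos.2 ht)
  have hst : 0 < √t := Real.sqrt_pos.2 ht
  have l1 := hA.tendsto_latticeSum_div hMr (t := t * 2) (t' := t) (by positivity) ht
    (fun _ => 0) fun _ => 0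
  have l2 := hA.tendsto_latticeSum_div hMr (t := 1) (t' := 1) one_pos one_pos
    (fun n => ((q * n : ℕ) : ℝ) • ζ) fun _ => 0
  have l3 := hA.tendsto_latticeSum_div hMr (t := 1) (t' := t) one_pos ht (fun _ => 0) fun _ => 0
  have l4 := hA.tendsto_latticeSum_div hMr (t := 2) (t' := 1) two_pos one_pos
    (fun n => ((q * n : ℕ) : ℝ) • ζ) fun _ => 0
  have l5 := hA.tendsto_latticeSum_div hMr (t := 2) (t' := t) two_pos ht
    (fun n => ((q * n : ℕ) : ℝ) • ζ) fun _ => 0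
  simp only [mul_one, Real.sqrt_one, one_pow, div_one] at l2 l3 l4
  have e1 : √(t * 2) ^ m / √t ^ m = √2 ^ m := by
    rw [Real.sqrt_mul ht.le, mul_pow]; field_simp
  rw [e1] at l1
  have k1 := (l1.const_mul (B * c * √t)).add (hη.comp hM)
  have k2 := l3.const_mul ((∫ x, gaussExp C (1 + t)⁻¹ x) / (∫ x, gaussExp C t⁻¹ x))
  rw [hC.integral_gaussExp_div ht] at k2
  have k3 := ((k2.const_sub 1).abs.mul l2).add
    ((hδ.mul_const (Λ.index / ∫ x, gaussExp C t⁻¹ x)).mul (l4.mul l5)).sqrt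
  have k4 := k1.add ((l2.const_sub 1).add (k3.const_mul 2))
  simp only [zero_mul, Real.sqrt_zero, add_zero, sub_self, zero_add, mul_one] at k4
  refine ⟨_, k4, ?_⟩
  filter_upwards [eventually_gt_atTop 0] with n hn
  have hn' : 0 < q * n := Nat.mul_pos hq0 hn
  have hnr : (0 : ℝ) < (q * n : ℕ) := by exact_mod_cast hn'
  have hν := avgProb_nonneg μ q (q * n)
  have hνs := hasSum_avgProb μ hq0 (q * n)
  have b1 := tsum_abs_smoothing_gaussWeight_sub_le φ hA hnr ht hB hc0 hc hν hνs (hreg (q * n))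
  have b2 := tsum_abs_smoothing_sub_discreteGaussian_le φ hΔ hC hπ hn' ζ ht hν hνs
  set a := smoothing φ (gaussWeight C⁻¹ (((q * n : ℕ) : ℝ) * t)) (avgProb μ q (q * n)) with ha
  set G := discreteGaussian φ hΔ π (q * n) C ζ with hG
  have hnt : 0 < ((q * n : ℕ) : ℝ) * t := mul_pos hnr ht
  have sa : Summable a := (hasSum_smoothing φ (fun w => hA.gaussWeight_nonneg hnt w)
    (hA.hasSum_gaussWeight hnt) hν hνs).summable
  have sG : Summable G := summable_discreteGaussian φ hΔ hC hπ hn' ζ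
  have s1 := (sa.sub hνs.summable).abs
  have s2 := (sa.sub sG).abs
  calc ∑' γ, |avgProb μ q (q * n) γ - G γ|
      ≤ ∑' γ, (|a γ - avgProb μ q (q * n) γ| + |a γ - G γ|) := by
        refine Summable.tsum_le_tsum (fun γ => ?_) (hνs.summable.sub sG).abs (s1.add s2)
        rw [abs_sub_comm (a γ)]
        exact abs_sub_le _ _ _
    _ = (∑' γ, |a γ - avgProb μ q (q * n) γ|) + ∑' γ, |a γ - G γ| := s1.tsum_add s2
    _ ≤ _ := by
        refine (add_le_add b1 b2).trans (le_of_eq ?_)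
        simp only [Function.comp_apply, mul_assoc]

theorem tendsto_tsum_abs_avgProb_sub [Λ.Normal]
    (hgen : Subsemigroup.closure μ.support = ⊤) {q : ℕ}
    (hq : IsPeriod μ q) (hT : Subgroup.closure (T : Set Γ) = ⊤)
    (hmom : FiniteSecondMoment (T : Set Γ) μ) {f : Fin m → CosetSpace Λ → ℝ}
    (hf : ∀ i, IsCorrector φ hΔ μ (Pi.single i 1) (f i)) {π : CosetSpace Λ → ℝ}
    (hπ : ∀ x, π x = 1 / (Λ.index : ℝ)) :
    Tendsto (fun n : ℕ => ∑' γ, |avgProb μ q (q * n) γ - discreteGaussian φ hΔ π (q * n)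
        (covMatrix φ hΔ μ f) (drift φ hΔ μ π) γ|) atTop (𝓝 0) := by
  have hC := posDef_covMatrix φ hΔ hgen hT hmom f
  obtain ⟨c, hc0, hc⟩ := hC.inv.exists_abs_apply_le
  obtain ⟨B, η, hB, hη, hreg⟩ := exists_tsum_abs_translate_avgProb_sub_le φ hgen hq
  have hU : Tendsto (fun t : ℝ => B * c * √t * √2 ^ m + 2 * |1 - √(1 + t)⁻¹ ^ m|) (𝓝[>] 0)
      (𝓝 0) := by
    have h1 : Tendsto (fun t : ℝ => (1 + t)⁻¹) (𝓝[>] 0) (𝓝 1) := by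
      have : Tendsto (fun t : ℝ => 1 + t) (𝓝[>] 0) (𝓝 (1 + 0)) :=
        (tendsto_id.const_add 1).mono_left nhdsWithin_le_nhds
      simpa using this.inv₀ (by norm_num)
    have h2 : Tendsto (fun t : ℝ => √t) (𝓝[>] 0) (𝓝 0) := by
      have := (Real.continuous_sqrt.tendsto 0).mono_left (nhdsWithin_le_nhds (s := Set.Ioi 0))
      rwa [Real.sqrt_zero] at this
    have h3 := ((h2.const_mul (B * c)).mul_const (√2 ^ m)).add
      (((h1.sqrt.pow m).const_sub 1).abs.const_mul 2)
    simpa using h3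
  rw [Metric.tendsto_atTop']
  intro ε hε
  -- The smoothing parameter is fixed in terms of ε before n grows.
  obtain ⟨t, htε, ht⟩ := ((hU.eventually_lt_const hε).and self_mem_nhdsWithin).exists
  obtain ⟨u, hu, hle⟩ := exists_tendsto_tsum_abs_avgProb_sub_le φ hΔ hgen hq hT hmom hf hπ hB hc0
    hc hη hreg ht
  obtain ⟨n₀, hn₀⟩ := (hle.and (hu.eventually_lt_const htε)).exists_forall_of_atTop
  refine ⟨n₀, fun n hn => ?_⟩
  rw [Real.dist_0_eq_abs, abs_of_nonneg (tsum_nonneg fun γ => abs_nonneg _)]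
  exact (hn₀ n hn.le).1.trans_lt (hn₀ n hn.le).2

theorem tendsto_tvDist_avgProb [Λ.Normal] (hgen : Subsemigroup.closure μ.support = ⊤) {q : ℕ}
    (hq : IsPeriod μ q) (hT : Subgroup.closure (T : Set Γ) = ⊤)
    (hmom : FiniteSecondMoment (T : Set Γ) μ) {f : Fin m → CosetSpace Λ → ℝ}
    (hf : ∀ i, IsCorrector φ hΔ μ (Pi.single i 1) (f i)) {π : CosetSpace Λ → ℝ}
    (hπ : ∀ x, π x = 1 / (Λ.index : ℝ)) :
    Tendsto (fun n : ℕ => tvDist (avgProb μ q (q * n)) (discreteGaussian φ hΔ π (q * n)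
        (covMatrix φ hΔ μ f) (drift φ hΔ μ π))) atTop (𝓝 0) := by
  have h := ENNReal.Tendsto.div_const (b := 2) (ENNReal.tendsto_ofReal
    (tendsto_tsum_abs_avgProb_sub φ hΔ hgen hq hT hmom hf hπ)) (Or.inr two_ne_zero)
  rw [ENNReal.ofReal_zero, ENNReal.zero_div] at h
  refine h.congr' ?_
  filter_upwards [eventually_gt_atTop 0] with n hn
  have hq0 := hq.pos hgen
  rw [tvDist, ENNReal.ofReal_tsum_of_nonneg fun _ => abs_nonneg _]
  exact ((hasSum_avgProb μ hq0 (q * n)).summable.sub (summable_discreteGaussian φ hΔ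
    (posDef_covMatrix φ hΔ hgen hT hmom f) hπ (Nat.mul_pos hq0 hn) _)).abs

end Final

end

theorem theorem4 {Γ : Type*} [Group Γ] (Λ : Subgroup Γ) [Λ.Normal] [Λ.FiniteIndex]
    {m : ℕ} (hm : 1 ≤ m) (φ : Λ ≃* Multiplicative (Fin m → ℤ))
    (Δ : Set Γ) (hΔ : Subgroup.IsComplement (Λ : Set Γ) Δ) (hid : (1 : Γ) ∈ Δ)
    (T : Finset Γ) (hT : Subgroup.closure (T : Set Γ) = ⊤)
    (μ : PMF Γ) (hmom : FiniteSecondMoment (T : Set Γ) μ)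
    (hgen : Subsemigroup.closure μ.support = ⊤)
    (q : ℕ) (hq : IsPeriod μ q) :
    (∃! π : CosetSpace Λ → ℝ, (quotientDiagram Λ μ).IsStationary π) ∧
    ∀ π : CosetSpace Λ → ℝ, (quotientDiagram Λ μ).IsStationary π →
      (∀ x, π x = 1 / (Λ.index : ℝ)) ∧
      (Summable fun e : QEdge Λ μ =>
        (quotientDiagram Λ μ).conductance π e • PhiEdge φ hΔ e) ∧
      (∀ v : Fin m → ℝ, ∃! u : QEdge Λ μ → ℝ,
        (quotientDiagram Λ μ).IsHarmonicPart π (hatForm φ hΔ μ v) u) ∧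
      ∃ C : Matrix (Fin m) (Fin m) ℝ, C.PosDef ∧
        (∀ (v₁ v₂ : Fin m → ℝ) (u₁ u₂ : QEdge Λ μ → ℝ),
          (quotientDiagram Λ μ).IsHarmonicPart π (hatForm φ hΔ μ v₁) u₁ →
          (quotientDiagram Λ μ).IsHarmonicPart π (hatForm φ hΔ μ v₂) u₂ →
          v₁ ⬝ᵥ C *ᵥ v₂ =
            ∑' e, u₁ e * u₂ e * (quotientDiagram Λ μ).conductance π e -
              (∑' e, u₁ e * (quotientDiagram Λ μ).conductance π e) *
                ∑' e, u₂ e * (quotientDiagram Λ μ).conductance π e) ∧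
        Tendsto (fun n : ℕ =>
          tvDist (fun γ => (q : ℝ)⁻¹ * ∑ i ∈ Finset.range q, (convPow μ (q * n + i) γ).toReal)
            (discreteGaussian φ hΔ π (q * n) C (drift φ hΔ μ π)))
          atTop (𝓝 0) := by
  refine ⟨existsUnique_isStationary hgen, fun π hstat => ?_⟩
  have hπ := (isStationary_iff hgen π).1 hstat
  choose f hf using fun i : Fin m => exists_isCorrector φ hΔ hgen (Pi.single i (1 : ℝ))
  exact ⟨hπ, (summable_conductance_smul_PhiEdge φ hΔ hT hmom hπ).summable,
    existsUnique_isHarmonicPart φ hΔ hgen hT hmom hπ, covMatrix φ hΔ μ f,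
    posDef_covMatrix φ hΔ hgen hT hmom f,
    covMatrix_apply_harmonicPart φ hΔ hgen hT hmom hπ hf,
    tendsto_tvDist_avgProb φ hΔ hgen hq hT hmom hf hπ⟩
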